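/- **Data.** Let $k$ be a field (in the original setting $k=\mathbb C$) and let $R,R'\in M_n(k)\otimes M_n(k)$ be invertible matrices such that $R$ obeys the quantum Yang–Baxter equation and, with $P$ the permutation matrix, (i) $R_{12}R_{13}R'_{23}=R'_{23}R_{13}R_{12}$ and $R_{23}R_{13}R'_{12}=R'_{12}R_{13}R_{23}$, (ii) $(PR+1)(PR'-1)=0$, (iii) $R_{21}R'_{12}=R'_{21}R_{12}$. Let $V(R')$ be the algebra with generators $1,p^1,\dots,p^n$ and relations $\mathbf p_1\mathbf p_2=R'_{12}\mathbf p_2\mathbf p_1$. Let $\lambda\in k^\times$ and let $A$ be a dual quasitriangular Hopf algebra that is generated as an algebra by a matrix $\mathbf t=(t^i{}_j)$ with $\Delta t^i{}_j=\sum_a t^i{}_a\otimes t^a{}_j$, $\epsilon(t^i{}_j)=\delta^i_j$ and $\mathcal R(\mathbf t_1\otimes\mathbf t_2)=\lambda R_{12}$. Let $H$ be the corresponding quantum enveloping algebra in FRT form: a Hopf algebra with a Hopf pairing with $A$ under which $A$ separates the elements of $H$, generated as an algebra by elements $l^{\pm i}{}_j$ with $\langle l^{+i}{}_j,a\rangle=\mathcal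 R(a\otimes t^i{}_j)$ and $\langle l^{-i}{}_j,a\rangle=\mathcal R^{-1}(t^i{}_j\otimes a)$ for all $a\in A$. Let $C$ be a Hopf algebra of functions $\mathbb Z\to k$, with pointwise product and $(\Delta f)(a,b)=f(a+b)$, which contains the function $\gamma(a)=\lambda^a$. Put $\tilde A=A\otimes k\mathbb Z$, where $k\mathbb Z$ has the invertible group-like generator $g$, with $\mathcal R(ag^m\otimes bg^n)=\lambda^{-mn}\mathcal R(a\otimes b)$, and $\tilde H=H\otimes C$, paired with $\tilde A$ by $\langle h\otimes c,ag^m\rangle=\langle h,a\rangle c(m)$. **Claim.** (a) $V(R')$ is a braided Hopf algebra in the braided category of left $\tilde H$-modules, with action $h\triangleright p^i=\sum_j\langle h,g^{-1}St^i{}_j\rangle p^j$ dual to the coaction $\mathbf p\mapsto g^{-1}\mathbf t^{-1}\mathbf p$ of $\tilde A$, with $\underline\Delta\mathbf p=\mathbf p\otimes1+1\otimes\mathbf p$, $\underline\epsilon(\mathbf p)=0$, $\underline S\mathbf p=-\mathbf p$, and with the braiding $\Psi(b\otimes c)=b^{(1)}\triangleright c\otimes b^{(2)}$ given by the left $\tilde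 H$-coaction $\beta(b)=b^{(1)}\otimes b^{(2)}=\mathcal R_{21}\triangleright b$; on generators $\Psi(\mathbf p_1\otimes\mathbf p_2)=R_{12}\mathbf p_2\otimes\mathbf p_1$. Here $\mathcal R$ is the formal quasitriangular structure of $\tilde H$, given as the map $\rho:\tilde A\to\tilde H$ with $\langle\rho(a),x\rangle=\mathcal R(x\otimes a)$, and $\mathcal R_{21}\triangleright b$ is defined by $\langle b^{(1)},a\rangle b^{(2)}=\rho(a)\triangleright b$ for all $a\in\tilde A$. (b) Its bosonization $V(R'){>\!\!\!\triangleleft}\tilde H$, that is $V(R')\otimes\tilde H$ with the semidirect product $hb=(h_{(1)}\triangleright b)h_{(2)}$ and the semidirect coproduct $\Delta b=b_{\underline{(1)}}b_{\underline{(2)}}{}^{(1)}\otimes b_{\underline{(2)}}{}^{(2)}$ (for $b\in V(R')$, $h\in\tilde H$, with $V(R')$ as a subalgebra and $\tilde H$ as a sub-Hopf algebra), is an ordinary Hopf algebra. In it $$\gamma\mathbf p=\lambda^{-1}\mathbf p\gamma,\quad \mathbf l^+_2\mathbf p_1=\lambda^{-1}R^{-1}_{12}\mathbf p_1\mathbf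 l^+_2,\quad \mathbf l^-_2\mathbf p_1=\lambda R_{21}\mathbf p_1\mathbf l^-_2,$$ $$\Delta\mathbf p=\mathbf p\otimes1+\mathbf l^-\gamma\otimes\mathbf p,\quad \Delta\mathbf l^\pm=\mathbf l^\pm\otimes\mathbf l^\pm,\quad \Delta\gamma=\gamma\otimes\gamma .$$ -/

import Mathlib

open scoped TensorProduct

noncomputable section

namespace QPoincare

/-! ### R-matrix data and the algebra of braided vectors -/

section Matrices

variable {k ι : Type*} [Field k] [Fintype ι] [DecidableEq ι]

/-- `M₁₂`. An element of `M_n ⊗ M_n` with entries `M^i_j^k_l` is the matrix whose entry in row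
`(i, k)` and column `(j, l)` is `M^i_j^k_l`. -/
def leg12 (M : Matrix (ι × ι) (ι × ι) k) : Matrix (ι × ι × ι) (ι × ι × ι) k :=
  Matrix.of fun x y => if x.2.2 = y.2.2 then M (x.1, x.2.1) (y.1, y.2.1) else 0

/-- `M₁₃`. -/
def leg13 (M : Matrix (ι × ι) (ι × ι) k) : Matrix (ι × ι × ι) (ι × ι × ι) k :=
  Matrix.of fun x y => if x.2.1 = y.2.1 then M (x.1, x.2.2) (y.1, y.2.2) else 0

/-- `M₂₃`. -/
def leg23 (M : Matrix (ι × ι) (ι × ι) k) : Matrix (ι × ι × ι) (ι × ι × ι) k :=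
  Matrix.of fun x y => if x.1 = y.1 then M (x.2.1, x.2.2) (y.2.1, y.2.2) else 0

/-- `M₂₁`. -/
def leg21 (M : Matrix (ι × ι) (ι × ι) k) : Matrix (ι × ι) (ι × ι) k :=
  M.submatrix Prod.swap Prod.swap

/-- The permutation matrix `P`. -/
def permMat (k ι : Type*) [Field k] [DecidableEq ι] : Matrix (ι × ι) (ι × ι) k :=
  Matrix.of fun x y => if x = y.swap then 1 else 0

/-- The conditions on `(R, R')` under which the braided (co)vectors form braided Hopf algebras. -/
structure IsBraidedVectorDatum (R R' : Matrix (ι × ι) (ι × ι) k) : Prop where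
  isUnit_R : IsUnit R
  isUnit_R' : IsUnit R'
  qybe : leg12 R * leg13 R * leg23 R = leg23 R * leg13 R * leg12 R
  mixed_left : leg12 R * leg13 R * leg23 R' = leg23 R' * leg13 R * leg12 R
  mixed_right : leg23 R * leg13 R * leg12 R' = leg12 R' * leg13 R * leg23 R
  hecke : (permMat k ι * R + 1) * (permMat k ι * R' - 1) = 0
  symm : leg21 R * R' = leg21 R' * R

/-- The relations `p₁ p₂ = R' p₂ p₁`, that is `p^i p^m = ∑ R'^i_a^m_b p^b p^a`. -/
inductive BraidedVectorRel (R' : Matrix (ι × ι) (ι × ι) k) :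
    FreeAlgebra k ι → FreeAlgebra k ι → Prop
  | rel (i m : ι) : BraidedVectorRel R' (FreeAlgebra.ι k i * FreeAlgebra.ι k m)
      (∑ a, ∑ b, R' (i, m) (a, b) • (FreeAlgebra.ι k b * FreeAlgebra.ι k a))

/-- The algebra `V(R')` of braided vectors. -/
abbrev BraidedVectors (R' : Matrix (ι × ι) (ι × ι) k) : Type _ :=
  RingQuot (BraidedVectorRel R')

/-- The generator `p^i` of `V(R')`. -/
def gen (R' : Matrix (ι × ι) (ι × ι) k) (i : ι) : BraidedVectors R' :=
  RingQuot.mkAlgHom k (BraidedVectorRel R') (FreeAlgebra.ι k i)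

end Matrices

/-! ### Dual quasitriangular Hopf algebras, matrix generators, FRT duals -/

section Duality

variable (k : Type*) [Field k]

/-- A dual quasitriangular structure on `A`, with its convolution inverse. -/
structure DualQuasitriangular (A : Type*) [Ring A] [HopfAlgebra k A] where
  form : A →ₗ[k] A →ₗ[k] k
  inv : A →ₗ[k] A →ₗ[k] k
  form_inv : LinearMap.mul' k k ∘ₗ TensorProduct.map (TensorProduct.lift form)
    (TensorProduct.lift inv) ∘ₗ Coalgebra.comul = Coalgebra.counit (R := k) (A := A ⊗[k] A)
  inv_form : LinearMap.mul' k k ∘ₗ TensorProduct.map (TensorProduct.lift inv)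
    (TensorProduct.lift form) ∘ₗ Coalgebra.comul = Coalgebra.counit (R := k) (A := A ⊗[k] A)
  /-- `𝓡(ab ⊗ c) = 𝓡(a ⊗ c₁) 𝓡(b ⊗ c₂)` -/
  form_mul_left : ∀ a b c, form (a * b) c =
    LinearMap.mul' k k (TensorProduct.map (form a) (form b) (Coalgebra.comul c))
  /-- `𝓡(a ⊗ bc) = 𝓡(a₁ ⊗ c) 𝓡(a₂ ⊗ b)` -/
  form_mul_right : ∀ a b c, form a (b * c) =
    LinearMap.mul' k k (TensorProduct.map (form.flip c) (form.flip b) (Coalgebra.comul a))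
  /-- `b₁ a₁ 𝓡(a₂ ⊗ b₂) = 𝓡(a₁ ⊗ b₁) a₂ b₂` -/
  quasi_comm : (TensorProduct.rid k A).toLinearMap ∘ₗ
      TensorProduct.map (LinearMap.mul' k A ∘ₗ (TensorProduct.comm k A A).toLinearMap)
        (TensorProduct.lift form) ∘ₗ Coalgebra.comul (R := k) (A := A ⊗[k] A) =
    (TensorProduct.lid k A).toLinearMap ∘ₗ
      TensorProduct.map (TensorProduct.lift form) (LinearMap.mul' k A) ∘ₗ Coalgebra.comul

variable {k}

/-- `A` is a matrix quantum group: it is generated as an algebra by the entries of a matrix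
coalgebra `t`, and its dual quasitriangular structure satisfies `𝓡(t₁ ⊗ t₂) = Q₁₂`. -/
structure IsMatrixQuantumGroup {ι : Type*} [Fintype ι] [DecidableEq ι]
    {A : Type*} [Ring A] [HopfAlgebra k A]
    (r : DualQuasitriangular k A) (t : Matrix ι ι A) (Q : Matrix (ι × ι) (ι × ι) k) : Prop where
  comul_t : ∀ i j, Coalgebra.comul (R := k) (t i j) = ∑ a, t i a ⊗ₜ[k] t a j
  counit_t : ∀ i j, Coalgebra.counit (R := k) (t i j) = if i = j then 1 else 0
  adjoin_t : Algebra.adjoin k {x | ∃ i j, x = t i j} = ⊤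
  form_t : ∀ i j m l, r.form (t i j) (t m l) = Q (i, m) (j, l)

variable (k) in
/-- A Hopf pairing of `H` with `A`. -/
structure HopfPairing (H A : Type*) [Ring H] [HopfAlgebra k H] [Ring A] [HopfAlgebra k A] where
  toFun : H →ₗ[k] A →ₗ[k] k
  one_left : ∀ a, toFun 1 a = Coalgebra.counit a
  one_right : ∀ h, toFun h 1 = Coalgebra.counit h
  mul_left : ∀ g h a, toFun (g * h) a =
    LinearMap.mul' k k (TensorProduct.map (toFun g) (toFun h) (Coalgebra.comul a))
  mul_right : ∀ h a b, toFun h (a * b) =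
    LinearMap.mul' k k (TensorProduct.map (toFun.flip a) (toFun.flip b) (Coalgebra.comul h))

/-- `H` is the quantum enveloping algebra in FRT form that corresponds to `(A, 𝓡, t)`: a Hopf
algebra of linear functionals on `A`, generated as an algebra by the functionals
`l⁺^i_j = 𝓡( - ⊗ t^i_j)` and `l⁻^i_j = 𝓡⁻¹(t^i_j ⊗ - )`. -/
structure IsFRTEnveloping {ι : Type*} {A H : Type*} [Ring A] [HopfAlgebra k A]
    [Ring H] [HopfAlgebra k H] (r : DualQuasitriangular k A) (t : Matrix ι ι A)
    (pair : HopfPairing k H A) (lp lm : Matrix ι ι H) : Prop where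
  separating : ∀ h, (∀ a, pair.toFun h a = 0) → h = 0
  pair_lp : ∀ i j a, pair.toFun (lp i j) a = r.form a (t i j)
  pair_lm : ∀ i j a, pair.toFun (lm i j) a = r.inv (t i j) a
  adjoin_l : Algebra.adjoin k ({x | ∃ i j, x = lp i j} ∪ {x | ∃ i j, x = lm i j}) = ⊤

variable (k) in
/-- `C` is a Hopf algebra of functions on the group `ℤ`: `(fg)(m) = f(m) g(m)`,
`(Δf)(m, n) = f(m + n)`, `ε(f) = f(0)`. -/
structure IntFunctions (C : Type*) [Ring C] [HopfAlgebra k C] where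
  eval : C →ₐ[k] (ℤ → k)
  injective : Function.Injective eval
  eval_add : ∀ c m n, eval c (m + n) = LinearMap.mul' k k
    (TensorProduct.map (LinearMap.proj m ∘ₗ eval.toLinearMap)
      (LinearMap.proj n ∘ₗ eval.toLinearMap) (Coalgebra.comul c))
  eval_zero : ∀ c, eval c 0 = Coalgebra.counit c

/-- The linear map on the group algebra of `ℤ` with `g^m ↦ f m`. -/
def zLift {N : Type*} [AddCommGroup N] [Module k N] (f : ℤ → N) :
    LaurentPolynomial k →ₗ[k] N :=
  Finsupp.linearCombination k f ∘ₗ (AddMonoidAlgebra.coeffLinearEquiv k).toLinearMap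

/-- The extended quantum function algebra `Ã = A ⊗ kℤ`; `g = 1 ⊗ T`. -/
abbrev ExtA (k A : Type*) [Field k] [Ring A] [HopfAlgebra k A] : Type _ :=
  A ⊗[k] LaurentPolynomial k

/-- The dual quasitriangular form on `Ã`,
`𝓡(a g^m ⊗ b g^n) = 𝓡(a ⊗ b) lam^(-mn)`. -/
def extForm {A : Type*} [Ring A] [HopfAlgebra k A] (r : DualQuasitriangular k A) (lam : k) :
    ExtA k A →ₗ[k] ExtA k A →ₗ[k] k :=
  (TensorProduct.map₂ r.form (zLift fun m => zLift fun n => lam ^ (-(m * n)))).compr₂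
    (LinearMap.mul' k k)

/-- The pairing of `H̃ = H ⊗ C` with `Ã`, `⟨h ⊗ c, a g^m⟩ = ⟨h, a⟩ c(m)`. -/
def extPair {A H C : Type*} [Ring A] [HopfAlgebra k A] [Ring H] [HopfAlgebra k H]
    [Ring C] [HopfAlgebra k C] (pair : HopfPairing k H A) (F : IntFunctions k C) :
    H ⊗[k] C →ₗ[k] ExtA k A →ₗ[k] k :=
  (TensorProduct.map₂ pair.toFun
    (zLift fun m => LinearMap.proj m ∘ₗ F.eval.toLinearMap).flip).compr₂ (LinearMap.mul' k k)

end Duality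

/-! ### Braided Hopf algebras over a Hopf algebra, and bosonization -/

section Bosonization

variable {k H B : Type*} [Field k] [Ring H] [HopfAlgebra k H] [Ring B] [Algebra k B]

/-- `h ▷ (b ⊗ c) = h₁ ▷ b ⊗ h₂ ▷ c`. -/
def tensorAct (act : H →ₗ[k] B →ₗ[k] B) (h : H) : B ⊗[k] B →ₗ[k] B ⊗[k] B :=
  TensorProduct.homTensorHomMap (RingHom.id k) B B B B (TensorProduct.map act act (Coalgebra.comul h))

/-- The tensor product coaction `b ⊗ c ↦ b⁽¹⁾ c⁽¹⁾ ⊗ b⁽²⁾ ⊗ c⁽²⁾`, where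
`coact b = b⁽¹⁾ ⊗ b⁽²⁾`. -/
def tensorCoact (coact : B →ₗ[k] H ⊗[k] B) : B ⊗[k] B →ₗ[k] H ⊗[k] (B ⊗[k] B) :=
  (LinearMap.mul' k H).rTensor (B ⊗[k] B) ∘ₗ
    (TensorProduct.tensorTensorTensorComm k H B H B).toLinearMap ∘ₗ TensorProduct.map coact coact

/-- The braiding `Ψ(b ⊗ c) = b⁽¹⁾ ▷ c ⊗ b⁽²⁾`. -/
def braiding (act : H →ₗ[k] B →ₗ[k] B) (coact : B →ₗ[k] H ⊗[k] B) :
    B ⊗[k] B →ₗ[k] B ⊗[k] B :=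
  (TensorProduct.lift act).rTensor B ∘ₗ (TensorProduct.rightComm k H B B).toLinearMap ∘ₗ
    coact.rTensor B

/-- The multiplication `(a ⊗ b)(c ⊗ d) = a Ψ(b ⊗ c) d` of the braided tensor product. -/
def braidedMul (Ψ : B ⊗[k] B →ₗ[k] B ⊗[k] B) :
    (B ⊗[k] B) ⊗[k] (B ⊗[k] B) →ₗ[k] B ⊗[k] B :=
  TensorProduct.map (LinearMap.mul' k B) (LinearMap.mul' k B) ∘ₗ
    (TensorProduct.assoc k B B (B ⊗[k] B)).symm.toLinearMap ∘ₗ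
    ((TensorProduct.assoc k B B B).toLinearMap ∘ₗ Ψ.rTensor B ∘ₗ
      (TensorProduct.assoc k B B B).symm.toLinearMap).lTensor B ∘ₗ
    (TensorProduct.assoc k B B (B ⊗[k] B)).toLinearMap

variable (k H B) in
/-- A braided Hopf algebra structure on the algebra `B`, in the category of left `H`-modules and
compatible left `H`-comodules with the braiding `Ψ(b ⊗ c) = b⁽¹⁾ ▷ c ⊗ b⁽²⁾`. -/
structure BraidedHopfStructure where
  act : H →ₗ[k] B →ₗ[k] B
  coact : B →ₗ[k] H ⊗[k] B
  comul : B →ₗ[k] B ⊗[k] B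
  counit : B →ₗ[k] k
  antipode : B →ₗ[k] B
  -- `B` is an `H`-module
  one_act : ∀ b, act 1 b = b
  mul_act : ∀ g h b, act (g * h) b = act g (act h b)
  -- `B` is an `H`-comodule
  coassoc_coact : (TensorProduct.assoc k H H B).toLinearMap ∘ₗ
    (Coalgebra.comul (R := k) (A := H)).rTensor B ∘ₗ coact = coact.lTensor H ∘ₗ coact
  counit_coact : ∀ b, (Coalgebra.counit (R := k) (A := H)).rTensor B (coact b) = 1 ⊗ₜ b
  -- compatibility: `h₁ b⁽¹⁾ ⊗ h₂ ▷ b⁽²⁾ = (h₁ ▷ b)⁽¹⁾ h₂ ⊗ (h₁ ▷ b)⁽²⁾`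
  compat : ∀ h b,
    TensorProduct.homTensorHomMap (RingHom.id k) H B H B
        (TensorProduct.map (LinearMap.mul k H) act (Coalgebra.comul h)) (coact b) =
      (LinearMap.mul' k H).rTensor B (TensorProduct.rightComm k H B H
        ((coact ∘ₗ act.flip b).rTensor H (Coalgebra.comul h)))
  -- unit and product are morphisms
  act_one : ∀ h, act h 1 = Coalgebra.counit (R := k) h • (1 : B)
  act_mul : ∀ h, act h ∘ₗ LinearMap.mul' k B = LinearMap.mul' k B ∘ₗ tensorAct act h
  coact_one : coact 1 = 1 ⊗ₜ 1
  coact_mul : coact ∘ₗ LinearMap.mul' k B =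
    (LinearMap.mul' k B).lTensor H ∘ₗ tensorCoact coact
  -- coproduct, counit and antipode are morphisms
  comul_act : ∀ h b, comul (act h b) = tensorAct act h (comul b)
  comul_coact : tensorCoact coact ∘ₗ comul = comul.lTensor H ∘ₗ coact
  counit_act : ∀ h b, counit (act h b) = Coalgebra.counit (R := k) h * counit b
  coact_counit : ∀ b, counit.lTensor H (coact b) = 1 ⊗ₜ counit b
  antipode_act : ∀ h b, antipode (act h b) = act h (antipode b)
  antipode_coact : coact ∘ₗ antipode = antipode.lTensor H ∘ₗ coact
  -- `B` is a coalgebra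
  coassoc : (TensorProduct.assoc k B B B).toLinearMap ∘ₗ comul.rTensor B ∘ₗ comul =
    comul.lTensor B ∘ₗ comul
  counit_left : ∀ b, counit.rTensor B (comul b) = 1 ⊗ₜ b
  counit_right : ∀ b, counit.lTensor B (comul b) = b ⊗ₜ 1
  -- coproduct and counit are multiplicative, the former into the braided tensor product
  comul_one : comul 1 = 1 ⊗ₜ 1
  comul_mul : comul ∘ₗ LinearMap.mul' k B =
    braidedMul (braiding act coact) ∘ₗ TensorProduct.map comul comul
  counit_one : counit 1 = 1
  counit_mul : ∀ b c, counit (b * c) = counit b * counit c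
  -- the antipode
  mul_antipode_left : ∀ b, LinearMap.mul' k B (antipode.rTensor B (comul b)) =
    counit b • (1 : B)
  mul_antipode_right : ∀ b, LinearMap.mul' k B (antipode.lTensor B (comul b)) =
    counit b • (1 : B)

/-- The ordinary Hopf algebra `P` is the bosonization `B ⋊ H`, with `j` and `i` the inclusions of
`B` and `H`: it is `B ⊗ H` with the semidirect product and the semidirect coproduct. -/
structure IsBosonization (S : BraidedHopfStructure k H B) {P : Type*} [Ring P] [HopfAlgebra k P]
    (j : B →ₐ[k] P) (i : H →ₐc[k] P) : Prop where
  bijective : Function.Bijective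
    (LinearMap.mul' k P ∘ₗ TensorProduct.map j.toLinearMap (i : H →ₗ[k] P))
  /-- `h b = (h₁ ▷ b) h₂` -/
  cross : ∀ h b, i h * j b = LinearMap.mul' k P
    (TensorProduct.map (j.toLinearMap ∘ₗ S.act.flip b) (i : H →ₗ[k] P) (Coalgebra.comul h))
  /-- `Δ b = b₁ b₂⁽¹⁾ ⊗ b₂⁽²⁾` with the braided coproduct of `b` on the right hand side -/
  comul_j : ∀ b, Coalgebra.comul (R := k) (j b) =
    (LinearMap.mul' k P).rTensor P ((TensorProduct.assoc k P P P).symm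
      (TensorProduct.map j.toLinearMap
        (TensorProduct.map (i : H →ₗ[k] P) j.toLinearMap ∘ₗ S.coact) (S.comul b)))
  counit_j : ∀ b, Coalgebra.counit (R := k) (j b) = S.counit b

/-- The coaction is `β(b) = 𝓡₂₁ ▷ b`, for the universal R-matrix of `H` given as the map
`a ↦ 𝓡⁽¹⁾⟨𝓡⁽²⁾, a⟩` from `A` to `H`: this map represents `form`, that is
`⟨𝓡⁽¹⁾, x⟩⟨𝓡⁽²⁾, a⟩ = form x a`, and `⟨b⁽¹⁾, a⟩ b⁽²⁾ = 𝓡⁽¹⁾⟨𝓡⁽²⁾, a⟩ ▷ b`. -/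
def IsCoactionOfForm {A : Type*} [Ring A] [Algebra k A] (pair : H →ₗ[k] A →ₗ[k] k)
    (form : A →ₗ[k] A →ₗ[k] k) (act : H →ₗ[k] B →ₗ[k] B) (coact : B →ₗ[k] H ⊗[k] B) : Prop :=
  ∃ ρ : A →ₗ[k] H, (∀ a x, pair (ρ a) x = form x a) ∧
    ∀ a b, TensorProduct.lid k B ((pair.flip a).rTensor B (coact b)) = act (ρ a) b

end Bosonization

end QPoincare

end

open QPoincare

universe uk uι uA uH uC

/-! `V(R')` is given by generators and relations, so each structure map is obtained by finding an
algebra in which the candidate images of the `p^i` satisfy `p₁ p₂ = R' p₂ p₁`. The action is an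
algebra map into the convolution algebra `Hom(K, V)`, the coaction one into `K ⊗ V`. The coproduct
is an algebra map into `End(V ⊗ V)`, sending `p^i` to left multiplication by `p^i ⊗ 1 + 1 ⊗ p^i` in
the braided tensor square. The antipode is one into `End V`, through the braided opposite product.
With operators in place of a braided tensor product algebra, no associativity of the latter has to
be known beforehand. All axioms are then proved by induction on monomials `p^i c`.

What a Hopf algebra `K` must supply for this is collected in `IsBraidedVectorAction`: functionals
`τ` (the action) and elements `l` (the coaction). Both obey `X₁ X₂ R' = R' X₂ X₁`, and `τ(l)` is
`R`. The identity `exch` is the Yetter–Drinfeld compatibility on generators; it lies behind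
compatibility of action and coaction, equivariance of coproduct and antipode, and the coproduct of
the bosonization. The matrix conditions enter as follows: (ii) and (iii) say that a sum of two
braided-commuting solutions of the relations is again a solution (`SatisfiesRel.add`), which gives
the coproduct. Condition (iii) also gives the antipode. The two conditions (i) give the intertwining
property of `τ` and `l`.

For `H̃` one takes `τ = ⟨ - , g⁻¹ S t⟩` and `l = l⁻ γ`. Intertwining of `⟨h, S t S t⟩` is checked on
the generators `l^±` and propagates to products (`pair_antipode_intertwines`); the relation for `l⁻`
is the same fact read through the universal R-matrix (`lm_rel`). `exch` is quasi-commutativity of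
`A` evaluated on `S t`. The pairing of `l⁻` with `S t` is `λ R`, and the value `γ(-1) = λ⁻¹` cancels
the `λ`: this is why the extension by `g` is needed.

The bosonization is built on `V ⊗ K` as a semidirect product whose coproduct and counit are algebra
maps determined on `p^i` and on `K`; its antipode is `b h ↦ S(h) S(b⁽¹⁾) S(b⁽²⁾)`, where the last
`S` is the braided antipode. -/

noncomputable section

namespace QPoincare

/-! ### Presentation of the algebra of braided vectors, and matrices intertwining its relations. -/

section Relations

variable {k ι : Type*} [Field k] [Fintype ι]

/-- The family `x` satisfies the relations of the braided vectors. -/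
def SatisfiesRel (R' : Matrix (ι × ι) (ι × ι) k) {Z : Type*} [Semiring Z] [Algebra k Z]
    (x : ι → Z) : Prop :=
  ∀ i m, x i * x m = ∑ a, ∑ b, R' (i, m) (a, b) • (x b * x a)

variable {R' : Matrix (ι × ι) (ι × ι) k} {Z : Type*} [Semiring Z] [Algebra k Z]

theorem gen_satisfiesRel : SatisfiesRel R' (gen R') := fun i m => by
  have h := RingQuot.mkAlgHom_rel k (BraidedVectorRel.rel (R' := R') i m)
  simpa [gen] using h

/-- The algebra map out of `V(R')` given by a family satisfying the relations. -/
def liftGen (x : ι → Z) (hx : SatisfiesRel R' x) : BraidedVectors R' →ₐ[k] Z :=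
  RingQuot.liftAlgHom k ⟨FreeAlgebra.lift k x, by
    rintro _ _ ⟨i, m⟩
    simpa using hx i m⟩

@[simp]
theorem liftGen_gen (x : ι → Z) (hx : SatisfiesRel R' x) (i : ι) :
    liftGen x hx (gen R' i) = x i := by
  simp [liftGen, gen]

theorem SatisfiesRel.map {W : Type*} [Semiring W] [Algebra k W] {x : ι → Z} (hx : SatisfiesRel R' x)
    (f : Z →ₐ[k] W) : SatisfiesRel R' fun i => f (x i) := fun i m => by
  simpa using congrArg f (hx i m)

theorem algHom_ext_gen {f g : BraidedVectors R' →ₐ[k] Z} (h : ∀ i, f (gen R' i) = g (gen R' i)) :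
    f = g := by
  apply RingQuot.ringQuot_ext'
  ext i
  exact h i

/-- Induction on monomials, by multiplication with a generator on the left. -/
theorem gen_induction {p : BraidedVectors R' → Prop} (one : p 1)
    (add : ∀ b c, p b → p c → p (b + c)) (smul : ∀ (a : k) b, p b → p (a • b))
    (gen_mul : ∀ i c, p c → p (gen R' i * c)) (b : BraidedVectors R') : p b := by
  obtain ⟨x, rfl⟩ := RingQuot.mkAlgHom_surjective k (BraidedVectorRel R') b
  suffices ∀ x y : FreeAlgebra k ι, p (RingQuot.mkAlgHom k (BraidedVectorRel R') y) →
      p (RingQuot.mkAlgHom k (BraidedVectorRel R') (x * y)) by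
    simpa using this x 1 (by simpa using one)
  intro x
  induction x using FreeAlgebra.induction with
  | grade0 r =>
    intro y hy
    rw [← Algebra.smul_def, map_smul]
    exact smul _ _ hy
  | grade1 i =>
    intro y hy
    rw [map_mul]
    exact gen_mul i _ hy
  | mul a b ha hb =>
    intro y hy
    rw [mul_assoc]
    exact ha _ (hb _ hy)
  | add a b ha hb =>
    intro y hy
    rw [add_mul, map_add]
    exact add _ _ (ha _ hy) (hb _ hy)

/-- Matrix elements `X` with `X₁ X₂ R' = R' X₂ X₁`. -/
def IntertwinesRel (R' : Matrix (ι × ι) (ι × ι) k) (X : ι → ι → Z) : Prop :=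
  ∀ i m c d, ∑ j, ∑ l, R' (j, l) (c, d) • (X i j * X m l) =
    ∑ a, ∑ b, R' (i, m) (a, b) • (X b d * X a c)

theorem IntertwinesRel.map {W : Type*} [Semiring W] [Algebra k W] {X : ι → ι → Z}
    (hX : IntertwinesRel R' X) (f : Z →ₐ[k] W) : IntertwinesRel R' fun i j => f (X i j) :=
  fun i m c d => by simpa using congrArg f (hX i m c d)

theorem sum4_comm {M : Type*} [AddCommMonoid M] (f : ι → ι → ι → ι → M) :
    ∑ a, ∑ b, ∑ c, ∑ d, f a b c d = ∑ c, ∑ d, ∑ a, ∑ b, f a b c d := by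
  have := Finset.sum_comm (s := Finset.univ) (t := Finset.univ)
    (f := fun p q : ι × ι => f p.1 p.2 q.1 q.2)
  simpa only [Fintype.sum_prod_type] using this

theorem sum4_rotate {M : Type*} [AddCommMonoid M] (f : ι → ι → ι → ι → M) :
    ∑ a, ∑ b, ∑ c, ∑ d, f a b c d = ∑ d, ∑ a, ∑ b, ∑ c, f a b c d := by
  have := Finset.sum_comm (s := Finset.univ) (t := Finset.univ)
    (f := fun (p : ι × ι × ι) d => f p.1 p.2.1 p.2.2 d)
  simpa only [Fintype.sum_prod_type] using this

/-- With `X₁ X₂ R' = R' X₂ X₁` and `g₁₂ = R' g₂₁`, one inserts `R'` into `g`, moves it through `X₁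
X₂`, and it comes out on the left. The bilinear `F` covers the three uses: products of commuting
families, the action, and the braided opposite product. -/
theorem IntertwinesRel.pairing {X : ι → ι → Z} (hX : IntertwinesRel R' X) {V W : Type*}
    [AddCommMonoid V] [Module k V] [AddCommMonoid W] [Module k W] (g : ι → ι → V)
    (hg : ∀ j l, g j l = ∑ c, ∑ d, R' (j, l) (c, d) • g d c) (F : Z →ₗ[k] V →ₗ[k] W) (i m : ι) :
    ∑ j, ∑ l, F (X i j * X m l) (g j l) =
      ∑ a, ∑ b, R' (i, m) (a, b) • ∑ j, ∑ l, F (X b j * X a l) (g j l) := by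
  calc ∑ j, ∑ l, F (X i j * X m l) (g j l)
      = ∑ j, ∑ l, ∑ c, ∑ d, F (R' (j, l) (c, d) • (X i j * X m l)) (g d c) := by
        refine Finset.sum_congr rfl fun j _ => Finset.sum_congr rfl fun l _ => ?_
        conv_lhs => rw [hg j l]
        simp
    _ = ∑ c, ∑ d, F (∑ j, ∑ l, R' (j, l) (c, d) • (X i j * X m l)) (g d c) := by
        rw [sum4_comm]
        simp
    _ = ∑ c, ∑ d, ∑ a, ∑ b, R' (i, m) (a, b) • F (X b d * X a c) (g d c) := by
        simp [hX i m]
    _ = _ := by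
        rw [sum4_comm]
        simp only [Finset.smul_sum]
        exact Finset.sum_congr rfl fun a _ => Finset.sum_congr rfl fun b _ => Finset.sum_comm

/-- If the entries of `X` commute with the `x j` then `∑ X i j * x j` satisfies the relations. -/
theorem IntertwinesRel.satisfiesRel {X : ι → ι → Z} (hX : IntertwinesRel R' X) {x : ι → Z}
    (hx : SatisfiesRel R' x) (hc : ∀ i j m, x m * X i j = X i j * x m) :
    SatisfiesRel R' fun i => ∑ j, X i j * x j := fun i m => by
  have key (i m : ι) : (∑ j, X i j * x j) * (∑ l, X m l * x l) =
      ∑ j, ∑ l, LinearMap.mul k Z (X i j * X m l) (x j * x l) := by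
    rw [Finset.sum_mul_sum]
    refine Finset.sum_congr rfl fun j _ => Finset.sum_congr rfl fun l _ => ?_
    rw [LinearMap.mul_apply', mul_assoc, ← mul_assoc (x j), hc, mul_assoc, mul_assoc]
  simp only [key]
  exact hX.pairing (fun j l => x j * x l) hx _ i m

end Relations

/-! ### The Hecke-type condition and additivity of solutions. -/

section RMatrix

variable {k ι : Type*} [Field k] [Fintype ι] [DecidableEq ι] {R R' : Matrix (ι × ι) (ι × ι) k}

theorem permMat_mul_apply (M : Matrix (ι × ι) (ι × ι) k) (x y : ι × ι) :
    (permMat k ι * M) x y = M x.swap y := by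
  rw [Matrix.mul_apply, Finset.sum_eq_single x.swap]
  · simp [permMat]
  · intro b _ hb
    have : x ≠ b.swap := fun h => hb (by simp [h])
    simp [permMat, this]
  · simp

/-- Condition (iii) says that `PR` and `PR'` commute; these are its entries. -/
theorem IsBraidedVectorDatum.coeff_symm (h : IsBraidedVectorDatum R R') (s l n j : ι) :
    ∑ c, ∑ d, R' (s, l) (c, d) * R (d, c) (j, n) =
      ∑ c, ∑ d, R (s, l) (c, d) * R' (d, c) (j, n) := by
  have := congrFun (congrFun h.symm (l, s)) (j, n)
  simp only [Matrix.mul_apply, Fintype.sum_prod_type, leg21, Matrix.submatrix_apply,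
    Prod.swap_prod_mk] at this
  rw [Finset.sum_comm, ← this, Finset.sum_comm]

/-- Expanding (ii) and commuting `PR` past `PR'` gives `1 + PR = PR' + PR' PR`; multiplication by
`P` turns this into `P + R = R' + R' P R`. -/
theorem IsBraidedVectorDatum.coeff_hecke (h : IsBraidedVectorDatum R R') (i m u v : ι) :
    (if i = v ∧ m = u then 1 else 0) + R (i, m) (u, v) =
      R' (i, m) (u, v) + ∑ c, ∑ d, R' (i, m) (c, d) * R (d, c) (u, v) := by
  rw [h.coeff_symm i m v u]
  have := congrFun (congrFun h.hecke (m, i)) (u, v)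
  rw [add_mul, one_mul, mul_sub, mul_one, Matrix.mul_assoc] at this
  simp only [Matrix.add_apply, Matrix.sub_apply, permMat_mul_apply, Prod.swap_prod_mk,
    Matrix.one_apply, Matrix.zero_apply, Prod.mk.injEq] at this
  rw [Matrix.mul_apply] at this
  simp only [permMat_mul_apply, Fintype.sum_prod_type, Prod.swap_prod_mk] at this
  have e : (if i = v ∧ m = u then (1 : k) else 0) = if m = u ∧ i = v then 1 else 0 := by
    simp only [and_comm]
  rw [e]
  linear_combination -this

variable {Z : Type*} [Semiring Z] [Algebra k Z]

/-- Two braided-commuting solutions of the relations can be added. -/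
theorem SatisfiesRel.add (h : IsBraidedVectorDatum R R') {x y : ι → Z}
    (hx : SatisfiesRel R' x) (hy : SatisfiesRel R' y)
    (hyx : ∀ i m, y i * x m = ∑ s, ∑ n, R (i, m) (s, n) • (x n * y s)) :
    SatisfiesRel R' fun i => x i + y i := fun i m => by
  -- Only the mixed terms are in question. By braided commutation they are `(P + R)` applied to the
  -- products `x y`, and `P + R = R' + R' P R` rewrites this as `R'` applied to the mixed terms in
  -- opposite order.
  have key : x i * y m + y i * x m =
      ∑ u, ∑ v, (R' (i, m) (u, v) • (x v * y u) + R' (i, m) (u, v) • (y v * x u)) := by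
    have h1 : x i * y m + y i * x m = ∑ u, ∑ v,
        ((if i = v ∧ m = u then 1 else 0) + R (i, m) (u, v)) • (x v * y u) := by
      simp only [add_smul, Finset.sum_add_distrib, hyx i m, ite_smul, one_smul, zero_smul, ite_and]
      simp
    rw [h1]
    simp only [h.coeff_hecke, add_smul, Finset.sum_add_distrib, hyx, Finset.smul_sum,
      Finset.sum_smul, smul_smul]
    rw [sum4_comm]
  have e : (x i + y i) * (x m + y m) = x i * x m + y i * y m + (x i * y m + y i * x m) := by
    rw [add_mul, mul_add, mul_add]
    abel
  simp only [e, key, hx i m, hy i m, ← Finset.sum_add_distrib]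
  refine Finset.sum_congr rfl fun a _ => Finset.sum_congr rfl fun b _ => ?_
  simp only [add_mul, mul_add, smul_add]
  abel

end RMatrix

/-! ### Contracting one leg of the coproduct with a functional. -/

section Hits

variable {k K : Type*} [Field k] [Ring K] [HopfAlgebra k K]

/-- `h ↦ f(h₁) h₂`. -/
def hitL (f : K →ₗ[k] k) : K →ₗ[k] K :=
  (TensorProduct.lid k K).toLinearMap ∘ₗ f.rTensor K ∘ₗ Coalgebra.comul

/-- `h ↦ h₁ f(h₂)`. -/
def hitR (f : K →ₗ[k] k) : K →ₗ[k] K :=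
  (TensorProduct.rid k K).toLinearMap ∘ₗ f.lTensor K ∘ₗ Coalgebra.comul

theorem comul_hitL (f : K →ₗ[k] k) (h : K) :
    Coalgebra.comul (R := k) (hitL f h) = (hitL f).rTensor K (Coalgebra.comul h) := by
  have key (z : K ⊗[k] K) : (hitL f).rTensor K z = TensorProduct.lid k (K ⊗[k] K)
      (f.rTensor _ (TensorProduct.assoc k K K K (Coalgebra.comul.rTensor K z))) := by
    induction z using TensorProduct.induction_on with
    | zero => simp
    | add x y hx hy => simp only [map_add, hx, hy]
    | tmul x y =>
      simp only [LinearMap.rTensor_tmul, hitL, LinearMap.comp_apply]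
      generalize (Coalgebra.comul x : K ⊗[k] K) = w
      induction w using TensorProduct.induction_on with
      | zero => simp
      | add x y hx hy => simp only [map_add, TensorProduct.add_tmul, hx, hy]
      | tmul x y => simp [TensorProduct.smul_tmul']
  rw [key, Coalgebra.coassoc_apply]
  simp only [hitL, LinearMap.comp_apply]
  generalize (Coalgebra.comul h : K ⊗[k] K) = w
  induction w using TensorProduct.induction_on with
  | zero => simp
  | add x y hx hy => simp only [map_add, hx, hy]
  | tmul x y => simp

/-- In `h₁ f(h₂) h₃` the middle leg may be attached to either neighbour. This is how a functional
produced by acting on the second tensor factor reaches the first one, where `exch` can be applied.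
-/
theorem lTensor_hitL_comul (f : K →ₗ[k] k) (h : K) :
    (hitL f).lTensor K (Coalgebra.comul h) = (hitR f).rTensor K (Coalgebra.comul h) := by
  let G : K ⊗[k] (K ⊗[k] K) →ₗ[k] K ⊗[k] K :=
    ((TensorProduct.lid k K).toLinearMap ∘ₗ f.rTensor K).lTensor K
  have h1 (z : K ⊗[k] K) : (hitL f).lTensor K z = G (Coalgebra.comul.lTensor K z) := by
    induction z using TensorProduct.induction_on with
    | zero => simp
    | add x y hx hy => simp only [map_add, hx, hy]
    | tmul x y => simp [G, hitL]
  have h2 (z : K ⊗[k] K) : (hitR f).rTensor K z =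
      G (TensorProduct.assoc k K K K (Coalgebra.comul.rTensor K z)) := by
    induction z using TensorProduct.induction_on with
    | zero => simp
    | add x y hx hy => simp only [map_add, hx, hy]
    | tmul x y =>
      simp only [LinearMap.rTensor_tmul, hitR, LinearMap.comp_apply]
      generalize (Coalgebra.comul x : K ⊗[k] K) = w
      induction w using TensorProduct.induction_on with
      | zero => simp
      | add x y hx hy => simp only [map_add, TensorProduct.add_tmul, hx, hy]
      | tmul x y => simp [G, TensorProduct.smul_tmul]
  rw [h1, h2, Coalgebra.coassoc_apply]

theorem hitL_one (f : K →ₗ[k] k) : hitL f (1 : K) = f 1 • 1 := by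
  simp [hitL, Algebra.TensorProduct.one_def]

/-- For a family of functionals that is matrix-multiplicative this turns `hitL` of a product into a
matrix product, which makes the action on `p^i c` multiplicative in `K`. -/
theorem hitL_mul {α : Type*} [Fintype α] (f : K →ₗ[k] k) (p q : α → K →ₗ[k] k)
    (hf : ∀ g h, f (g * h) = ∑ a, p a g * q a h) (g h : K) :
    hitL f (g * h) = ∑ a, hitL (p a) g * hitL (q a) h := by
  simp only [hitL, LinearMap.comp_apply, Bialgebra.comul_mul]
  generalize (Coalgebra.comul g : K ⊗[k] K) = z
  generalize (Coalgebra.comul h : K ⊗[k] K) = w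
  induction z using TensorProduct.induction_on with
  | zero => simp
  | add x y hx hy => simp only [map_add, add_mul, hx, hy, Finset.sum_add_distrib]
  | tmul x y =>
    induction w using TensorProduct.induction_on with
    | zero => simp
    | add x y hx hy => simp only [map_add, mul_add, hx, hy, Finset.sum_add_distrib]
    | tmul x' y' => simp [hf, Finset.sum_smul, smul_smul, mul_comm]

end Hits

/-! ### Action and coaction on the braided vectors, and their Yetter–Drinfeld compatibility. -/

section Structure

variable {k ι K : Type*} [Field k] [Fintype ι] [DecidableEq ι] [Ring K] [HopfAlgebra k K]

/-- Functionals `τ` and elements `l` of a Hopf algebra `K` by which it acts and coacts on the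
braided vectors: `h ▷ p^i = ∑ τ i j h p^j` and `p^i ↦ ∑ l i j ⊗ p^j`. -/
structure IsBraidedVectorAction (R R' : Matrix (ι × ι) (ι × ι) k) (τ : ι → ι → K →ₗ[k] k)
    (l : ι → ι → K) : Prop where
  datum : IsBraidedVectorDatum R R'
  τ_one : ∀ i j, τ i j 1 = if i = j then 1 else 0
  τ_mul : ∀ i j g h, τ i j (g * h) = ∑ a, τ a j g * τ i a h
  τ_rel : IntertwinesRel R' fun i j => WithConv.toConv (τ i j)
  comul_l : ∀ i j, Coalgebra.comul (R := k) (l i j) = ∑ a, l i a ⊗ₜ[k] l a j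
  counit_l : ∀ i j, Coalgebra.counit (R := k) (l i j) = if i = j then 1 else 0
  l_rel : IntertwinesRel R' l
  exch : ∀ i j h, ∑ m, l m j * hitL (τ i m) h = ∑ m, hitR (τ m j) h * l i m
  τ_l : ∀ i j m n, τ m n (l i j) = R (i, m) (j, n)

namespace IsBraidedVectorAction

variable {R R' : Matrix (ι × ι) (ι × ι) k} {τ : ι → ι → K →ₗ[k] k} {l : ι → ι → K}

/-- In the convolution algebra the product of two such maps pairs the convolution product of the
scalars `τ` with `p^j p^l`; the former intertwine `R'` and the latter satisfy the relations. The
convolution product builds `h ▷ (bc) = (h₁ ▷ b)(h₂ ▷ c)` into the resulting algebra map. -/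
theorem act_rel (S : IsBraidedVectorAction R R' τ l) : SatisfiesRel R' fun i =>
    WithConv.toConv (∑ j, (τ i j).smulRight (gen R' j)) := fun i m => by
  ext h
  have key (i m : ι) : (WithConv.toConv (∑ j, (τ i j).smulRight (gen R' j)) *
      WithConv.toConv (∑ j, (τ m j).smulRight (gen R' j))).ofConv h =
      ∑ j, ∑ l, ((WithConv.toConv (τ i j) * WithConv.toConv (τ m l)).ofConv h) •
        (gen R' j * gen R' l) := by
    simp only [LinearMap.convMul_def, WithConv.ofConv_toConv, LinearMap.comp_apply]
    generalize (Coalgebra.comul h : K ⊗[k] K) = z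
    induction z using TensorProduct.induction_on with
    | zero => simp
    | add x y hx hy => simp only [map_add, hx, hy, add_smul, Finset.sum_add_distrib]
    | tmul x y => simp [Finset.sum_mul_sum, smul_smul, mul_comm]
  rw [key]
  have := S.τ_rel.pairing (fun j l => gen R' j * gen R' l) gen_satisfiesRel
    (LinearMap.lsmul k (BraidedVectors R') ∘ₗ LinearMap.applyₗ h ∘ₗ
      (WithConv.linearEquiv k (K →ₗ[k] k)).toLinearMap) i m
  simp only [LinearMap.comp_apply, LinearMap.lsmul_apply, LinearEquiv.coe_coe,
    WithConv.linearEquiv_apply, LinearMap.applyₗ_apply_apply] at this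
  rw [this]
  simp only [WithConv.ofConv_sum, WithConv.ofConv_smul, LinearMap.sum_apply, LinearMap.smul_apply,
    key]

/-- The action of `K` on `V(R')`, as a map into the convolution algebra. -/
def actHom (S : IsBraidedVectorAction R R' τ l) :
    BraidedVectors R' →ₐ[k] WithConv (K →ₗ[k] BraidedVectors R') :=
  liftGen _ S.act_rel

/-- The action of `K` on `V(R')`. -/
def act (S : IsBraidedVectorAction R R' τ l) : K →ₗ[k] BraidedVectors R' →ₗ[k] BraidedVectors R' :=
  ((WithConv.linearEquiv k (K →ₗ[k] BraidedVectors R')).toLinearMap ∘ₗ S.actHom.toLinearMap).flip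

variable (S : IsBraidedVectorAction R R' τ l)

theorem act_apply (h : K) (b : BraidedVectors R') : S.act h b = (S.actHom b).ofConv h := rfl

theorem act_gen (h : K) (i : ι) : S.act h (gen R' i) = ∑ j, τ i j h • gen R' j := by
  simp [act_apply, actHom]

theorem act_one (h : K) :
    S.act h 1 = Coalgebra.counit (R := k) h • (1 : BraidedVectors R') := by
  simp [act_apply, LinearMap.convOne_def, Algebra.algebraMap_eq_smul_one]

theorem act_mul (h : K) (b c : BraidedVectors R') : S.act h (b * c) =
    LinearMap.mul' k _ (TensorProduct.map (S.act.flip b) (S.act.flip c) (Coalgebra.comul h)) := by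
  rw [act_apply, map_mul]
  rfl

theorem act_gen_mul (h : K) (i : ι) (c : BraidedVectors R') :
    S.act h (gen R' i * c) = ∑ m, gen R' m * S.act (hitL (τ i m) h) c := by
  rw [act_mul]
  simp only [hitL, LinearMap.comp_apply]
  generalize (Coalgebra.comul h : K ⊗[k] K) = z
  induction z using TensorProduct.induction_on with
  | zero => simp
  | add x y hx hy => simp only [map_add, LinearMap.add_apply, mul_add, hx, hy,
      Finset.sum_add_distrib]
  | tmul x y => simp [act_gen, Finset.sum_mul]

theorem act_mul_gen (h : K) (i : ι) (c : BraidedVectors R') :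
    S.act h (c * gen R' i) = ∑ m, S.act (hitR (τ i m) h) c * gen R' m := by
  rw [act_mul]
  simp only [hitR, LinearMap.comp_apply]
  generalize (Coalgebra.comul h : K ⊗[k] K) = z
  induction z using TensorProduct.induction_on with
  | zero => simp
  | add x y hx hy => simp only [map_add, LinearMap.add_apply, add_mul, hx, hy,
      Finset.sum_add_distrib]
  | tmul x y => simp [act_gen, Finset.mul_sum]

theorem one_act (b : BraidedVectors R') : S.act 1 b = b := by
  induction b using gen_induction with
  | one => simp [act_one]
  | add b c hb hc => simp [hb, hc]
  | smul a b hb => simp [hb]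
  | gen_mul i c hc =>
    have (m : ι) : hitL (τ i m) 1 = if i = m then 1 else 0 := by simp [hitL_one, S.τ_one]
    rw [act_gen_mul, Finset.sum_eq_single i]
    · simp [this, hc]
    · intro m _ hm
      simp [this, hm.symm]
    · simp

theorem mul_act (g h : K) (b : BraidedVectors R') : S.act (g * h) b = S.act g (S.act h b) := by
  induction b using gen_induction generalizing g h with
  | one => simp [act_one, mul_comm, smul_smul]
  | add b c hb hc => simp [hb, hc]
  | smul a b hb => simp [hb]
  | gen_mul i c hc =>
    simp only [act_gen_mul, map_sum, hitL_mul _ _ _ (S.τ_mul i _), LinearMap.sum_apply, hc,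
      Finset.mul_sum]
    exact Finset.sum_comm

theorem hitL_l (S : IsBraidedVectorAction R R' τ l) (i j m n : ι) :
    hitL (τ m n) (l i j) = ∑ s, R (i, m) (s, n) • l s j := by
  simp [hitL, S.comul_l, S.τ_l]

/-- Because `τ(l) = R`, moving `l` past a generator costs exactly `R`: this is the braided
commutation required by `SatisfiesRel.add`. -/
theorem act_l_gen_mul (i j m : ι) (c : BraidedVectors R') :
    S.act (l i j) (gen R' m * c) = ∑ s, ∑ n, R (i, m) (s, n) • (gen R' n * S.act (l s j) c) := by
  rw [act_gen_mul, Finset.sum_comm]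
  simp [S.hitL_l, Finset.mul_sum]

/-- The coaction of `K` on `V(R')`. -/
def coactHom : BraidedVectors R' →ₐ[k] K ⊗[k] BraidedVectors R' :=
  liftGen (fun i => ∑ j, (l i j ⊗ₜ[k] (1 : BraidedVectors R')) * ((1 : K) ⊗ₜ[k] gen R' j))
    ((S.l_rel.map (Algebra.TensorProduct.includeLeft (R := k) (A := K) (S := k)
      (B := BraidedVectors R'))).satisfiesRel
      (gen_satisfiesRel.map (Algebra.TensorProduct.includeRight (R := k) (A := K)
        (B := BraidedVectors R'))) fun i j m => by simp)

theorem coactHom_gen (i : ι) : S.coactHom (gen R' i) = ∑ j, l i j ⊗ₜ[k] gen R' j := by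
  simp [coactHom]

theorem coactHom_coassoc (b : BraidedVectors R') :
    TensorProduct.assoc k K K _ (Coalgebra.comul.rTensor _ (S.coactHom b)) =
      S.coactHom.toLinearMap.lTensor K (S.coactHom b) := by
  have : ((Algebra.TensorProduct.assoc k k k K K (BraidedVectors R')).toAlgHom.comp
      (Algebra.TensorProduct.map (Bialgebra.comulAlgHom k K) (.id k _))).comp S.coactHom =
      (Algebra.TensorProduct.map (.id k _) S.coactHom).comp S.coactHom := by
    apply algHom_ext_gen
    intro i
    simp only [AlgHom.comp_apply, coactHom_gen, map_sum, Algebra.TensorProduct.map_tmul]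
    simp [S.comul_l, TensorProduct.sum_tmul, TensorProduct.tmul_sum]
    exact Finset.sum_comm
  exact congrArg (fun f => f b) this

theorem coactHom_counit (b : BraidedVectors R') :
    (Coalgebra.counit (R := k) (A := K)).rTensor _ (S.coactHom b) = 1 ⊗ₜ b := by
  have : (Algebra.TensorProduct.map (Bialgebra.counitAlgHom k K) (.id k _)).comp S.coactHom =
      Algebra.TensorProduct.includeRight := by
    apply algHom_ext_gen
    intro i
    simp only [AlgHom.comp_apply, coactHom_gen, map_sum, Algebra.TensorProduct.map_tmul]
    simp [S.counit_l, TensorProduct.ite_tmul]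
  exact congrArg (fun f => f b) this

/-- The diagonal left action of `K ⊗ K` on `K ⊗ V(R')`. -/
def diagAct : K ⊗[k] K →ₗ[k] K ⊗[k] BraidedVectors R' →ₗ[k] K ⊗[k] BraidedVectors R' :=
  TensorProduct.homTensorHomMap (RingHom.id k) K _ K _ ∘ₗ
    TensorProduct.map (LinearMap.mul k K) S.act

theorem diagAct_tmul (x y g : K) (b : BraidedVectors R') :
    S.diagAct (x ⊗ₜ y) (g ⊗ₜ b) = (x * g) ⊗ₜ S.act y b := by
  simp [diagAct]

/-- `∑ β(x ▷ b) (y ⊗ 1)` for `∑ x ⊗ y` in `K ⊗ K`. -/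
def coactAct : K ⊗[k] K →ₗ[k] BraidedVectors R' →ₗ[k] K ⊗[k] BraidedVectors R' :=
  TensorProduct.lift (LinearMap.mk₂ k
    (fun x y => LinearMap.mulRight k (y ⊗ₜ[k] (1 : BraidedVectors R')) ∘ₗ
      S.coactHom.toLinearMap ∘ₗ S.act x)
    (fun x x' y => by ext b; simp [add_mul]) (fun a x y => by ext b; simp)
    (fun x y y' => by ext b; simp [TensorProduct.add_tmul, mul_add])
    (fun a x y => by
      ext b
      simp [← TensorProduct.smul_tmul', mul_smul_comm]))

theorem coactAct_tmul (x y : K) (b : BraidedVectors R') :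
    S.coactAct (x ⊗ₜ y) b = S.coactHom (S.act x b) * (y ⊗ₜ 1) := by
  simp [coactAct]

/-- Acting with `h₂` on `p^j c` produces `τ(h₂) h₃`; the middle leg is moved to `h₁`, where `exch`
carries it to the other side of `l`. It is the inductive step of `compat`. -/
theorem diagAct_gen_mul (i : ι) (h : K) (x : K ⊗[k] BraidedVectors R') :
    S.diagAct (Coalgebra.comul h) (S.coactHom (gen R' i) * x) =
      ∑ j, S.coactHom (gen R' j) * S.diagAct (Coalgebra.comul (hitL (τ i j) h)) x := by
  induction x using TensorProduct.induction_on with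
  | zero => simp
  | add x y hx hy => simp only [map_add, mul_add, hx, hy, Finset.sum_add_distrib]
  | tmul g c =>
    have h1 (z : K ⊗[k] K) : S.diagAct z (S.coactHom (gen R' i) * (g ⊗ₜ c)) =
        ∑ m, ∑ j, (1 ⊗ₜ[k] gen R' m) *
          S.diagAct ((hitL (τ j m)).lTensor K z) ((l i j * g) ⊗ₜ c) := by
      induction z using TensorProduct.induction_on with
      | zero => simp
      | add x y hx hy => simp only [map_add, LinearMap.add_apply, mul_add, hx, hy,
          Finset.sum_add_distrib]
      | tmul x y =>
        rw [Finset.sum_comm]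
        simp [coactHom_gen, Finset.sum_mul, diagAct_tmul, act_gen_mul, TensorProduct.tmul_sum]
    have h2 (z : K ⊗[k] K) : ∑ m, ∑ j, (1 ⊗ₜ[k] gen R' m) *
          S.diagAct ((hitR (τ j m)).rTensor K z) ((l i j * g) ⊗ₜ c) =
        ∑ j, S.coactHom (gen R' j) * S.diagAct ((hitL (τ i j)).rTensor K z) (g ⊗ₜ c) := by
      induction z using TensorProduct.induction_on with
      | zero => simp
      | add x y hx hy => simp only [map_add, LinearMap.add_apply, mul_add, hx, hy,
          Finset.sum_add_distrib]
      | tmul x y =>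
        simp only [LinearMap.rTensor_tmul, diagAct_tmul, coactHom_gen, Finset.sum_mul,
          Algebra.TensorProduct.tmul_mul_tmul, one_mul, ← mul_assoc, ← TensorProduct.sum_tmul]
        rw [Finset.sum_comm]
        simp only [← TensorProduct.sum_tmul, ← Finset.sum_mul, S.exch]
    simp only [h1, lTensor_hitL_comul, h2, comul_hitL]

theorem compat (h : K) (b : BraidedVectors R') :
    S.diagAct (Coalgebra.comul h) (S.coactHom b) = S.coactAct (Coalgebra.comul h) b := by
  induction b using gen_induction generalizing h with
  | one =>
    rw [map_one, Algebra.TensorProduct.one_def]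
    have h1 (z : K ⊗[k] K) : S.diagAct z (1 ⊗ₜ 1) =
        TensorProduct.rid k K (Coalgebra.counit.lTensor K z) ⊗ₜ 1 := by
      induction z using TensorProduct.induction_on with
      | zero => simp
      | add x y hx hy => simp only [map_add, LinearMap.add_apply, hx, hy, TensorProduct.add_tmul]
      | tmul x y => simp [diagAct_tmul, act_one, TensorProduct.smul_tmul]
    have h2 (z : K ⊗[k] K) : S.coactAct z 1 =
        TensorProduct.lid k K (Coalgebra.counit.rTensor K z) ⊗ₜ 1 := by
      induction z using TensorProduct.induction_on with
      | zero => simp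
      | add x y hx hy => simp only [map_add, LinearMap.add_apply, hx, hy, TensorProduct.add_tmul]
      | tmul x y => simp [coactAct_tmul, act_one, TensorProduct.smul_tmul']
    simp [h1, h2]
  | add b c hb hc => simp only [map_add, hb, hc]
  | smul a b hb => simp only [map_smul, hb]
  | gen_mul i c hc =>
    rw [map_mul, diagAct_gen_mul]
    simp only [hc]
    simp only [comul_hitL]
    generalize (Coalgebra.comul h : K ⊗[k] K) = z
    induction z using TensorProduct.induction_on with
    | zero => simp
    | add x y hx hy => simp only [map_add, LinearMap.add_apply, mul_add, hx, hy,
        Finset.sum_add_distrib]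
    | tmul x y =>
      simp [coactAct_tmul, act_gen_mul, Finset.sum_mul, mul_assoc]

end IsBraidedVectorAction

end Structure

/-! ### The braided coproduct, its equivariance and coassociativity. -/

section Structure

variable {k ι K : Type*} [Field k] [Fintype ι] [DecidableEq ι] [Ring K] [HopfAlgebra k K]

namespace IsBraidedVectorAction

variable {R R' : Matrix (ι × ι) (ι × ι) k} {τ : ι → ι → K →ₗ[k] k} {l : ι → ι → K}
  (S : IsBraidedVectorAction R R' τ l)

/-- The action of `K` on `V(R')` as an algebra map. -/
def actAlgHom : K →ₐ[k] Module.End k (BraidedVectors R') :=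
  .ofLinearMap S.act (by ext1 b; exact S.one_act b) fun g h => by ext1 b; exact S.mul_act g h b

@[simp]
theorem actAlgHom_apply (h : K) : S.actAlgHom h = S.act h := rfl

/-- Operators on the left tensor factor of `V(R') ⊗ V(R')`. -/
def leftEnd (R' : Matrix (ι × ι) (ι × ι) k) : Module.End k (BraidedVectors R') →ₐ[k]
    Module.End k (BraidedVectors R' ⊗[k] BraidedVectors R') :=
  Module.endTensorEndAlgHom.comp Algebra.TensorProduct.includeLeft

/-- Operators on the right tensor factor of `V(R') ⊗ V(R')`. -/
def rightEnd (R' : Matrix (ι × ι) (ι × ι) k) : Module.End k (BraidedVectors R') →ₐ[k]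
    Module.End k (BraidedVectors R' ⊗[k] BraidedVectors R') :=
  Module.endTensorEndAlgHom.comp Algebra.TensorProduct.includeRight

@[simp]
theorem leftEnd_tmul (f : Module.End k (BraidedVectors R')) (d e : BraidedVectors R') :
    leftEnd R' f (d ⊗ₜ e) = f d ⊗ₜ e := by
  rw [leftEnd, AlgHom.comp_apply]
  exact congrArg (fun g => g (d ⊗ₜ e))
    (Module.endTensorEndAlgHom_apply (R := k) (S := k) (A := k) f 1)

@[simp]
theorem rightEnd_tmul (f : Module.End k (BraidedVectors R')) (d e : BraidedVectors R') :
    rightEnd R' f (d ⊗ₜ e) = d ⊗ₜ f e := by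
  rw [rightEnd, AlgHom.comp_apply]
  exact congrArg (fun g => g (d ⊗ₜ e))
    (Module.endTensorEndAlgHom_apply (R := k) (S := k) (A := k) 1 f)

/-- Left multiplication by `p^i ⊗ 1 + 1 ⊗ p^i` in the braided tensor product. -/
def comulStep (i : ι) : Module.End k (BraidedVectors R' ⊗[k] BraidedVectors R') :=
  leftEnd R' (Algebra.lmul k _ (gen R' i)) +
    ∑ j, leftEnd R' (S.actAlgHom (l i j)) * rightEnd R' (Algebra.lmul k _ (gen R' j))

theorem comulStep_tmul (i : ι) (d e : BraidedVectors R') : S.comulStep i (d ⊗ₜ e) =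
    (gen R' i * d) ⊗ₜ e + ∑ j, S.act (l i j) d ⊗ₜ (gen R' j * e) := by
  simp [comulStep]

/-- The operators `p^i ⊗ 1` are one solution of the relations and `∑ l^i_j ⊗ p^j` is another, since
`l` intertwines `R'` and acts on the other tensor factor. They braided-commute by `act_l_gen_mul`,
so their sum is a solution. -/
theorem comulStep_satisfiesRel : SatisfiesRel R' S.comulStep := by
  refine SatisfiesRel.add S.datum
    (gen_satisfiesRel.map ((leftEnd R').comp (Algebra.lmul k _)))
    ((S.l_rel.map ((leftEnd R').comp S.actAlgHom)).satisfiesRel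
      (gen_satisfiesRel.map ((rightEnd R').comp (Algebra.lmul k _))) fun i j m => ?_)
    fun i m => ?_
  · ext d e
    simp
  · ext d e
    simp only [Finset.sum_mul, Finset.smul_sum, Finset.mul_sum,
      TensorProduct.AlgebraTensorModule.curry_apply, LinearMap.restrictScalars_self,
      TensorProduct.curry_apply, LinearMap.sum_apply, Module.End.mul_apply, leftEnd_tmul,
      rightEnd_tmul, LinearMap.smul_apply, actAlgHom_apply, Algebra.coe_lmul_eq_mul,
      LinearMap.mul_apply', S.act_l_gen_mul, TensorProduct.sum_tmul, TensorProduct.smul_tmul']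
    rw [Finset.sum_comm]
    exact Finset.sum_congr rfl fun a _ => Finset.sum_comm

/-- Left multiplication by the coproduct in the braided tensor product. -/
def comulHom : BraidedVectors R' →ₐ[k]
    Module.End k (BraidedVectors R' ⊗[k] BraidedVectors R') :=
  liftGen S.comulStep S.comulStep_satisfiesRel

/-- The braided coproduct of `V(R')`. -/
def comul : BraidedVectors R' →ₗ[k] BraidedVectors R' ⊗[k] BraidedVectors R' :=
  LinearMap.applyₗ (1 ⊗ₜ 1) ∘ₗ S.comulHom.toLinearMap

theorem comul_one : S.comul 1 = 1 ⊗ₜ 1 := by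
  simp [comul]

theorem comul_gen_mul (i : ι) (c : BraidedVectors R') :
    S.comul (gen R' i * c) = S.comulStep i (S.comul c) := by
  simp [comul, comulHom]

theorem comul_gen (i : ι) : S.comul (gen R' i) = gen R' i ⊗ₜ 1 + 1 ⊗ₜ gen R' i := by
  have h := S.comul_gen_mul i 1
  rw [mul_one, comul_one, comulStep_tmul] at h
  simpa [act_one, S.counit_l, TensorProduct.ite_tmul, ite_smul] using h

/-- The diagonal action of `K ⊗ K` on `V(R') ⊗ V(R')`. -/
def diagAct₂ : K ⊗[k] K →ₗ[k] Module.End k (BraidedVectors R' ⊗[k] BraidedVectors R') :=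
  TensorProduct.homTensorHomMap (RingHom.id k) _ _ _ _ ∘ₗ TensorProduct.map S.act S.act

theorem diagAct₂_tmul (x y : K) (d e : BraidedVectors R') :
    S.diagAct₂ (x ⊗ₜ y) (d ⊗ₜ e) = S.act x d ⊗ₜ S.act y e := by
  simp [diagAct₂]

theorem tensorAct_eq (h : K) : tensorAct S.act h = S.diagAct₂ (Coalgebra.comul h) := rfl

theorem act_comp_mul (h : K) : S.act h ∘ₗ LinearMap.mul' k (BraidedVectors R') =
    LinearMap.mul' k _ ∘ₗ tensorAct S.act h := by
  ext b c
  simp only [TensorProduct.AlgebraTensorModule.curry_apply, LinearMap.restrictScalars_self,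
    TensorProduct.curry_apply, LinearMap.comp_apply, LinearMap.mul'_apply, act_mul, tensorAct_eq]
  generalize (Coalgebra.comul h : K ⊗[k] K) = z
  induction z using TensorProduct.induction_on with
  | zero => simp
  | add x y hx hy => simp only [map_add, LinearMap.add_apply, hx, hy]
  | tmul x y => simp [diagAct₂_tmul]

/-- The summand `p^i ⊗ 1` transforms directly; for `∑ l^i_j ⊗ p^j` the middle leg is moved to the
first factor and `exch` is applied. With `act_gen_mul` this is the inductive step for the coproduct
being a module map. -/
theorem tensorAct_comulStep (i : ι) (h : K) (u : BraidedVectors R' ⊗[k] BraidedVectors R') :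
    tensorAct S.act h (S.comulStep i u) =
      ∑ m, S.comulStep m (tensorAct S.act (hitL (τ i m) h) u) := by
  simp only [tensorAct_eq]
  induction u using TensorProduct.induction_on with
  | zero => simp
  | add x y hx hy => simp only [map_add, hx, hy, Finset.sum_add_distrib]
  | tmul d e =>
    have h1 (z : K ⊗[k] K) : S.diagAct₂ z ((gen R' i * d) ⊗ₜ e) =
        ∑ m, leftEnd R' (Algebra.lmul k _ (gen R' m))
          (S.diagAct₂ ((hitL (τ i m)).rTensor K z) (d ⊗ₜ e)) := by
      induction z using TensorProduct.induction_on with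
      | zero => simp
      | add x y hx hy => simp only [map_add, LinearMap.add_apply, hx, hy, Finset.sum_add_distrib]
      | tmul x y => simp [diagAct₂_tmul, act_gen_mul, TensorProduct.sum_tmul]
    have h2 (z : K ⊗[k] K) : S.diagAct₂ z (∑ j, S.act (l i j) d ⊗ₜ (gen R' j * e)) =
        ∑ m, ∑ j, rightEnd R' (Algebra.lmul k _ (gen R' m))
          (S.diagAct₂ ((hitL (τ j m)).lTensor K z) (S.act (l i j) d ⊗ₜ e)) := by
      induction z using TensorProduct.induction_on with
      | zero => simp
      | add x y hx hy => simp only [map_add, LinearMap.add_apply, hx, hy, Finset.sum_add_distrib]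
      | tmul x y =>
        rw [Finset.sum_comm]
        simp [diagAct₂_tmul, act_gen_mul, TensorProduct.tmul_sum]
    have h3 (z : K ⊗[k] K) : ∑ m, ∑ j, rightEnd R' (Algebra.lmul k _ (gen R' m))
          (S.diagAct₂ ((hitR (τ j m)).rTensor K z) (S.act (l i j) d ⊗ₜ e)) =
        ∑ m, ∑ j, leftEnd R' (S.actAlgHom (l m j)) (rightEnd R' (Algebra.lmul k _ (gen R' j))
          (S.diagAct₂ ((hitL (τ i m)).rTensor K z) (d ⊗ₜ e))) := by
      induction z using TensorProduct.induction_on with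
      | zero => simp
      | add x y hx hy => simp only [map_add, LinearMap.add_apply, hx, hy, Finset.sum_add_distrib]
      | tmul x y =>
        simp only [LinearMap.rTensor_tmul, diagAct₂_tmul, leftEnd_tmul, rightEnd_tmul,
          actAlgHom_apply, ← S.mul_act]
        rw [Finset.sum_comm (γ := ι) (f := fun m j =>
          S.act (l m j * _) d ⊗ₜ[k] (Algebra.lmul k _ (gen R' j)) (S.act y e))]
        simp only [← TensorProduct.sum_tmul, ← LinearMap.sum_apply, ← map_sum, S.exch]
    rw [comulStep_tmul, map_add, h1, h2]
    simp only [lTensor_hitL_comul, h3, ← comul_hitL, comulStep,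
      LinearMap.add_apply, LinearMap.sum_apply, Module.End.mul_apply, Finset.sum_add_distrib]

theorem comul_act (h : K) (b : BraidedVectors R') :
    S.comul (S.act h b) = tensorAct S.act h (S.comul b) := by
  induction b using gen_induction generalizing h with
  | one =>
    rw [act_one, map_smul, comul_one, tensorAct_eq]
    have (z : K ⊗[k] K) : S.diagAct₂ z (1 ⊗ₜ 1) =
        Coalgebra.counit (R := k) (TensorProduct.lid k K (Coalgebra.counit.rTensor K z)) •
          (1 ⊗ₜ 1) := by
      induction z using TensorProduct.induction_on with
      | zero => simp
      | add x y hx hy => simp only [map_add, LinearMap.add_apply, hx, hy, add_smul]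
      | tmul x y => simp [diagAct₂_tmul, act_one, TensorProduct.smul_tmul', TensorProduct.tmul_smul,
          smul_smul, mul_comm]
    simp [this]
  | add b c hb hc => simp only [map_add, hb, hc]
  | smul a b hb => simp only [map_smul, hb]
  | gen_mul i c hc =>
    simp only [act_gen_mul, map_sum, comul_gen_mul, tensorAct_comulStep, hc]

/-- The product in `K` of the first factors of two elements of `K ⊗ V(R')`. -/
def mulFirst (R' : Matrix (ι × ι) (ι × ι) k) :
    (K ⊗[k] BraidedVectors R') ⊗[k] (K ⊗[k] BraidedVectors R') →ₗ[k]
      K ⊗[k] (BraidedVectors R' ⊗[k] BraidedVectors R') :=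
  (LinearMap.mul' k K).rTensor _ ∘ₗ
    (TensorProduct.tensorTensorTensorComm k K (BraidedVectors R') K (BraidedVectors R')).toLinearMap

theorem mulFirst_tmul (x y : K) (d e : BraidedVectors R') :
    mulFirst R' ((x ⊗ₜ d) ⊗ₜ[k] (y ⊗ₜ e)) = (x * y) ⊗ₜ (d ⊗ₜ e) := by
  simp [mulFirst]

theorem tensorCoact_tmul (d e : BraidedVectors R') :
    tensorCoact S.coactHom.toLinearMap (d ⊗ₜ e) = mulFirst R' (S.coactHom d ⊗ₜ S.coactHom e) := rfl

/-- The Yetter–Drinfeld condition for the element `l^i_m` itself, whose coproduct is a matrix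
coproduct. -/
theorem sum_coact_act_l (i m : ι) (d : BraidedVectors R') :
    ∑ j, S.coactHom (S.act (l i j) d) * (l j m ⊗ₜ 1) =
      ∑ j, S.diagAct (l i j ⊗ₜ l j m) (S.coactHom d) := by
  have := S.compat (l i m) d
  simpa [S.comul_l, coactAct_tmul] using this.symm

/-- The inductive step for the coproduct being a comodule map: the coaction of `l ▷ d` is controlled
by the Yetter–Drinfeld condition once the factor `l` from the coaction of `p^j` stands next to it.
-/
theorem tensorCoact_comulStep (i : ι) (u : BraidedVectors R' ⊗[k] BraidedVectors R') :
    tensorCoact S.coactHom.toLinearMap (S.comulStep i u) =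
      ∑ j, TensorProduct.map (LinearMap.mulLeft k (l i j)) (S.comulStep j)
        (tensorCoact S.coactHom.toLinearMap u) := by
  induction u using TensorProduct.induction_on with
  | zero => simp
  | add x y hx hy => simp only [map_add, hx, hy, Finset.sum_add_distrib]
  | tmul d e =>
    have h1 (x y : K ⊗[k] BraidedVectors R') :
        mulFirst R' ((S.coactHom (gen R' i) * x) ⊗ₜ y) +
          ∑ m, ∑ j, mulFirst R' (S.diagAct (l i j ⊗ₜ l j m) x ⊗ₜ ((1 ⊗ₜ gen R' m) * y)) =
        ∑ j, TensorProduct.map (LinearMap.mulLeft k (l i j)) (S.comulStep j)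
          (mulFirst R' (x ⊗ₜ y)) := by
      induction x using TensorProduct.induction_on with
      | zero => simp
      | add x x' hx hx' =>
        simp only [map_add, mul_add, TensorProduct.add_tmul, Finset.sum_add_distrib, ← hx, ← hx']
        abel
      | tmul x d =>
        induction y using TensorProduct.induction_on with
        | zero => simp
        | add y y' hy hy' =>
          simp only [map_add, mul_add, TensorProduct.tmul_add, Finset.sum_add_distrib, ← hy, ← hy']
          abel
        | tmul y e =>
          simp only [coactHom_gen, Finset.sum_mul, Algebra.TensorProduct.tmul_mul_tmul,
            TensorProduct.sum_tmul, map_sum, mulFirst_tmul, diagAct_tmul, one_mul,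
            TensorProduct.map_tmul, comulStep_tmul, TensorProduct.tmul_add,
            LinearMap.mulLeft_apply, TensorProduct.tmul_sum, Finset.sum_add_distrib, mul_assoc]
          rw [Finset.sum_comm]
    simp only [comulStep_tmul, map_add, map_sum, tensorCoact_tmul, map_mul, ← h1]
    congr 1
    simp only [S.coactHom_gen, Finset.sum_mul, TensorProduct.tmul_sum, map_sum]
    rw [Finset.sum_comm]
    refine Finset.sum_congr rfl fun m _ => ?_
    -- The `K`-part coming from `p^m` is transferred to the right of the first coaction, producing
    -- the form handled by `sum_coact_act_l`.
    have h2 (x y : K ⊗[k] BraidedVectors R') (g : K) : mulFirst R' (x ⊗ₜ ((g ⊗ₜ gen R' m) * y)) =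
        mulFirst R' ((x * (g ⊗ₜ 1)) ⊗ₜ ((1 ⊗ₜ gen R' m) * y)) := by
      induction x using TensorProduct.induction_on with
      | zero => simp
      | add x x' hx hx' => simp only [map_add, add_mul, TensorProduct.add_tmul, hx, hx']
      | tmul x d =>
        induction y using TensorProduct.induction_on with
        | zero => simp
        | add y y' hy hy' => simp only [map_add, mul_add, TensorProduct.tmul_add, hy, hy']
        | tmul y e => simp [mulFirst_tmul, mul_assoc]
    rw [Finset.sum_congr rfl fun j _ =>
      h2 (S.coactHom (S.act (l i j) d)) (S.coactHom e) (l j m)]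
    rw [← map_sum, ← TensorProduct.sum_tmul, sum_coact_act_l, TensorProduct.sum_tmul, map_sum]

theorem comul_coact (b : BraidedVectors R') : tensorCoact S.coactHom.toLinearMap (S.comul b) =
    S.comul.lTensor K (S.coactHom b) := by
  induction b using gen_induction with
  | one => simp [comul_one, tensorCoact_tmul, Algebra.TensorProduct.one_def, mulFirst_tmul]
  | add b c hb hc => simp only [map_add, hb, hc]
  | smul a b hb => simp only [map_smul, hb]
  | gen_mul i c hc =>
    rw [comul_gen_mul, tensorCoact_comulStep, hc, map_mul, coactHom_gen]
    generalize S.coactHom c = x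
    induction x using TensorProduct.induction_on with
    | zero => simp
    | add x y hx hy => simp only [map_add, mul_add, hx, hy, Finset.sum_add_distrib]
    | tmul g c => simp [Finset.sum_mul, comul_gen_mul]

/-- Left multiplication by `p^i ⊗ 1 ⊗ 1 + 1 ⊗ p^i ⊗ 1 + 1 ⊗ 1 ⊗ p^i` in the threefold braided
tensor product. -/
def comulStep₃ (i : ι) :
    Module.End k (BraidedVectors R' ⊗[k] (BraidedVectors R' ⊗[k] BraidedVectors R')) :=
  (LinearMap.mulLeft k (gen R' i)).rTensor _ +
    ∑ j, TensorProduct.map (S.act (l i j)) (S.comulStep j)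

theorem lTensor_comulStep (i : ι) (u : BraidedVectors R' ⊗[k] BraidedVectors R') :
    S.comul.lTensor _ (S.comulStep i u) = S.comulStep₃ i (S.comul.lTensor _ u) := by
  induction u using TensorProduct.induction_on with
  | zero => simp
  | add x y hx hy => simp only [map_add, hx, hy]
  | tmul d e => simp [comulStep_tmul, comul_gen_mul, comulStep₃]

/-- On the first factor the coproduct meets `l ▷ d`; since it is a module map and `l` has a matrix
coproduct, this splits into the operators of the threefold braided tensor product. Coassociativity
follows because both iterated coproducts obey the same recursion. -/
theorem rTensor_comulStep (i : ι) (u : BraidedVectors R' ⊗[k] BraidedVectors R') :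
    TensorProduct.assoc k _ _ _ (S.comul.rTensor _ (S.comulStep i u)) =
      S.comulStep₃ i (TensorProduct.assoc k _ _ _ (S.comul.rTensor _ u)) := by
  induction u using TensorProduct.induction_on with
  | zero => simp
  | add x y hx hy => simp only [map_add, hx, hy]
  | tmul d e =>
    simp only [comulStep_tmul, map_add, map_sum, LinearMap.rTensor_tmul, comul_gen_mul, comul_act,
      tensorAct_eq, S.comul_l]
    generalize S.comul d = v
    induction v using TensorProduct.induction_on with
    | zero => simp
    | add x y hx hy =>
      simp only [map_add, TensorProduct.add_tmul, Finset.sum_add_distrib, ← hx, ← hy]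
      abel
    | tmul d d' =>
      simp only [comulStep_tmul, map_sum, LinearMap.sum_apply, diagAct₂_tmul,
        TensorProduct.add_tmul, TensorProduct.sum_tmul, TensorProduct.assoc_tmul, map_add,
        comulStep₃, LinearMap.add_apply, TensorProduct.map_tmul, LinearMap.rTensor_tmul,
        LinearMap.mulLeft_apply, TensorProduct.tmul_add, TensorProduct.tmul_sum,
        Finset.sum_add_distrib, add_assoc]
      rw [Finset.sum_comm]

theorem coassoc (b : BraidedVectors R') :
    TensorProduct.assoc k _ _ _ (S.comul.rTensor _ (S.comul b)) =
      S.comul.lTensor _ (S.comul b) := by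
  induction b using gen_induction with
  | one => simp [comul_one]
  | add b c hb hc => simp only [map_add, hb, hc]
  | smul a b hb => simp only [map_smul, hb]
  | gen_mul i c hc => rw [comul_gen_mul, rTensor_comulStep, hc, lTensor_comulStep]

end IsBraidedVectorAction

end Structure

/-! ### Counit, multiplicativity of the coproduct, braided antipode; assembly of the braided Hopf
algebra. -/

section Structure

variable {k ι K : Type*} [Field k] [Fintype ι] [DecidableEq ι] [Ring K] [HopfAlgebra k K]

namespace IsBraidedVectorAction

variable {R R' : Matrix (ι × ι) (ι × ι) k} {τ : ι → ι → K →ₗ[k] k} {l : ι → ι → K}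
  (S : IsBraidedVectorAction R R' τ l)

/-- The counit of `V(R')`. -/
def counitHom (R' : Matrix (ι × ι) (ι × ι) k) : BraidedVectors R' →ₐ[k] k :=
  liftGen (fun _ => 0) fun i m => by simp

@[simp]
theorem counitHom_gen (i : ι) : counitHom R' (gen R' i) = 0 := by
  exact liftGen_gen (fun _ => (0 : k)) _ i

theorem counit_act (h : K) (b : BraidedVectors R') :
    counitHom R' (S.act h b) = Coalgebra.counit (R := k) h * counitHom R' b := by
  induction b using gen_induction generalizing h with
  | one => simp [act_one]
  | add b c hb hc => simp [hb, hc, mul_add]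
  | smul a b hb => simp [hb, mul_left_comm]
  | gen_mul i c hc => simp [act_gen_mul]

theorem coact_counit (b : BraidedVectors R') :
    (counitHom R').toLinearMap.lTensor K (S.coactHom b) = 1 ⊗ₜ counitHom R' b := by
  have : (Algebra.TensorProduct.map (.id k K) (counitHom R')).comp S.coactHom =
      Algebra.TensorProduct.includeRight.comp (counitHom R') := by
    apply algHom_ext_gen
    intro i
    simp only [AlgHom.comp_apply, coactHom_gen, map_sum, Algebra.TensorProduct.map_tmul]
    simp
  exact congrArg (fun f => f b) this

theorem counit_left (b : BraidedVectors R') :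
    (counitHom R').toLinearMap.rTensor _ (S.comul b) = 1 ⊗ₜ b := by
  have step (i : ι) (u : BraidedVectors R' ⊗[k] BraidedVectors R') :
      (counitHom R').toLinearMap.rTensor _ (S.comulStep i u) =
        (LinearMap.mulLeft k (gen R' i)).lTensor k ((counitHom R').toLinearMap.rTensor _ u) := by
    induction u using TensorProduct.induction_on with
    | zero => simp
    | add x y hx hy => simp only [map_add, hx, hy]
    | tmul d e => simp [comulStep_tmul, counit_act, S.counit_l, TensorProduct.ite_tmul]
  induction b using gen_induction with
  | one => simp [comul_one]
  | add b c hb hc => simp [hb, hc, TensorProduct.tmul_add]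
  | smul a b hb => simp [hb]
  | gen_mul i c hc => simp [comul_gen_mul, step, hc]

theorem counit_right (b : BraidedVectors R') :
    (counitHom R').toLinearMap.lTensor _ (S.comul b) = b ⊗ₜ 1 := by
  have step (i : ι) (u : BraidedVectors R' ⊗[k] BraidedVectors R') :
      (counitHom R').toLinearMap.lTensor _ (S.comulStep i u) =
        (LinearMap.mulLeft k (gen R' i)).rTensor k ((counitHom R').toLinearMap.lTensor _ u) := by
    induction u using TensorProduct.induction_on with
    | zero => simp
    | add x y hx hy => simp only [map_add, hx, hy]
    | tmul d e => simp [comulStep_tmul]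
  induction b using gen_induction with
  | one => simp [comul_one]
  | add b c hb hc => simp [hb, hc, TensorProduct.add_tmul]
  | smul a b hb => simp [hb, TensorProduct.smul_tmul']
  | gen_mul i c hc => simp [comul_gen_mul, step, hc]

/-- `x ▷ d' ⊗ b e'` for `x ⊗ b` in `K ⊗ V(R')`. -/
def crossRight (d' e' : BraidedVectors R') :
    K ⊗[k] BraidedVectors R' →ₗ[k] BraidedVectors R' ⊗[k] BraidedVectors R' :=
  TensorProduct.map (S.act.flip d') (LinearMap.mulRight k e')

theorem crossRight_tmul (d' e' b : BraidedVectors R') (x : K) :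
    S.crossRight d' e' (x ⊗ₜ b) = S.act x d' ⊗ₜ (b * e') := by
  simp [crossRight]

theorem braiding_tmul (b c : BraidedVectors R') : braiding S.act S.coactHom.toLinearMap (b ⊗ₜ c) =
    TensorProduct.map (S.act.flip c) .id (S.coactHom b) := by
  simp only [braiding, LinearMap.comp_apply, LinearMap.rTensor_tmul, AlgHom.toLinearMap_apply]
  generalize S.coactHom b = x
  induction x using TensorProduct.induction_on with
  | zero => simp
  | add x y hx hy => simp only [map_add, TensorProduct.add_tmul, hx, hy]
  | tmul g b => simp

theorem braiding_gen (i m : ι) :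
    braiding S.act S.coactHom.toLinearMap (gen R' i ⊗ₜ gen R' m) =
      ∑ a, ∑ b, R (i, m) (a, b) • (gen R' b ⊗ₜ[k] gen R' a) := by
  simp [braiding_tmul, coactHom_gen, act_gen, S.τ_l, TensorProduct.sum_tmul,
    TensorProduct.smul_tmul']

theorem braidedMul_tmul (d e d' e' : BraidedVectors R') :
    braidedMul (braiding S.act S.coactHom.toLinearMap) ((d ⊗ₜ e) ⊗ₜ (d' ⊗ₜ e')) =
      (LinearMap.mulLeft k d).rTensor _ (S.crossRight d' e' (S.coactHom e)) := by
  simp only [braidedMul, LinearMap.comp_apply, LinearEquiv.coe_coe, TensorProduct.assoc_tmul,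
    LinearMap.lTensor_tmul, TensorProduct.assoc_symm_tmul, LinearMap.rTensor_tmul, braiding_tmul]
  generalize S.coactHom e = x
  induction x using TensorProduct.induction_on with
  | zero => simp
  | add x y hx hy => simp only [map_add, TensorProduct.add_tmul, TensorProduct.tmul_add, hx, hy]
  | tmul g b => simp [crossRight_tmul]

/-- The only instance of associativity of the braided tensor product that is needed: left
multiplication by the coproduct of a generator commutes with right multiplications. Induction on the
first factor then gives `comul_mul`. -/
theorem comulStep_braidedMul (i : ι) (v u : BraidedVectors R' ⊗[k] BraidedVectors R') :
    S.comulStep i (braidedMul (braiding S.act S.coactHom.toLinearMap) (v ⊗ₜ u)) =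
      braidedMul (braiding S.act S.coactHom.toLinearMap) (S.comulStep i v ⊗ₜ u) := by
  induction v using TensorProduct.induction_on with
  | zero => simp
  | add x y hx hy => simp only [map_add, TensorProduct.add_tmul, hx, hy]
  | tmul d e =>
    induction u using TensorProduct.induction_on with
    | zero => simp
    | add x y hx hy => simp only [map_add, TensorProduct.tmul_add, hx, hy]
    | tmul d' e' =>
      simp only [comulStep_tmul, TensorProduct.add_tmul, TensorProduct.sum_tmul, map_add, map_sum,
        braidedMul_tmul, map_mul]
      generalize S.coactHom e = x
      induction x using TensorProduct.induction_on with
      | zero => simp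
      | add x y hx hy =>
        simp only [map_add, mul_add, Finset.sum_add_distrib, hx, hy]
        abel
      | tmul g b =>
        have act_l_mul (i m : ι) (b c : BraidedVectors R') : S.act (l i m) (b * c) =
            ∑ j, S.act (l i j) b * S.act (l j m) c := by
          simp [act_mul, S.comul_l]
        simp only [crossRight_tmul, coactHom_gen, Finset.sum_mul, map_sum,
          Algebra.TensorProduct.tmul_mul_tmul, LinearMap.rTensor_tmul, LinearMap.mulLeft_apply,
          comulStep_tmul, act_l_mul, TensorProduct.sum_tmul, S.mul_act, mul_assoc]
        rw [Finset.sum_comm]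

theorem comul_mul (b c : BraidedVectors R') : S.comul (b * c) =
    braidedMul (braiding S.act S.coactHom.toLinearMap) (S.comul b ⊗ₜ S.comul c) := by
  induction b using gen_induction with
  | one =>
    rw [one_mul, comul_one]
    generalize S.comul c = u
    induction u using TensorProduct.induction_on with
    | zero => simp
    | add x y hx hy => simp only [map_add, TensorProduct.tmul_add, ← hx, ← hy]
    | tmul d e =>
      simp [braidedMul_tmul, Algebra.TensorProduct.one_def, crossRight_tmul, one_act]
  | add b c hb hc => simp only [map_add, add_mul, TensorProduct.add_tmul, hb, hc]
  | smul a b hb => simp only [map_smul, smul_mul_assoc, ← TensorProduct.smul_tmul', hb]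
  | gen_mul i c hc => rw [mul_assoc, comul_gen_mul, hc, comulStep_braidedMul, comul_gen_mul]

/-- Left multiplication by `p^i` for the braided opposite product. -/
def oppStep (i : ι) : Module.End k (BraidedVectors R') :=
  ∑ j, LinearMap.mulRight k (gen R' j) ∘ₗ S.act (l i j)

theorem oppStep_apply (i : ι) (c : BraidedVectors R') :
    S.oppStep i c = ∑ j, S.act (l i j) c * gen R' j := by
  simp [oppStep]

theorem hitR_l (S : IsBraidedVectorAction R R' τ l) (i j m n : ι) :
    hitR (τ m n) (l i j) = ∑ s, R (s, m) (j, n) • l i s := by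
  simp [hitR, S.comul_l, S.τ_l]

/-- Two steps applied to `c` give `(l₁ l₂ ▷ c)` times the family `g = R (p p)`. That `g` satisfies
`g₁₂ = R' g₂₁` follows from the relations of `p` because `PR` and `PR'` commute; then the
intertwining property of `l` applies. -/
theorem oppStep_satisfiesRel : SatisfiesRel R' S.oppStep := fun i m => by
  let g (s t : ι) : BraidedVectors R' := ∑ j, ∑ n, R (s, t) (j, n) • (gen R' n * gen R' j)
  have hg (s t : ι) : g s t = ∑ c, ∑ d, R' (s, t) (c, d) • g d c := by
    have h1 : g s t = ∑ j, ∑ n, (∑ c, ∑ d, R (s, t) (c, d) * R' (d, c) (j, n)) •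
        (gen R' n * gen R' j) := by
      have : g s t = ∑ c, ∑ d, R (s, t) (c, d) •
          ∑ j, ∑ n, R' (d, c) (j, n) • (gen R' n * gen R' j) :=
        Finset.sum_congr rfl fun c _ => Finset.sum_congr rfl fun d _ =>
          congrArg (R (s, t) (c, d) • ·) (gen_satisfiesRel d c)
      simp only [this, Finset.smul_sum, Finset.sum_smul, smul_smul]
      rw [sum4_comm]
    have h2 : ∑ c, ∑ d, R' (s, t) (c, d) • g d c =
        ∑ j, ∑ n, (∑ c, ∑ d, R' (s, t) (c, d) * R (d, c) (j, n)) • (gen R' n * gen R' j) := by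
      simp only [g, Finset.smul_sum, Finset.sum_smul, smul_smul]
      rw [sum4_comm]
    rw [h1, h2]
    simp only [S.datum.coeff_symm]
  apply LinearMap.ext
  intro c
  have key (i m : ι) : S.oppStep i (S.oppStep m c) =
      ∑ j, ∑ n, (LinearMap.mul k (BraidedVectors R') ∘ₗ S.act.flip c) (l i j * l m n) (g j n) := by
    simp only [oppStep_apply, map_sum, act_mul_gen, S.hitR_l, LinearMap.sum_apply,
      map_smul, LinearMap.smul_apply, ← S.mul_act, g, LinearMap.comp_apply, LinearMap.flip_apply,
      LinearMap.mul_apply', Finset.sum_mul, smul_mul_assoc, mul_assoc]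
    rw [sum4_rotate]
  simp only [Module.End.mul_apply, LinearMap.sum_apply, LinearMap.smul_apply, key]
  exact S.l_rel.pairing g hg _ i m

/-- Left multiplication by the antipode for the braided opposite product. -/
def antipodeHom : BraidedVectors R' →ₐ[k] Module.End k (BraidedVectors R') :=
  liftGen (fun i => (-1 : k) • S.oppStep i) fun i m => by
    simpa only [smul_mul_smul_comm, neg_mul_neg, one_mul, one_smul] using
      S.oppStep_satisfiesRel i m

theorem antipodeHom_gen (i : ι) : S.antipodeHom (gen R' i) = (-1 : k) • S.oppStep i :=
  liftGen_gen _ _ i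

theorem neg_one_smul_eq (x : BraidedVectors R') : (-1 : k) • x = -x := neg_one_smul k x

/-- The braided antipode of `V(R')`. -/
def antipode : BraidedVectors R' →ₗ[k] BraidedVectors R' :=
  LinearMap.applyₗ 1 ∘ₗ S.antipodeHom.toLinearMap

theorem antipode_one : S.antipode 1 = 1 := by
  simp [antipode]

theorem antipode_gen_mul (i : ι) (c : BraidedVectors R') :
    S.antipode (gen R' i * c) = (-1 : k) • ∑ j, S.act (l i j) (S.antipode c) * gen R' j := by
  simp only [antipode, LinearMap.comp_apply, AlgHom.toLinearMap_apply, map_mul, antipodeHom_gen,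
    LinearMap.applyₗ_apply_apply, Module.End.mul_apply, LinearMap.smul_apply, oppStep_apply]

theorem antipode_gen (i : ι) : S.antipode (gen R' i) = -gen R' i := by
  have h := S.antipode_gen_mul i 1
  rw [mul_one, antipode_one] at h
  simpa [act_one, S.counit_l, ite_smul, neg_one_smul_eq] using h

/-- On `p^i c` one side has `l` after `hitL`, the other has `hitR` after `l`, both acting on the
antipode of `c`; `exch` identifies the two sums. -/
theorem antipode_act (h : K) (b : BraidedVectors R') :
    S.antipode (S.act h b) = S.act h (S.antipode b) := by
  induction b using gen_induction generalizing h with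
  | one => simp [act_one, antipode_one]
  | add b c hb hc => simp [hb, hc]
  | smul a b hb => simp [hb]
  | gen_mul i c hc =>
    simp only [act_gen_mul, map_sum, antipode_gen_mul, hc, map_smul, act_mul_gen, ← mul_act,
      ← Finset.smul_sum]
    rw [Finset.sum_comm]
    conv_rhs => rw [Finset.sum_comm]
    simp only [← Finset.sum_mul, ← LinearMap.sum_apply, ← map_sum, S.exch]

theorem mul_antipode_left (b : BraidedVectors R') :
    LinearMap.mul' k _ (S.antipode.rTensor _ (S.comul b)) =
      counitHom R' b • (1 : BraidedVectors R') := by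
  -- The term from `p^i ⊗ 1` is minus the braided opposite product with `p^j`, which equivariance of
  -- the antipode identifies with minus the term from `∑ l^i_j ⊗ p^j`. So the result vanishes
  -- without an induction hypothesis.
  have step (i : ι) (u : BraidedVectors R' ⊗[k] BraidedVectors R') :
      LinearMap.mul' k _ (S.antipode.rTensor _ (S.comulStep i u)) = 0 := by
    induction u using TensorProduct.induction_on with
    | zero => simp
    | add x y hx hy => simp only [map_add, hx, hy, add_zero]
    | tmul d e =>
      simp only [comulStep_tmul, map_add, map_sum, LinearMap.rTensor_tmul, LinearMap.mul'_apply,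
        antipode_gen_mul, antipode_act, smul_mul_assoc, Finset.sum_mul, mul_assoc]
      rw [neg_one_smul_eq]
      exact neg_add_cancel (G := BraidedVectors R') _
  induction b using gen_induction with
  | one => simp [comul_one, antipode_one]
  | add b c hb hc => simp [hb, hc, add_smul]
  | smul a b hb => simp [hb, smul_smul]
  | gen_mul i c hc => simp [comul_gen_mul, step]

theorem mul_antipode_right (b : BraidedVectors R') :
    LinearMap.mul' k _ (S.antipode.lTensor _ (S.comul b)) =
      counitHom R' b • (1 : BraidedVectors R') := by
  -- In this order the result depends on `u` only through its own contraction. The induction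
  -- hypothesis makes that a scalar, on which `l` acts by its counit, and the two terms cancel.
  have step (i : ι) (u : BraidedVectors R' ⊗[k] BraidedVectors R') :
      LinearMap.mul' k _ (S.antipode.lTensor _ (S.comulStep i u)) =
        gen R' i * LinearMap.mul' k _ (S.antipode.lTensor _ u) -
          ∑ m, S.act (l i m) (LinearMap.mul' k _ (S.antipode.lTensor _ u)) * gen R' m := by
    induction u using TensorProduct.induction_on with
    | zero => simp
    | add x y hx hy =>
      simp only [map_add, hx, hy, mul_add, add_mul, Finset.sum_add_distrib]
      abel
    | tmul d e =>
      have act_l_mul (i m : ι) (b c : BraidedVectors R') : S.act (l i m) (b * c) =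
          ∑ j, S.act (l i j) b * S.act (l j m) c := by
        simp [act_mul, S.comul_l]
      simp only [comulStep_tmul, map_add, map_sum, LinearMap.lTensor_tmul, LinearMap.mul'_apply,
        antipode_gen_mul, act_l_mul, Finset.sum_mul, mul_smul_comm, Finset.mul_sum,
        ← Finset.smul_sum, mul_assoc, sub_eq_add_neg, neg_smul, one_smul]
      rw [Finset.sum_comm]
  induction b using gen_induction with
  | one => simp [comul_one, antipode_one]
  | add b c hb hc => simp [hb, hc, add_smul]
  | smul a b hb => simp [hb, smul_smul]
  | gen_mul i c hc => simp [comul_gen_mul, step, hc, act_one, S.counit_l, ite_smul]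

/-- For `p^i c` the coaction of `l ▷ S c` is rewritten by the Yetter–Drinfeld condition at `l`,
which moves `l` to the left of the coaction of `c`, as the coaction of a product requires. -/
theorem antipode_coact (b : BraidedVectors R') :
    S.coactHom (S.antipode b) = S.antipode.lTensor K (S.coactHom b) := by
  induction b using gen_induction with
  | one => simp [antipode_one, Algebra.TensorProduct.one_def]
  | add b c hb hc => simp only [map_add, hb, hc]
  | smul a b hb => simp only [map_smul, hb]
  | gen_mul i c hc =>
    have h1 : S.coactHom (S.antipode (gen R' i * c)) =
        (-1 : k) • ∑ m, ∑ j, S.diagAct (l i j ⊗ₜ l j m) (S.coactHom (S.antipode c)) *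
          (1 ⊗ₜ gen R' m) := by
      simp only [← Finset.sum_mul, ← sum_coact_act_l]
      simp only [antipode_gen_mul, map_smul, map_sum, map_mul, coactHom_gen, Finset.sum_mul,
        Finset.mul_sum, mul_assoc, Algebra.TensorProduct.tmul_mul_tmul, mul_one, one_mul]
      rw [Finset.sum_comm]
    rw [h1, hc, map_mul, coactHom_gen]
    generalize S.coactHom c = x
    induction x using TensorProduct.induction_on with
    | zero => simp
    | add x y hx hy =>
      simp only [map_add, mul_add, add_mul, Finset.sum_add_distrib, ← hx, ← hy]
      rw [smul_add]
    | tmul g c =>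
      rw [Finset.sum_comm]
      simp only [Finset.sum_mul, diagAct_tmul, antipode_gen_mul, TensorProduct.tmul_sum,
        TensorProduct.tmul_smul, map_sum, LinearMap.lTensor_tmul, Finset.smul_sum,
        Algebra.TensorProduct.tmul_mul_tmul, mul_one]

theorem compat_structure (h : K) (b : BraidedVectors R') :
    TensorProduct.homTensorHomMap (RingHom.id k) K _ K _
        (TensorProduct.map (LinearMap.mul k K) S.act (Coalgebra.comul h)) (S.coactHom b) =
      (LinearMap.mul' k K).rTensor _ (TensorProduct.rightComm k K _ K
        ((S.coactHom.toLinearMap ∘ₗ S.act.flip b).rTensor K (Coalgebra.comul h))) := by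
  refine (S.compat h b).trans ?_
  generalize (Coalgebra.comul h : K ⊗[k] K) = z
  induction z using TensorProduct.induction_on with
  | zero => simp
  | add x y hx hy => simp only [map_add, LinearMap.add_apply, hx, hy]
  | tmul x y =>
    simp only [coactAct_tmul, LinearMap.rTensor_tmul, LinearMap.comp_apply, LinearMap.flip_apply,
      AlgHom.toLinearMap_apply]
    generalize S.coactHom (S.act x b) = w
    induction w using TensorProduct.induction_on with
    | zero => simp
    | add x y hx hy => simp only [map_add, add_mul, TensorProduct.add_tmul, hx, hy]
    | tmul g c => simp

/-- The braided Hopf algebra `V(R')`. -/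
def toBraidedHopfStructure : BraidedHopfStructure k K (BraidedVectors R') where
  act := S.act
  coact := S.coactHom.toLinearMap
  comul := S.comul
  counit := (counitHom R').toLinearMap
  antipode := S.antipode
  one_act := S.one_act
  mul_act := S.mul_act
  coassoc_coact := LinearMap.ext S.coactHom_coassoc
  counit_coact := S.coactHom_counit
  compat := S.compat_structure
  act_one := S.act_one
  act_mul := S.act_comp_mul
  coact_one := map_one S.coactHom
  coact_mul := by
    ext b c
    simp only [TensorProduct.AlgebraTensorModule.curry_apply, LinearMap.restrictScalars_self,
      TensorProduct.curry_apply, LinearMap.comp_apply, LinearMap.mul'_apply, tensorCoact_tmul,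
      AlgHom.toLinearMap_apply, map_mul]
    generalize S.coactHom b = x
    generalize S.coactHom c = y
    induction x using TensorProduct.induction_on with
    | zero => simp
    | add x x' hx hx' => simp only [map_add, add_mul, TensorProduct.add_tmul, hx, hx']
    | tmul g b =>
      induction y using TensorProduct.induction_on with
      | zero => simp
      | add y y' hy hy' => simp only [map_add, mul_add, TensorProduct.tmul_add, hy, hy']
      | tmul g' c => simp [mulFirst_tmul]
  comul_act := S.comul_act
  comul_coact := LinearMap.ext S.comul_coact
  counit_act := S.counit_act
  coact_counit := S.coact_counit
  antipode_act := S.antipode_act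
  antipode_coact := LinearMap.ext S.antipode_coact
  coassoc := LinearMap.ext S.coassoc
  counit_left := S.counit_left
  counit_right := S.counit_right
  comul_one := S.comul_one
  comul_mul := by
    ext b c
    exact S.comul_mul b c
  counit_one := map_one (counitHom R')
  counit_mul := map_mul (counitHom R')
  mul_antipode_left := S.mul_antipode_left
  mul_antipode_right := S.mul_antipode_right

end IsBraidedVectorAction

end Structure

/-! ### The semidirect product of a module algebra with a Hopf algebra. -/

section Smash

variable {k K B : Type*} [Field k] [Ring K] [HopfAlgebra k K] [Ring B] [Algebra k B]

/-- `B` is a left `K`-module algebra. -/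
structure IsModuleAlgebra (act : K →ₗ[k] B →ₗ[k] B) : Prop where
  one_act : ∀ b, act 1 b = b
  mul_act : ∀ g h b, act (g * h) b = act g (act h b)
  act_one : ∀ h, act h 1 = Coalgebra.counit (R := k) h • (1 : B)
  act_mul : ∀ h b c, act h (b * c) =
    LinearMap.mul' k B (TensorProduct.map (act.flip b) (act.flip c) (Coalgebra.comul h))

/-- The semidirect product algebra `B ⋊ K`. -/
def SmashProduct {act : K →ₗ[k] B →ₗ[k] B} (_ : IsModuleAlgebra act) : Type _ := B ⊗[k] K

namespace SmashProduct

/-- Left multiplication by elements of `B` on `B ⊗ K`. -/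
def leftB : B →ₗ[k] B ⊗[k] K →ₗ[k] B ⊗[k] K := LinearMap.rTensorHom K ∘ₗ LinearMap.mul k B

theorem leftB_tmul (b c : B) (h : K) : leftB b (c ⊗ₜ[k] h) = (b * c) ⊗ₜ h := by
  simp [leftB]

/-- The action of `K ⊗ K` on `B ⊗ K`. -/
def diagK (act : K →ₗ[k] B →ₗ[k] B) : K ⊗[k] K →ₗ[k] B ⊗[k] K →ₗ[k] B ⊗[k] K :=
  TensorProduct.homTensorHomMap (RingHom.id k) B K B K ∘ₗ TensorProduct.map act (LinearMap.mul k K)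

theorem diagK_tmul (act : K →ₗ[k] B →ₗ[k] B) (x y g : K) (b : B) :
    diagK act (x ⊗ₜ y) (b ⊗ₜ g) = act x b ⊗ₜ (y * g) := by
  simp [diagK]

/-- Left multiplication by elements of `K` on `B ⊗ K`. -/
def leftK (act : K →ₗ[k] B →ₗ[k] B) : K →ₗ[k] B ⊗[k] K →ₗ[k] B ⊗[k] K :=
  diagK act ∘ₗ Coalgebra.comul

/-- Left multiplication on `B ⊗ K` in the semidirect product. -/
def leftMul (act : K →ₗ[k] B →ₗ[k] B) : B ⊗[k] K →ₗ[k] B ⊗[k] K →ₗ[k] B ⊗[k] K :=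
  TensorProduct.lift (LinearMap.mk₂ k (fun b h => leftB b ∘ₗ leftK act h)
    (fun b b' h => by rw [map_add, LinearMap.add_comp])
    (fun a b h => by rw [map_smul, LinearMap.smul_comp])
    (fun b h h' => by rw [map_add, LinearMap.comp_add])
    (fun a b h => by rw [map_smul, LinearMap.comp_smul]))

theorem leftMul_tmul (act : K →ₗ[k] B →ₗ[k] B) (b : B) (h : K) (u : B ⊗[k] K) :
    leftMul act (b ⊗ₜ h) u = leftB b (leftK act h u) := by
  simp [leftMul]

variable {act : K →ₗ[k] B →ₗ[k] B}

theorem leftK_mul (hact : IsModuleAlgebra act) (g h : K) (u : B ⊗[k] K) :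
    leftK act (g * h) u = leftK act g (leftK act h u) := by
  simp only [leftK, LinearMap.comp_apply, Bialgebra.comul_mul]
  generalize (Coalgebra.comul g : K ⊗[k] K) = z
  generalize (Coalgebra.comul h : K ⊗[k] K) = w
  induction z using TensorProduct.induction_on with
  | zero => simp
  | add x y hx hy => simp only [map_add, add_mul, LinearMap.add_apply, hx, hy]
  | tmul x y =>
    induction w using TensorProduct.induction_on with
    | zero => simp
    | add x y hx hy => simp only [map_add, mul_add, LinearMap.add_apply, hx, hy]
    | tmul x' y' =>
      induction u using TensorProduct.induction_on with
      | zero => simp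
      | add x y hx hy => simp only [map_add, hx, hy]
      | tmul b g => simp [diagK_tmul, hact.mul_act, mul_assoc]

theorem leftB_mul (b c : B) (u : B ⊗[k] K) : leftB (b * c) u = leftB b (leftB c u) := by
  induction u using TensorProduct.induction_on with
  | zero => simp
  | add x y hx hy => simp only [map_add, hx, hy]
  | tmul b g => simp [leftB_tmul, mul_assoc]

/-- The essential case `h (b u) = (h b) u` of associativity: both sides are the same map applied to
the two bracketings of `h₁ ⊗ h₂ ⊗ h₃`. -/
theorem leftK_leftB (hact : IsModuleAlgebra act) (h : K) (b : B) (u : B ⊗[k] K) :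
    leftK act h (leftB b u) =
    leftMul act (leftK act h (b ⊗ₜ 1)) u := by
  induction u using TensorProduct.induction_on with
  | zero => simp
  | add x y hx hy => simp only [map_add, hx, hy]
  | tmul b' g =>
    let G : K ⊗[k] (K ⊗[k] K) →ₗ[k] B ⊗[k] K :=
      (LinearMap.mul' k B).rTensor K ∘ₗ (TensorProduct.assoc k B B K).symm.toLinearMap ∘ₗ
        TensorProduct.map (act.flip b)
          (TensorProduct.map (act.flip b') (LinearMap.mulRight k g))
    have h1 (z : K ⊗[k] K) : diagK act z (leftB b (b' ⊗ₜ g)) =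
        G (TensorProduct.assoc k K K K (Coalgebra.comul.rTensor K z)) := by
      induction z using TensorProduct.induction_on with
      | zero => simp
      | add x y hx hy => simp only [map_add, LinearMap.add_apply, hx, hy]
      | tmul x y =>
        simp only [leftB_tmul, diagK_tmul, LinearMap.rTensor_tmul, hact.act_mul]
        generalize (Coalgebra.comul x : K ⊗[k] K) = w
        induction w using TensorProduct.induction_on with
        | zero => simp
        | add x y hx hy => simp only [map_add, TensorProduct.add_tmul, hx, hy]
        | tmul x y => simp [G]
    have h2 (z : K ⊗[k] K) : leftMul act (diagK act z (b ⊗ₜ 1)) (b' ⊗ₜ g) =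
        G (Coalgebra.comul.lTensor K z) := by
      induction z using TensorProduct.induction_on with
      | zero => simp
      | add x y hx hy => simp only [map_add, LinearMap.add_apply, hx, hy]
      | tmul x y =>
        simp only [diagK_tmul, leftMul_tmul, leftK, LinearMap.comp_apply, mul_one,
          LinearMap.lTensor_tmul]
        generalize (Coalgebra.comul y : K ⊗[k] K) = w
        induction w using TensorProduct.induction_on with
        | zero => simp
        | add x y hx hy => simp only [map_add, TensorProduct.tmul_add, LinearMap.add_apply, hx, hy]
        | tmul x y => simp [G, diagK_tmul, leftB_tmul]
    rw [leftK, LinearMap.comp_apply, h1, h2, Coalgebra.coassoc_apply]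

theorem leftB_one (u : B ⊗[k] K) : leftB 1 u = u := by
  induction u using TensorProduct.induction_on with
  | zero => simp
  | add x y hx hy => simp only [map_add, hx, hy]
  | tmul b g => simp [leftB_tmul]

theorem leftMul_leftB (b : B) (u v : B ⊗[k] K) :
    leftMul act (leftB b u) v = leftB b (leftMul act u v) := by
  induction u using TensorProduct.induction_on with
  | zero => simp
  | add x y hx hy => simp only [map_add, LinearMap.add_apply, hx, hy]
  | tmul c g =>
    rw [leftMul_tmul, ← leftB_mul, ← leftMul_tmul]
    simp [leftB_tmul]

theorem leftMul_leftK (hact : IsModuleAlgebra act) (h : K) (u v : B ⊗[k] K) :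
    leftMul act (leftK act h u) v = leftK act h (leftMul act u v) := by
  induction u using TensorProduct.induction_on with
  | zero => simp
  | add x y hx hy => simp only [map_add, LinearMap.add_apply, hx, hy]
  | tmul c g =>
    rw [leftMul_tmul, leftK_leftB hact]
    simp only [leftK, LinearMap.comp_apply]
    generalize (Coalgebra.comul h : K ⊗[k] K) = z
    induction z using TensorProduct.induction_on with
    | zero => simp
    | add x y hx hy => simp only [map_add, LinearMap.add_apply, hx, hy]
    | tmul x y =>
      have := leftK_mul hact y g v
      simp only [leftK, LinearMap.comp_apply] at this
      simp only [diagK_tmul, leftMul_tmul, leftK, LinearMap.comp_apply, mul_one, this]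

/-- Left multiplication by `b ⊗ h` is the composite of those by `b` and by `h`, so it suffices that
each of these commutes with right multiplication. -/
theorem leftMul_assoc (hact : IsModuleAlgebra act) (u v w : B ⊗[k] K) :
    leftMul act (leftMul act u v) w = leftMul act u (leftMul act v w) := by
  induction u using TensorProduct.induction_on with
  | zero => simp
  | add x y hx hy => simp only [map_add, LinearMap.add_apply, hx, hy]
  | tmul b h => simp only [leftMul_tmul, leftMul_leftB, leftMul_leftK hact]

theorem leftK_one (hact : IsModuleAlgebra act) (u : B ⊗[k] K) : leftK act 1 u = u := by
  induction u using TensorProduct.induction_on with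
  | zero => simp
  | add x y hx hy => simp only [map_add, hx, hy]
  | tmul b g => simp [leftK, Algebra.TensorProduct.one_def, diagK_tmul, hact.one_act]

theorem leftK_one_tmul (hact : IsModuleAlgebra act) (h g : K) :
    leftK act h (1 ⊗ₜ g) = 1 ⊗ₜ (h * g) := by
  have key (z : K ⊗[k] K) : diagK act z (1 ⊗ₜ g) =
      1 ⊗ₜ (TensorProduct.lid k K (Coalgebra.counit.rTensor K z) * g) := by
    induction z using TensorProduct.induction_on with
    | zero => simp
    | add x y hx hy => simp only [map_add, LinearMap.add_apply, TensorProduct.tmul_add, add_mul,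
        hx, hy]
    | tmul x y => simp [diagK_tmul, hact.act_one, TensorProduct.smul_tmul']
  simp [leftK, key]

variable (hact : IsModuleAlgebra act)

instance : AddCommGroup (SmashProduct hact) := inferInstanceAs (AddCommGroup (B ⊗[k] K))

instance : Module k (SmashProduct hact) := inferInstanceAs (Module k (B ⊗[k] K))

/-- The underlying vector space of the semidirect product. -/
def equiv : B ⊗[k] K ≃ₗ[k] SmashProduct hact := LinearEquiv.refl k (B ⊗[k] K)

instance : Ring (SmashProduct hact) :=
  { (inferInstance : AddCommGroup (SmashProduct hact)) with
    mul u v := equiv hact (leftMul act ((equiv hact).symm u) ((equiv hact).symm v))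
    one := equiv hact (1 ⊗ₜ 1)
    left_distrib u v w := by
      change equiv hact (leftMul act _ ((equiv hact).symm (v + w))) = equiv hact _ + equiv hact _
      simp only [map_add]
    right_distrib u v w := by
      change equiv hact (leftMul act ((equiv hact).symm (u + v)) _) = equiv hact _ + equiv hact _
      simp only [map_add, LinearMap.add_apply]
    zero_mul u := by
      change equiv hact (leftMul act ((equiv hact).symm 0) _) = 0
      simp only [map_zero, LinearMap.zero_apply]
    mul_zero u := by
      change equiv hact (leftMul act _ ((equiv hact).symm 0)) = 0
      simp only [map_zero]
    mul_assoc u v w := congrArg (equiv hact) (leftMul_assoc hact _ _ _)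
    one_mul u := by
      change equiv hact (leftMul act (1 ⊗ₜ 1) ((equiv hact).symm u)) = u
      rw [leftMul_tmul, leftK_one hact, leftB_one, LinearEquiv.apply_symm_apply]
    mul_one u := by
      change equiv hact (leftMul act ((equiv hact).symm u) (1 ⊗ₜ 1)) = u
      obtain ⟨u, rfl⟩ := (equiv hact).surjective u
      rw [LinearEquiv.symm_apply_apply]
      congr 1
      induction u using TensorProduct.induction_on with
      | zero => simp
      | add x y hx hy => simp only [map_add, LinearMap.add_apply, hx, hy]
      | tmul b g => simp [leftMul_tmul, leftK_one_tmul hact, leftB_tmul] }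

theorem equiv_mul_equiv (u v : B ⊗[k] K) :
    equiv hact u * equiv hact v = equiv hact (leftMul act u v) := rfl

theorem one_eq : (1 : SmashProduct hact) = equiv hact (1 ⊗ₜ 1) := rfl

instance : Algebra k (SmashProduct hact) := Algebra.ofModule
  (fun a u v => by
    obtain ⟨u, rfl⟩ := (equiv hact).surjective u
    obtain ⟨v, rfl⟩ := (equiv hact).surjective v
    rw [← map_smul, equiv_mul_equiv, equiv_mul_equiv, map_smul, LinearMap.smul_apply, map_smul])
  (fun a u v => by
    obtain ⟨u, rfl⟩ := (equiv hact).surjective u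
    obtain ⟨v, rfl⟩ := (equiv hact).surjective v
    rw [← map_smul, equiv_mul_equiv, equiv_mul_equiv, map_smul, map_smul])

/-- The inclusion of `B`. -/
def inclB : B →ₐ[k] SmashProduct hact :=
  .ofLinearMap ((equiv hact).toLinearMap ∘ₗ (TensorProduct.mk k B K).flip 1) rfl fun b c => by
    simp [equiv_mul_equiv, leftMul_tmul, leftK_one hact, leftB_tmul]

/-- The inclusion of `K`. -/
def inclK : K →ₐ[k] SmashProduct hact :=
  .ofLinearMap ((equiv hact).toLinearMap ∘ₗ TensorProduct.mk k B K 1) rfl fun g h => by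
    simp [equiv_mul_equiv, leftMul_tmul, leftK_one_tmul hact, leftB_tmul]

theorem inclB_apply (b : B) : inclB hact b = equiv hact (b ⊗ₜ 1) := rfl

theorem inclK_apply (h : K) : inclK hact h = equiv hact (1 ⊗ₜ h) := rfl

theorem inclB_mul_inclK (b : B) (h : K) : inclB hact b * inclK hact h = equiv hact (b ⊗ₜ h) := by
  simp [inclB_apply, inclK_apply, equiv_mul_equiv, leftMul_tmul, leftK_one_tmul hact, leftB_tmul]

theorem equiv_eq (u : B ⊗[k] K) : equiv hact u = LinearMap.mul' k (SmashProduct hact)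
    (TensorProduct.map (inclB hact).toLinearMap (inclK hact).toLinearMap u) := by
  induction u using TensorProduct.induction_on with
  | zero => simp
  | add x y hx hy => simp only [map_add, hx, hy]
  | tmul b g => simp [inclB_mul_inclK]

theorem inclK_mul_inclB (h : K) (b : B) : inclK hact h * inclB hact b =
    LinearMap.mul' k (SmashProduct hact) (TensorProduct.map
      ((inclB hact).toLinearMap ∘ₗ act.flip b) (inclK hact).toLinearMap (Coalgebra.comul h)) := by
  rw [inclK_apply, inclB_apply, equiv_mul_equiv, leftMul_tmul, leftK, LinearMap.comp_apply]
  generalize (Coalgebra.comul h : K ⊗[k] K) = z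
  induction z using TensorProduct.induction_on with
  | zero => simp
  | add x y hx hy => simp only [map_add, LinearMap.add_apply, hx, hy]
  | tmul x y => simp [diagK_tmul, inclB_mul_inclK, leftB_tmul]

variable {Z : Type*} [Ring Z] [Algebra k Z]

/-- The algebra map out of the semidirect product given by compatible algebra maps. -/
def lift (f : B →ₐ[k] Z) (g : K →ₐ[k] Z)
    (hfg : ∀ h b, g h * f b = LinearMap.mul' k Z
      (TensorProduct.map (f.toLinearMap ∘ₗ act.flip b) g.toLinearMap (Coalgebra.comul h))) :
    SmashProduct hact →ₐ[k] Z :=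
  .ofLinearMap (LinearMap.mul' k Z ∘ₗ TensorProduct.map f.toLinearMap g.toLinearMap ∘ₗ
    (equiv hact).symm.toLinearMap) (by simp [one_eq]) fun u v => by
      obtain ⟨u, rfl⟩ := (equiv hact).surjective u
      obtain ⟨v, rfl⟩ := (equiv hact).surjective v
      let F := LinearMap.mul' k Z ∘ₗ TensorProduct.map f.toLinearMap g.toLinearMap
      have hB (b : B) (v : B ⊗[k] K) : F (leftB b v) = f b * F v := by
        induction v using TensorProduct.induction_on with
        | zero => simp
        | add x y hx hy => simp only [map_add, mul_add, hx, hy]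
        | tmul b g => simp [F, leftB_tmul, mul_assoc]
      have hK (h : K) (v : B ⊗[k] K) : F (leftK act h v) = g h * F v := by
        induction v using TensorProduct.induction_on with
        | zero => simp
        | add x y hx hy => simp only [map_add, mul_add, hx, hy]
        | tmul b h' =>
          have : g h * F (b ⊗ₜ h') = (g h * f b) * g h' := by simp [F, mul_assoc]
          rw [this, hfg]
          change F (diagK act (Coalgebra.comul h) (b ⊗ₜ h')) = _
          generalize (Coalgebra.comul h : K ⊗[k] K) = z
          induction z using TensorProduct.induction_on with
          | zero => simp
          | add x y hx hy => simp only [map_add, LinearMap.add_apply, add_mul, hx, hy]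
          | tmul x y => simp [F, diagK_tmul, mul_assoc]
      change F (leftMul act u v) = F u * F v
      induction u using TensorProduct.induction_on with
      | zero => simp
      | add x y hx hy => simp only [map_add, LinearMap.add_apply, add_mul, hx, hy]
      | tmul b h =>
        rw [leftMul_tmul, hB, hK]
        simp [F, mul_assoc]

theorem lift_inclB (f : B →ₐ[k] Z) (g : K →ₐ[k] Z) (hfg) (b : B) :
    lift hact f g hfg (inclB hact b) = f b := by
  simp [lift, inclB_apply]

theorem lift_inclK (f : B →ₐ[k] Z) (g : K →ₐ[k] Z) (hfg) (h : K) :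
    lift hact f g hfg (inclK hact h) = g h := by
  simp [lift, inclK_apply]

theorem algHom_ext {f g : SmashProduct hact →ₐ[k] Z}
    (hB : f.comp (inclB hact) = g.comp (inclB hact))
    (hK : f.comp (inclK hact) = g.comp (inclK hact)) : f = g := by
  ext u
  obtain ⟨u, rfl⟩ := (equiv hact).surjective u
  induction u using TensorProduct.induction_on with
  | zero => simp
  | add x y hx hy => simp only [map_add, hx, hy]
  | tmul b h =>
    have h1 := congrArg (fun f => f b) hB
    have h2 := congrArg (fun f => f h) hK
    simp only [AlgHom.comp_apply] at h1 h2
    rw [← inclB_mul_inclK, map_mul, map_mul, h1, h2]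

end SmashProduct

end Smash

/-! ### The bosonization as a bialgebra. -/

section Structure

variable {k ι K : Type*} [Field k] [Fintype ι] [DecidableEq ι] [Ring K] [HopfAlgebra k K]

namespace IsBraidedVectorAction

variable {R R' : Matrix (ι × ι) (ι × ι) k} {τ : ι → ι → K →ₗ[k] k} {l : ι → ι → K}
  (S : IsBraidedVectorAction R R' τ l)

theorem isModuleAlgebra : IsModuleAlgebra S.act := ⟨S.one_act, S.mul_act, S.act_one, S.act_mul⟩

/-- The algebra of the bosonization `V(R') ⋊ K`. -/
abbrev Boson : Type _ := SmashProduct S.isModuleAlgebra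

/-- The inclusion of `V(R')` in its bosonization. -/
abbrev inB : BraidedVectors R' →ₐ[k] S.Boson := SmashProduct.inclB S.isModuleAlgebra

/-- The inclusion of `K` in the bosonization. -/
abbrev inK : K →ₐ[k] S.Boson := SmashProduct.inclK S.isModuleAlgebra

variable {Z : Type*} [Ring Z] [Algebra k Z]

/-- The cross relations need only be checked on generators. -/
theorem cross_of_gen (f : BraidedVectors R' →ₐ[k] Z) (g : K →ₐ[k] Z)
    (hfg : ∀ h i, g h * f (gen R' i) = ∑ m, f (gen R' m) * g (hitL (τ i m) h)) (h : K)
    (b : BraidedVectors R') : g h * f b = LinearMap.mul' k Z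
      (TensorProduct.map (f.toLinearMap ∘ₗ S.act.flip b) g.toLinearMap (Coalgebra.comul h)) := by
  induction b using gen_induction generalizing h with
  | one =>
    have key (z : K ⊗[k] K) : LinearMap.mul' k Z
        (TensorProduct.map (f.toLinearMap ∘ₗ S.act.flip 1) g.toLinearMap z) =
          g (TensorProduct.lid k K (Coalgebra.counit.rTensor K z)) := by
      induction z using TensorProduct.induction_on with
      | zero => simp
      | add x y hx hy => simp only [map_add, hx, hy]
      | tmul x y => simp [act_one]
    simp [key]
  | add b c hb hc =>
    simp only [map_add, mul_add, hb, hc, LinearMap.comp_add, TensorProduct.map_add_left,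
      LinearMap.add_apply]
  | smul a b hb =>
    simp only [map_smul, mul_smul_comm, hb, LinearMap.comp_smul, TensorProduct.map_smul_left,
      LinearMap.smul_apply]
  | gen_mul i c hc =>
    rw [map_mul, ← mul_assoc, hfg, Finset.sum_mul]
    simp only [mul_assoc, hc, comul_hitL]
    generalize (Coalgebra.comul h : K ⊗[k] K) = z
    induction z using TensorProduct.induction_on with
    | zero => simp
    | add x y hx hy => simp only [map_add, mul_add, Finset.sum_add_distrib, hx, hy]
    | tmul x y => simp [act_gen_mul, Finset.sum_mul, mul_assoc]

theorem inK_mul_inB_gen (h : K) (i : ι) :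
    S.inK h * S.inB (gen R' i) = ∑ m, S.inB (gen R' m) * S.inK (hitL (τ i m) h) := by
  rw [SmashProduct.inclK_mul_inclB]
  simp only [hitL, LinearMap.comp_apply]
  generalize (Coalgebra.comul h : K ⊗[k] K) = z
  induction z using TensorProduct.induction_on with
  | zero => simp
  | add x y hx hy => simp only [map_add, mul_add, Finset.sum_add_distrib, hx, hy]
  | tmul x y => simp [act_gen, Finset.sum_mul]

theorem inK_l_mul_inB (i m : ι) (b : BraidedVectors R') :
    S.inK (l i m) * S.inB b = ∑ j, S.inB (S.act (l i j) b) * S.inK (l j m) := by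
  rw [SmashProduct.inclK_mul_inclB]
  simp [S.comul_l]

/-- The map `b ↦ b⁽¹⁾ ⊗ b⁽²⁾` into the tensor square of the bosonization. -/
def coactBoson : BraidedVectors R' →ₐ[k] S.Boson ⊗[k] S.Boson :=
  (Algebra.TensorProduct.map S.inK S.inB).comp S.coactHom

theorem coactBoson_gen (i : ι) :
    S.coactBoson (gen R' i) = ∑ j, S.inK (l i j) ⊗ₜ S.inB (gen R' j) := by
  simp [coactBoson, coactHom_gen]

/-- The map `b ⊗ c ↦ b c⁽¹⁾ ⊗ c⁽²⁾`. -/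
def semiComul : BraidedVectors R' ⊗[k] BraidedVectors R' →ₗ[k] S.Boson ⊗[k] S.Boson :=
  LinearMap.mul' k (S.Boson ⊗[k] S.Boson) ∘ₗ
    TensorProduct.map (Algebra.TensorProduct.includeLeft.comp S.inB).toLinearMap
      S.coactBoson.toLinearMap

theorem semiComul_tmul (d e : BraidedVectors R') :
    S.semiComul (d ⊗ₜ e) = (S.inB d ⊗ₜ 1) * S.coactBoson e := by
  simp [semiComul]

theorem semiComul_one : S.semiComul (1 ⊗ₜ 1) = 1 := by
  rw [semiComul_tmul]
  simp [← Algebra.TensorProduct.one_def]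

/-- The coproduct of the generator `p^i` in the bosonization. -/
def comulGen (i : ι) : S.Boson ⊗[k] S.Boson :=
  S.inB (gen R' i) ⊗ₜ 1 + ∑ j, S.inK (l i j) ⊗ₜ S.inB (gen R' j)

/-- The cross relation `l b = (l ▷ b) l` in the bosonization reproduces the braiding. Hence left
multiplication by the braided coproduct of `p^i` becomes ordinary left multiplication in the tensor
square, which makes the semidirect coproduct multiplicative on `V(R')`. -/
theorem semiComul_comulStep (i : ι) (u : BraidedVectors R' ⊗[k] BraidedVectors R') :
    S.semiComul (S.comulStep i u) = S.comulGen i * S.semiComul u := by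
  induction u using TensorProduct.induction_on with
  | zero => simp
  | add x y hx hy => simp only [map_add, mul_add, hx, hy]
  | tmul d e =>
    simp only [comulStep_tmul, map_add, map_sum, semiComul_tmul, comulGen, add_mul, map_mul,
      ← mul_assoc, Algebra.TensorProduct.tmul_mul_tmul, mul_one, Finset.sum_mul, coactBoson_gen,
      Finset.mul_sum, one_mul, inK_l_mul_inB, TensorProduct.sum_tmul]
    rw [Finset.sum_comm]

/-- The semidirect coproduct on `V(R')`. -/
def comulB : BraidedVectors R' →ₐ[k] S.Boson ⊗[k] S.Boson :=
  .ofLinearMap (S.semiComul ∘ₗ S.comul)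
    (by rw [LinearMap.comp_apply, comul_one, semiComul_one]) fun b c => by
      simp only [LinearMap.comp_apply]
      induction b using gen_induction with
      | one => rw [one_mul, comul_one, semiComul_one, one_mul]
      | add b b' hb hb' => simp only [map_add, add_mul, hb, hb']
      | smul a b hb => simp only [map_smul, smul_mul_assoc, hb]
      | gen_mul i b hb =>
        rw [mul_assoc, comul_gen_mul, semiComul_comulStep, hb, ← mul_assoc, comul_gen_mul,
          semiComul_comulStep]

theorem comulB_apply (b : BraidedVectors R') : S.comulB b = S.semiComul (S.comul b) := rfl

theorem comulB_gen (i : ι) : S.comulB (gen R' i) = S.comulGen i := by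
  rw [comulB_apply, comul_gen, map_add, semiComul_tmul, semiComul_tmul, coactBoson_gen, comulGen]
  simp [← Algebra.TensorProduct.one_def]

/-- The coproduct on `K`, in the bosonization. -/
def comulK : K →ₐ[k] S.Boson ⊗[k] S.Boson :=
  (Algebra.TensorProduct.map S.inK S.inK).comp (Bialgebra.comulAlgHom k K)

theorem comulK_apply (h : K) :
    S.comulK h = Algebra.TensorProduct.map S.inK S.inK (Coalgebra.comul h) := rfl

/-- The cross relation must survive the coproduct. The summand `p ⊗ 1` is immediate; for `∑ l ⊗ p`
the functional is moved between legs by coassociativity and past `l` by `exch`. -/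
theorem comulK_mul_comulB_gen (h : K) (i : ι) :
    S.comulK h * S.comulB (gen R' i) =
      ∑ m, S.comulB (gen R' m) * S.comulK (hitL (τ i m) h) := by
  have h1 (z : K ⊗[k] K) : Algebra.TensorProduct.map S.inK S.inK z * (S.inB (gen R' i) ⊗ₜ 1) =
      ∑ m, (S.inB (gen R' m) ⊗ₜ 1) *
        Algebra.TensorProduct.map S.inK S.inK ((hitL (τ i m)).rTensor K z) := by
    induction z using TensorProduct.induction_on with
    | zero => simp
    | add x y hx hy => simp only [map_add, mul_add, add_mul, hx, hy, Finset.sum_add_distrib]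
    | tmul x y => simp [inK_mul_inB_gen, TensorProduct.sum_tmul]
  have h2 (z : K ⊗[k] K) : Algebra.TensorProduct.map S.inK S.inK z *
      (∑ j, S.inK (l i j) ⊗ₜ S.inB (gen R' j)) =
        ∑ m, ∑ j, (1 ⊗ₜ S.inB (gen R' m)) * (Algebra.TensorProduct.map S.inK S.inK
          ((hitL (τ j m)).lTensor K z) * (S.inK (l i j) ⊗ₜ 1)) := by
    induction z using TensorProduct.induction_on with
    | zero => simp
    | add x y hx hy => simp only [map_add, mul_add, add_mul, hx, hy, Finset.sum_add_distrib]
    | tmul x y =>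
      rw [Finset.sum_comm]
      simp [inK_mul_inB_gen, TensorProduct.tmul_sum, Finset.mul_sum]
  have h3 (z : K ⊗[k] K) : ∑ m, ∑ j, (1 ⊗ₜ S.inB (gen R' m)) * (Algebra.TensorProduct.map
        S.inK S.inK ((hitR (τ j m)).rTensor K z) * (S.inK (l i j) ⊗ₜ 1)) =
      ∑ m, ∑ j, (S.inK (l m j) ⊗ₜ S.inB (gen R' j)) *
        Algebra.TensorProduct.map S.inK S.inK ((hitL (τ i m)).rTensor K z) := by
    induction z using TensorProduct.induction_on with
    | zero => simp
    | add x y hx hy => simp only [map_add, mul_add, add_mul, hx, hy, Finset.sum_add_distrib]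
    | tmul x y =>
      simp only [LinearMap.rTensor_tmul, Algebra.TensorProduct.map_tmul,
        Algebra.TensorProduct.tmul_mul_tmul, mul_one, one_mul, ← map_mul]
      conv_rhs => rw [Finset.sum_comm]
      simp only [← TensorProduct.sum_tmul, ← map_sum, S.exch]
  simp only [comulB_gen, comulGen, comulK_apply, mul_add, h1, h2, lTensor_hitL_comul, h3, add_mul,
    Finset.sum_add_distrib, Finset.sum_mul, comul_hitL]

/-- The coproduct of the bosonization. -/
def comulBoson : S.Boson →ₐ[k] S.Boson ⊗[k] S.Boson :=
  SmashProduct.lift _ S.comulB S.comulK (S.cross_of_gen _ _ S.comulK_mul_comulB_gen)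

theorem comulBoson_inB (b : BraidedVectors R') : S.comulBoson (S.inB b) = S.comulB b :=
  SmashProduct.lift_inclB _ _ _ _ _

theorem comulBoson_inK (h : K) : S.comulBoson (S.inK h) = S.comulK h :=
  SmashProduct.lift_inclK _ _ _ _ _

/-- The counit of the bosonization. -/
def counitBoson : S.Boson →ₐ[k] k :=
  SmashProduct.lift _ (counitHom R') (Bialgebra.counitAlgHom k K)
    (S.cross_of_gen _ _ fun h i => by simp)

theorem counitBoson_inB (b : BraidedVectors R') : S.counitBoson (S.inB b) = counitHom R' b :=
  SmashProduct.lift_inclB _ _ _ _ _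

theorem counitBoson_inK (h : K) : S.counitBoson (S.inK h) = Coalgebra.counit (R := k) h :=
  SmashProduct.lift_inclK _ _ _ _ _

theorem boson_algHom_ext {f g : S.Boson →ₐ[k] Z} (hB : ∀ i, f (S.inB (gen R' i)) =
    g (S.inB (gen R' i))) (hK : ∀ h, f (S.inK h) = g (S.inK h)) : f = g :=
  SmashProduct.algHom_ext _ (algHom_ext_gen hB) (AlgHom.ext hK)

/-- Each coalgebra axiom equates two algebra maps out of the bosonization, so it is checked on the
`p^i` and on `K` only. -/
instance : Bialgebra k S.Boson := Bialgebra.ofAlgHom S.comulBoson S.counitBoson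
  (by
    apply boson_algHom_ext
    · intro i
      simp only [AlgHom.comp_apply, comulBoson_inB, comulB_gen, comulGen, map_add, map_sum,
        Algebra.TensorProduct.map_tmul, comulBoson_inK, comulK_apply, S.comul_l]
      simp [TensorProduct.add_tmul, TensorProduct.sum_tmul, TensorProduct.tmul_add,
        TensorProduct.tmul_sum, Algebra.TensorProduct.one_def, Finset.sum_add_distrib, add_assoc]
      exact Finset.sum_comm
    · intro h
      have e1 (z : K ⊗[k] K) : Algebra.TensorProduct.assoc k k k S.Boson S.Boson S.Boson
          (Algebra.TensorProduct.map S.comulBoson (.id k _)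
            (Algebra.TensorProduct.map S.inK S.inK z)) =
          Algebra.TensorProduct.map S.inK (Algebra.TensorProduct.map S.inK S.inK)
            (TensorProduct.assoc k K K K (Coalgebra.comul.rTensor K z)) := by
        induction z using TensorProduct.induction_on with
        | zero => simp
        | add x y hx hy => simp only [map_add, hx, hy]
        | tmul x y =>
          simp only [Algebra.TensorProduct.map_tmul, comulBoson_inK, comulK_apply,
            LinearMap.rTensor_tmul]
          generalize (Coalgebra.comul x : K ⊗[k] K) = w
          induction w using TensorProduct.induction_on with
          | zero => simp
          | add x y hx hy => simp only [map_add, TensorProduct.add_tmul, hx, hy]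
          | tmul x y => simp
      have e2 (z : K ⊗[k] K) : Algebra.TensorProduct.map (.id k _) S.comulBoson
            (Algebra.TensorProduct.map S.inK S.inK z) =
          Algebra.TensorProduct.map S.inK (Algebra.TensorProduct.map S.inK S.inK)
            (Coalgebra.comul.lTensor K z) := by
        induction z using TensorProduct.induction_on with
        | zero => simp
        | add x y hx hy => simp only [map_add, hx, hy]
        | tmul x y => simp [comulBoson_inK, comulK_apply]
      simp only [AlgHom.comp_apply, comulBoson_inK, comulK_apply]
      refine (e1 _).trans ?_
      rw [e2, Coalgebra.coassoc_apply])
  (by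
    apply boson_algHom_ext
    · intro i
      simp only [AlgHom.comp_apply, comulBoson_inB, comulB_gen, comulGen, map_add, map_sum,
        Algebra.TensorProduct.map_tmul, counitBoson_inB, counitBoson_inK, S.counit_l]
      simp [TensorProduct.ite_tmul]
    · intro h
      have e (z : K ⊗[k] K) : Algebra.TensorProduct.map S.counitBoson (.id k _)
          (Algebra.TensorProduct.map S.inK S.inK z) =
            S.inK.toLinearMap.lTensor k (Coalgebra.counit.rTensor K z) := by
        induction z using TensorProduct.induction_on with
        | zero => simp
        | add x y hx hy => simp only [map_add, hx, hy]
        | tmul x y => simp [counitBoson_inK]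
      simp only [AlgHom.comp_apply, comulBoson_inK, comulK_apply]
      rw [e, Coalgebra.rTensor_counit_comul]
      simp)
  (by
    apply boson_algHom_ext
    · intro i
      simp only [AlgHom.comp_apply, comulBoson_inB, comulB_gen, comulGen, map_add, map_sum,
        Algebra.TensorProduct.map_tmul, counitBoson_inB]
      simp
    · intro h
      have e (z : K ⊗[k] K) : Algebra.TensorProduct.map (.id k _) S.counitBoson
          (Algebra.TensorProduct.map S.inK S.inK z) =
            S.inK.toLinearMap.rTensor k (Coalgebra.counit.lTensor K z) := by
        induction z using TensorProduct.induction_on with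
        | zero => simp
        | add x y hx hy => simp only [map_add, hx, hy]
        | tmul x y => simp [counitBoson_inK]
      simp only [AlgHom.comp_apply, comulBoson_inK, comulK_apply]
      rw [e, Coalgebra.lTensor_counit_comul]
      simp)

theorem comul_inB (b : BraidedVectors R') :
    Coalgebra.comul (R := k) (S.inB b) = S.semiComul (S.comul b) := S.comulBoson_inB b

theorem comul_inB_gen (i : ι) : Coalgebra.comul (R := k) (S.inB (gen R' i)) =
    S.inB (gen R' i) ⊗ₜ 1 + ∑ j, S.inK (l i j) ⊗ₜ S.inB (gen R' j) :=
  (S.comulBoson_inB _).trans (S.comulB_gen i)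

theorem comul_inK (h : K) : Coalgebra.comul (R := k) (S.inK h) =
    Algebra.TensorProduct.map S.inK S.inK (Coalgebra.comul h) := S.comulBoson_inK h

theorem counit_inB (b : BraidedVectors R') :
    Coalgebra.counit (R := k) (S.inB b) = counitHom R' b := S.counitBoson_inB b

theorem counit_inK (h : K) :
    Coalgebra.counit (R := k) (S.inK h) = Coalgebra.counit (R := k) h := S.counitBoson_inK h

/-- The inclusion of `K` in the bosonization, as a map of bialgebras. -/
def inKBialgHom : K →ₐc[k] S.Boson := .ofAlgHom S.inK
  (by ext h; exact S.counit_inK h) (by ext h; exact (S.comul_inK h).symm)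

theorem inKBialgHom_apply (h : K) : S.inKBialgHom h = S.inK h := rfl

end IsBraidedVectorAction

end Structure

/-! ### The antipode of the bosonization. -/

section Structure

variable {k ι K : Type*} [Field k] [Fintype ι] [DecidableEq ι] [Ring K] [HopfAlgebra k K]

namespace IsBraidedVectorAction

variable {R R' : Matrix (ι × ι) (ι × ι) k} {τ : ι → ι → K →ₗ[k] k} {l : ι → ι → K}
  (S : IsBraidedVectorAction R R' τ l)

/-- The antipode of the bosonization on `V(R')`, `b ↦ S(b⁽¹⁾) S(b⁽²⁾)`. -/
def antipodeB : BraidedVectors R' →ₗ[k] S.Boson :=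
  LinearMap.mul' k S.Boson ∘ₗ TensorProduct.map (S.inK.toLinearMap ∘ₗ HopfAlgebra.antipode k)
    (S.inB.toLinearMap ∘ₗ S.antipode) ∘ₗ S.coactHom.toLinearMap

/-- The antipode of the bosonization. -/
def antipodeBoson : S.Boson →ₗ[k] S.Boson :=
  LinearMap.mul' k S.Boson ∘ₗ
    TensorProduct.map (S.inK.toLinearMap ∘ₗ HopfAlgebra.antipode k) S.antipodeB ∘ₗ
    (TensorProduct.comm k _ _).toLinearMap ∘ₗ
    (SmashProduct.equiv S.isModuleAlgebra).symm.toLinearMap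

theorem antipodeBoson_inB_mul_inK (b : BraidedVectors R') (h : K) :
    S.antipodeBoson (S.inB b * S.inK h) = S.inK (HopfAlgebra.antipode k h) * S.antipodeB b := by
  rw [SmashProduct.inclB_mul_inclK]
  simp [antipodeBoson]

theorem antipodeBoson_inB (b : BraidedVectors R') : S.antipodeBoson (S.inB b) = S.antipodeB b := by
  simpa using S.antipodeBoson_inB_mul_inK b 1

theorem boson_induction {p : S.Boson → Prop} (zero : p 0) (add : ∀ x y, p x → p y → p (x + y))
    (mul : ∀ b h, p (S.inB b * S.inK h)) (x : S.Boson) : p x := by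
  obtain ⟨u, rfl⟩ := (SmashProduct.equiv S.isModuleAlgebra).surjective x
  induction u using TensorProduct.induction_on with
  | zero => simpa using zero
  | add x y hx hy =>
    rw [map_add]
    exact add _ _ hx hy
  | tmul b h =>
    rw [← SmashProduct.inclB_mul_inclK]
    exact mul b h

/-- Antimultiplicativity is needed only for right factors in `K`, because the bosonization is
spanned by products `b h`. -/
theorem antipodeBoson_mul_inK (x : S.Boson) (h : K) :
    S.antipodeBoson (x * S.inK h) = S.inK (HopfAlgebra.antipode k h) * S.antipodeBoson x := by
  induction x using S.boson_induction with
  | zero => simp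
  | add x y hx hy => simp only [map_add, add_mul, mul_add, hx, hy]
  | mul b g =>
    rw [mul_assoc, ← map_mul, antipodeBoson_inB_mul_inK, antipodeBoson_inB_mul_inK,
      HopfAlgebra.antipode_mul_antidistrib, map_mul, mul_assoc]

theorem comul_inB_mul_inK (b : BraidedVectors R') (h : K) :
    Coalgebra.comul (R := k) (S.inB b * S.inK h) = S.semiComul (S.comul b) *
      Algebra.TensorProduct.map S.inK S.inK (Coalgebra.comul h) := by
  rw [Bialgebra.comul_mul, comul_inB, comul_inK]

/-- For `b h` the factor `h` contributes `S(h₁) h₂` around the contraction for `b`. The latter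
reduces to the braided antipode axiom because the braided coproduct is a comodule map. -/
theorem mul_antipodeBoson_left (x : S.Boson) :
    LinearMap.mul' k S.Boson (S.antipodeBoson.rTensor _ (Coalgebra.comul x)) =
      algebraMap k _ (Coalgebra.counit x) := by
  induction x using S.boson_induction with
  | zero => simp
  | add x y hx hy => simp only [map_add, hx, hy]
  | mul b h =>
    have h1 (w : S.Boson ⊗[k] S.Boson) (z : K ⊗[k] K) (c : k)
        (hw : LinearMap.mul' k S.Boson (S.antipodeBoson.rTensor _ w) = algebraMap k _ c) :
        LinearMap.mul' k S.Boson (S.antipodeBoson.rTensor _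
          (w * Algebra.TensorProduct.map S.inK S.inK z)) =
        c • S.inK (LinearMap.mul' k K ((HopfAlgebra.antipode k).rTensor K z)) := by
      induction z using TensorProduct.induction_on with
      | zero => simp
      | add x y hx hy => simp only [map_add, mul_add, smul_add, hx, hy]
      | tmul x y =>
        have h2 : LinearMap.mul' k S.Boson (S.antipodeBoson.rTensor _
            (w * (S.inK x ⊗ₜ S.inK y))) = S.inK (HopfAlgebra.antipode k x) *
              LinearMap.mul' k S.Boson (S.antipodeBoson.rTensor _ w) * S.inK y := by
          clear hw
          induction w using TensorProduct.induction_on with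
          | zero => simp
          | add x y hx hy => simp only [map_add, mul_add, add_mul, hx, hy]
          | tmul u v => simp [antipodeBoson_mul_inK, mul_assoc]
        rw [Algebra.TensorProduct.map_tmul, h2, hw, Algebra.algebraMap_eq_smul_one]
        simp
    -- `N` sends `g ⊗ d ⊗ e` to `S(g)` times the braided antipode of `d` times `e`.
    -- Antimultiplicativity in `K` combines the two coaction legs into `S(d⁽¹⁾ e⁽¹⁾)`, the leg of
    -- the tensor product coaction.
    let N : K ⊗[k] (BraidedVectors R' ⊗[k] BraidedVectors R') →ₗ[k] S.Boson :=
      LinearMap.mul' k S.Boson ∘ₗ TensorProduct.map (S.inK.toLinearMap ∘ₗ HopfAlgebra.antipode k)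
        (S.inB.toLinearMap ∘ₗ LinearMap.mul' k _ ∘ₗ S.antipode.rTensor _)
    have h3 (u : BraidedVectors R' ⊗[k] BraidedVectors R') :
        LinearMap.mul' k S.Boson (S.antipodeBoson.rTensor _ (S.semiComul u)) =
          N (tensorCoact S.coactHom.toLinearMap u) := by
      induction u using TensorProduct.induction_on with
      | zero => simp
      | add x y hx hy => simp only [map_add, hx, hy]
      | tmul d e =>
        rw [tensorCoact_tmul, semiComul_tmul, coactBoson, AlgHom.comp_apply]
        generalize S.coactHom e = y
        induction y using TensorProduct.induction_on with
        | zero => simp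
        | add y y' hy hy' => simp only [map_add, mul_add, TensorProduct.tmul_add, hy, hy']
        | tmul g e =>
          simp only [Algebra.TensorProduct.map_tmul, Algebra.TensorProduct.tmul_mul_tmul, one_mul,
            LinearMap.rTensor_tmul, antipodeBoson_inB_mul_inK, LinearMap.mul'_apply, antipodeB,
            LinearMap.comp_apply, AlgHom.toLinearMap_apply]
          generalize S.coactHom d = x
          induction x using TensorProduct.induction_on with
          | zero => simp
          | add y y' hy hy' =>
            simp only [map_add, mul_add, add_mul, TensorProduct.add_tmul, hy, hy']
          | tmul g' d =>
            simp [N, mulFirst_tmul, HopfAlgebra.antipode_mul_antidistrib, mul_assoc]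
    have h4 (y : K ⊗[k] BraidedVectors R') : N (S.comul.lTensor K y) = LinearMap.mul' k S.Boson
        (TensorProduct.map (S.inK.toLinearMap ∘ₗ HopfAlgebra.antipode k) (Algebra.linearMap k _)
          ((counitHom R').toLinearMap.lTensor K y)) := by
      induction y using TensorProduct.induction_on with
      | zero => simp
      | add y y' hy hy' => simp only [map_add, hy, hy']
      | tmul g e => simp [N, mul_antipode_left, Algebra.algebraMap_eq_smul_one]
    rw [comul_inB_mul_inK, h1 _ _ (counitHom R' b) (by
      rw [h3, comul_coact, h4, coact_counit]
      simp)]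
    simp [counit_inB, counit_inK, Algebra.algebraMap_eq_smul_one, smul_smul]

/-- For `b h` the inner `h₁ S(h₂)` collapses first. Then coassociativity of the coaction produces
`e⁽¹⁾ S(e⁽²⁾)` inside `K`, which collapses too and leaves the braided antipode axiom. -/
theorem mul_antipodeBoson_right (x : S.Boson) :
    LinearMap.mul' k S.Boson (S.antipodeBoson.lTensor _ (Coalgebra.comul x)) =
      algebraMap k _ (Coalgebra.counit x) := by
  induction x using S.boson_induction with
  | zero => simp
  | add x y hx hy => simp only [map_add, hx, hy]
  | mul b h =>
    have h1 (w : S.Boson ⊗[k] S.Boson) :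
        LinearMap.mul' k S.Boson (S.antipodeBoson.lTensor _
          (w * Algebra.TensorProduct.map S.inK S.inK (Coalgebra.comul h))) =
        Coalgebra.counit (R := k) h • LinearMap.mul' k S.Boson (S.antipodeBoson.lTensor _ w) := by
      induction w using TensorProduct.induction_on with
      | zero => simp
      | add x y hx hy => simp only [map_add, add_mul, smul_add, hx, hy]
      | tmul u v =>
        have h2 (z : K ⊗[k] K) : LinearMap.mul' k S.Boson (S.antipodeBoson.lTensor _
            ((u ⊗ₜ v) * Algebra.TensorProduct.map S.inK S.inK z)) =
              u * S.inK (LinearMap.mul' k K ((HopfAlgebra.antipode k).lTensor K z)) *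
                S.antipodeBoson v := by
          induction z using TensorProduct.induction_on with
          | zero => simp
          | add x y hx hy => simp only [map_add, mul_add, add_mul, hx, hy]
          | tmul x y => simp [antipodeBoson_mul_inK, mul_assoc]
        rw [h2]
        simp [Algebra.algebraMap_eq_smul_one]
    have h3 (u : BraidedVectors R' ⊗[k] BraidedVectors R') :
        LinearMap.mul' k S.Boson (S.antipodeBoson.lTensor _ (S.semiComul u)) =
          S.inB (LinearMap.mul' k _ (S.antipode.lTensor _ u)) := by
      induction u using TensorProduct.induction_on with
      | zero => simp
      | add x y hx hy => simp only [map_add, hx, hy]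
      | tmul d e =>
        let M : K ⊗[k] (K ⊗[k] BraidedVectors R') →ₗ[k] S.Boson :=
          LinearMap.mul' k S.Boson ∘ₗ TensorProduct.map S.inK.toLinearMap
            (LinearMap.mul' k S.Boson ∘ₗ TensorProduct.map
              (S.inK.toLinearMap ∘ₗ HopfAlgebra.antipode k) (S.inB.toLinearMap ∘ₗ S.antipode))
        have h4 (y : K ⊗[k] BraidedVectors R') : LinearMap.mul' k S.Boson
            (S.antipodeBoson.lTensor _ ((S.inB d ⊗ₜ 1) *
              Algebra.TensorProduct.map S.inK S.inB y)) =
            S.inB d * M (S.coactHom.toLinearMap.lTensor K y) := by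
          induction y using TensorProduct.induction_on with
          | zero => simp
          | add y y' hy hy' => simp only [map_add, mul_add, hy, hy']
          | tmul g e => simp [M, antipodeBoson_inB, antipodeB, mul_assoc]
        have h5 (y : K ⊗[k] BraidedVectors R') :
            M (TensorProduct.assoc k _ _ _ (Coalgebra.comul.rTensor _ y)) =
              S.inB (S.antipode (TensorProduct.lid k _ (Coalgebra.counit.rTensor _ y))) := by
          induction y using TensorProduct.induction_on with
          | zero => simp
          | add y y' hy hy' => simp only [map_add, hy, hy']
          | tmul g e =>
            have h6 (z : K ⊗[k] K) : M (TensorProduct.assoc k _ _ _ (z ⊗ₜ e)) =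
                S.inK (LinearMap.mul' k K ((HopfAlgebra.antipode k).lTensor K z)) *
                  S.inB (S.antipode e) := by
              induction z using TensorProduct.induction_on with
              | zero => simp
              | add x y hx hy => simp only [map_add, TensorProduct.add_tmul, add_mul, hx, hy]
              | tmul x y => simp [M, mul_assoc]
            rw [LinearMap.rTensor_tmul, h6]
            simp [Algebra.algebraMap_eq_smul_one]
        rw [semiComul_tmul, coactBoson, AlgHom.comp_apply, h4, ← coactHom_coassoc, h5,
          coactHom_counit]
        simp
    rw [comul_inB_mul_inK, h1, h3, mul_antipode_right]
    simp [counit_inB, counit_inK, Algebra.algebraMap_eq_smul_one, smul_smul, mul_comm]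

instance : HopfAlgebra k S.Boson where
  antipode := S.antipodeBoson
  mul_antipode_rTensor_comul := LinearMap.ext S.mul_antipodeBoson_left
  mul_antipode_lTensor_comul := LinearMap.ext S.mul_antipodeBoson_right

theorem isBosonization : IsBosonization S.toBraidedHopfStructure S.inB S.inKBialgHom where
  bijective := by
    have : ⇑(LinearMap.mul' k S.Boson ∘ₗ TensorProduct.map S.inB.toLinearMap
        (S.inKBialgHom : K →ₗ[k] S.Boson)) = SmashProduct.equiv S.isModuleAlgebra :=
      funext fun u => (SmashProduct.equiv_eq S.isModuleAlgebra u).symm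
    rw [this]
    exact (SmashProduct.equiv S.isModuleAlgebra).bijective
  cross h b := SmashProduct.inclK_mul_inclB S.isModuleAlgebra h b
  comul_j b := by
    change Coalgebra.comul (R := k) (S.inB b) = (LinearMap.mul' k S.Boson).rTensor S.Boson
      ((TensorProduct.assoc k S.Boson S.Boson S.Boson).symm
        (TensorProduct.map S.inB.toLinearMap (TensorProduct.map S.inK.toLinearMap
          S.inB.toLinearMap ∘ₗ S.coactHom.toLinearMap) (S.comul b)))
    rw [comul_inB]
    generalize S.comul b = u
    induction u using TensorProduct.induction_on with
    | zero => simp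
    | add x y hx hy => simp only [map_add, hx, hy]
    | tmul d e =>
      simp only [semiComul_tmul, coactBoson, AlgHom.comp_apply, TensorProduct.map_tmul,
        LinearMap.comp_apply, AlgHom.toLinearMap_apply]
      generalize S.coactHom e = y
      induction y using TensorProduct.induction_on with
      | zero => simp
      | add y y' hy hy' => simp only [map_add, mul_add, TensorProduct.tmul_add, hy, hy']
      | tmul g e => simp
  counit_j b := S.counit_inB b

end IsBraidedVectorAction

end Structure

/-! ### Separating functionals on tensor products. -/

section Separation

variable {k V W : Type*} [Field k] [AddCommGroup V] [Module k V] [AddCommGroup W] [Module k W]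

/-- If the functionals `φ y` separate the elements of `W` then their slice maps separate the
elements of `V ⊗ W`. -/
theorem eq_zero_of_lTensor {Y : Type*} {φ : Y → W →ₗ[k] k} (hφ : ∀ w, (∀ y, φ y w = 0) → w = 0)
    {z : V ⊗[k] W} (hz : ∀ y, (φ y).lTensor V z = 0) : z = 0 := by
  classical
  let b := Module.Basis.ofVectorSpace k V
  apply (TensorProduct.equivFinsuppOfBasisLeft (N := W) b).injective
  rw [map_zero]
  ext i
  apply hφ
  intro y
  have key (z : V ⊗[k] W) : φ y (TensorProduct.equivFinsuppOfBasisLeft b z i) =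
      b.coord i (TensorProduct.rid k V ((φ y).lTensor V z)) := by
    induction z using TensorProduct.induction_on with
    | zero => simp
    | add x y hx hy => simp only [map_add, Finsupp.add_apply, hx, hy]
    | tmul v w => simp [mul_comm]
  rw [key, hz]
  simp

/-- Slicing one factor at a time reduces to the two separating families. This is what allows
coproducts in `H` and in `C` to be read off from products in `A` and sums in `ℤ`. -/
theorem eq_of_map_tensor {X Y : Type*} {ψ : X → V →ₗ[k] k} {φ : Y → W →ₗ[k] k}
    (hψ : ∀ v, (∀ x, ψ x v = 0) → v = 0) (hφ : ∀ w, (∀ y, φ y w = 0) → w = 0)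
    {z z' : V ⊗[k] W} (hz : ∀ x y, LinearMap.mul' k k (TensorProduct.map (ψ x) (φ y) z) =
      LinearMap.mul' k k (TensorProduct.map (ψ x) (φ y) z')) : z = z' := by
  rw [← sub_eq_zero]
  refine eq_zero_of_lTensor hφ fun y => ?_
  rw [← (TensorProduct.rid k V).map_eq_zero_iff]
  apply hψ
  intro x
  have key (z : V ⊗[k] W) : ψ x (TensorProduct.rid k V ((φ y).lTensor V z)) =
      LinearMap.mul' k k (TensorProduct.map (ψ x) (φ y) z) := by
    induction z using TensorProduct.induction_on with
    | zero => simp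
    | add x y hx hy => simp only [map_add, hx, hy]
    | tmul v w => simp [mul_comm]
  rw [key, map_sub, map_sub, hz, sub_self]

end Separation

/-! ### Unit values and convolution inverse of a dual quasitriangular form. -/

section DualQuasitriangularForms

variable {k A : Type*} [Field k] [Ring A] [HopfAlgebra k A] (r : DualQuasitriangular k A)

namespace DualQuasitriangular

/-- The functional `𝓡( - ⊗ 1)` is idempotent under convolution, by bimultiplicativity at `1 * 1`,
and has a right convolution inverse; so it is the convolution unit. The left slot is treated alike.
-/
theorem form_one_right (x : A) : r.form x 1 = Coalgebra.counit (R := k) x := by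
  let u : WithConv (A →ₗ[k] k) := WithConv.toConv (r.form.flip 1)
  let v : WithConv (A →ₗ[k] k) := WithConv.toConv (r.inv.flip 1)
  have huu : u * u = u := by
    ext x
    simpa [u] using (r.form_mul_right x 1 1).symm
  have huv : u * v = 1 := by
    ext x
    have := LinearMap.congr_fun r.form_inv (x ⊗ₜ 1)
    simp only [LinearMap.comp_apply, TensorProduct.comul_tmul, Bialgebra.comul_one,
      TensorProduct.counit_tmul, Algebra.TensorProduct.one_def] at this
    rw [LinearMap.convMul_apply, LinearMap.convOne_apply]
    simp only [Bialgebra.counit_one, smul_eq_mul, one_mul] at this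
    refine Eq.trans ?_ this
    generalize (Coalgebra.comul x : A ⊗[k] A) = z
    induction z using TensorProduct.induction_on with
    | zero => simp
    | add x y hx hy => simp only [map_add, TensorProduct.add_tmul, hx, hy]
    | tmul a b => simp [u, v]
  have hu : u = 1 := by
    calc u = u * (u * v) := by rw [huv, mul_one]
      _ = 1 := by rw [← mul_assoc, huu, huv]
  simpa [u] using congrArg (fun f => f.ofConv x) hu

theorem form_one_left (x : A) : r.form 1 x = Coalgebra.counit (R := k) x := by
  let u : WithConv (A →ₗ[k] k) := WithConv.toConv (r.form 1)
  let v : WithConv (A →ₗ[k] k) := WithConv.toConv (r.inv 1)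
  have huu : u * u = u := by
    ext x
    simpa [u] using (r.form_mul_left 1 1 x).symm
  have huv : u * v = 1 := by
    ext x
    have := LinearMap.congr_fun r.form_inv (1 ⊗ₜ x)
    simp only [LinearMap.comp_apply, TensorProduct.comul_tmul, Bialgebra.comul_one,
      TensorProduct.counit_tmul, Algebra.TensorProduct.one_def] at this
    rw [LinearMap.convMul_apply, LinearMap.convOne_apply]
    simp only [Bialgebra.counit_one, smul_eq_mul, mul_one] at this
    refine Eq.trans ?_ this
    generalize (Coalgebra.comul x : A ⊗[k] A) = z
    induction z using TensorProduct.induction_on with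
    | zero => simp
    | add x y hx hy => simp only [map_add, TensorProduct.tmul_add, hx, hy]
    | tmul a b => simp [u, v]
  have hu : u = 1 := by
    calc u = u * (u * v) := by rw [huv, mul_one]
      _ = 1 := by rw [← mul_assoc, huu, huv]
  simpa [u] using congrArg (fun f => f.ofConv x) hu

/-- `𝓡(S - ⊗ - )` is a left convolution inverse of `𝓡` and the given inverse is a right one, so they
agree. -/
theorem inv_eq (a b : A) : r.inv a b = r.form (HopfAlgebra.antipode k a) b := by
  let f : WithConv (A ⊗[k] A →ₗ[k] k) := WithConv.toConv (TensorProduct.lift r.form)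
  let g : WithConv (A ⊗[k] A →ₗ[k] k) := WithConv.toConv (TensorProduct.lift r.inv)
  let s : WithConv (A ⊗[k] A →ₗ[k] k) :=
    WithConv.toConv (TensorProduct.lift (r.form ∘ₗ HopfAlgebra.antipode k))
  have hfg : f * g = 1 := by
    ext1
    have := r.form_inv
    rw [LinearMap.convMul_def, LinearMap.convOne_def]
    exact this
  have hsf : s * f = 1 := by
    ext1
    apply TensorProduct.ext'
    intro a b
    rw [LinearMap.convMul_def, LinearMap.convOne_def]
    simp only [LinearMap.comp_apply, TensorProduct.comul_tmul, s, f]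
    have key (z : A ⊗[k] A) : LinearMap.mul' k k (TensorProduct.map
        (TensorProduct.lift (r.form ∘ₗ HopfAlgebra.antipode k)) (TensorProduct.lift r.form)
        (TensorProduct.AlgebraTensorModule.tensorTensorTensorComm k k k k A A A A
          (z ⊗ₜ Coalgebra.comul b))) =
        r.form (LinearMap.mul' k A ((HopfAlgebra.antipode k).rTensor A z)) b := by
      induction z using TensorProduct.induction_on with
      | zero => simp
      | add x y hx hy => simp only [map_add, TensorProduct.add_tmul, LinearMap.add_apply, hx, hy]
      | tmul x y =>
        rw [LinearMap.rTensor_tmul, LinearMap.mul'_apply, r.form_mul_left]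
        generalize (Coalgebra.comul b : A ⊗[k] A) = w
        induction w using TensorProduct.induction_on with
        | zero => simp
        | add x y hx hy => simp only [map_add, TensorProduct.tmul_add, hx, hy]
        | tmul a b => simp
    rw [key, HopfAlgebra.mul_antipode_rTensor_comul_apply, Algebra.algebraMap_eq_smul_one]
    simp [form_one_left, mul_comm]
  have hgs : g = s := by rw [← one_mul g, ← hsf, mul_assoc, hfg, mul_one]
  simpa [g, s] using congrArg (fun f => f.ofConv (a ⊗ₜ b)) hgs

end DualQuasitriangular

end DualQuasitriangularForms

/-! ### The antipode on a matrix coalgebra. -/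

section MatrixAntipode

variable {k ι A : Type*} [Field k] [Fintype ι] [DecidableEq ι] [Ring A] [HopfAlgebra k A]
  {t : Matrix ι ι A}

theorem sum_antipode_mul
    (comul_t : ∀ i j, Coalgebra.comul (R := k) (t i j) = ∑ a, t i a ⊗ₜ[k] t a j)
    (counit_t : ∀ i j, Coalgebra.counit (R := k) (t i j) = if i = j then 1 else 0) (i j : ι) :
    ∑ a, HopfAlgebra.antipode k (t i a) * t a j = if i = j then 1 else 0 := by
  have := HopfAlgebra.mul_antipode_rTensor_comul_apply (R := k) (t i j)
  simpa [comul_t, counit_t, apply_ite] using this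

theorem sum_mul_antipode
    (comul_t : ∀ i j, Coalgebra.comul (R := k) (t i j) = ∑ a, t i a ⊗ₜ[k] t a j)
    (counit_t : ∀ i j, Coalgebra.counit (R := k) (t i j) = if i = j then 1 else 0) (i j : ι) :
    ∑ a, t i a * HopfAlgebra.antipode k (t a j) = if i = j then 1 else 0 := by
  have := HopfAlgebra.mul_antipode_lTensor_comul_apply (R := k) (t i j)
  simpa [comul_t, counit_t, apply_ite] using this

/-- Over `A ⊗ A`, the matrix `Δ(S t)` is a left inverse of `Δ(t)`, and the matrix of flipped tensors
of `S t` is a right inverse. -/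
theorem comul_antipode
    (comul_t : ∀ i j, Coalgebra.comul (R := k) (t i j) = ∑ a, t i a ⊗ₜ[k] t a j)
    (counit_t : ∀ i j, Coalgebra.counit (R := k) (t i j) = if i = j then 1 else 0) (i j : ι) :
    Coalgebra.comul (R := k) (HopfAlgebra.antipode k (t i j)) =
      ∑ a, HopfAlgebra.antipode k (t a j) ⊗ₜ[k] HopfAlgebra.antipode k (t i a) := by
  let Δ : A →ₐ[k] A ⊗[k] A := Bialgebra.comulAlgHom k A
  let X : Matrix ι ι (A ⊗[k] A) := .of fun i j => Δ (HopfAlgebra.antipode k (t i j))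
  let T : Matrix ι ι (A ⊗[k] A) := .of fun i j => Δ (t i j)
  let Y : Matrix ι ι (A ⊗[k] A) := .of fun i j =>
    ∑ a, HopfAlgebra.antipode k (t a j) ⊗ₜ[k] HopfAlgebra.antipode k (t i a)
  have hXT : X * T = 1 := by
    ext i j
    simp only [Matrix.mul_apply, X, T, Matrix.of_apply, ← map_mul, ← map_sum,
      sum_antipode_mul comul_t counit_t, Matrix.one_apply]
    split_ifs <;> simp
  have hTY : T * Y = 1 := by
    ext i j
    have h (b : ι) : T i b = ∑ a, t i a ⊗ₜ[k] t a b := comul_t i b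
    simp only [Matrix.mul_apply, h, Y, Matrix.of_apply, Finset.sum_mul_sum,
      Algebra.TensorProduct.tmul_mul_tmul]
    calc ∑ b, ∑ a, ∑ c, (t i a * HopfAlgebra.antipode k (t c j)) ⊗ₜ[k]
          (t a b * HopfAlgebra.antipode k (t b c))
        = ∑ a, ∑ c, (t i a * HopfAlgebra.antipode k (t c j)) ⊗ₜ[k]
          (∑ b, t a b * HopfAlgebra.antipode k (t b c)) := by
          rw [Finset.sum_comm]
          refine Finset.sum_congr rfl fun a _ => ?_
          rw [Finset.sum_comm]
          simp only [TensorProduct.tmul_sum]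
      _ = (∑ a, t i a * HopfAlgebra.antipode k (t a j)) ⊗ₜ[k] 1 := by
          rw [TensorProduct.sum_tmul]
          simp [sum_mul_antipode comul_t counit_t, TensorProduct.tmul_ite]
      _ = _ := by
          rw [sum_mul_antipode comul_t counit_t, Matrix.one_apply]
          split_ifs <;> simp [Algebra.TensorProduct.one_def]
  have : X = Y := by rw [← mul_one X, ← hTY, ← mul_assoc, hXT, one_mul]
  exact congrFun (congrFun this i) j

end MatrixAntipode

/-! ### Matrices acting on three tensor legs. -/

section Legs

variable {k ι : Type*} [Field k] [Fintype ι] [DecidableEq ι]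

theorem leg13_one : leg13 (1 : Matrix (ι × ι) (ι × ι) k) = 1 := by
  ext ⟨x, y, z⟩ ⟨x', y', z'⟩
  simp only [leg13, Matrix.of_apply, Matrix.one_apply, Prod.mk.injEq]
  grind

theorem leg23_one : leg23 (1 : Matrix (ι × ι) (ι × ι) k) = 1 := by
  ext ⟨x, y, z⟩ ⟨x', y', z'⟩
  simp only [leg23, Matrix.of_apply, Matrix.one_apply, Prod.mk.injEq]
  grind

theorem leg13_mul (M N : Matrix (ι × ι) (ι × ι) k) : leg13 (M * N) = leg13 M * leg13 N := by
  ext ⟨x, y, z⟩ ⟨x', y', z'⟩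
  simp [leg13, Matrix.mul_apply, Fintype.sum_prod_type]

theorem leg23_mul (M N : Matrix (ι × ι) (ι × ι) k) : leg23 (M * N) = leg23 M * leg23 N := by
  ext ⟨x, y, z⟩ ⟨x', y', z'⟩
  simp [leg23, Matrix.mul_apply, Fintype.sum_prod_type]

theorem mul_leg12_apply (X : Matrix (ι × ι × ι) (ι × ι × ι) k) (M : Matrix (ι × ι) (ι × ι) k)
    (x : ι × ι × ι) (c d q : ι) :
    (X * leg12 M) x (c, d, q) = ∑ j, ∑ l, X x (j, l, q) * M (j, l) (c, d) := by
  simp [leg12, Matrix.mul_apply, Fintype.sum_prod_type]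

theorem leg12_mul_apply (X : Matrix (ι × ι × ι) (ι × ι × ι) k) (M : Matrix (ι × ι) (ι × ι) k)
    (x : ι × ι × ι) (c d q : ι) :
    (leg12 M * X) (c, d, q) x = ∑ j, ∑ l, M (c, d) (j, l) * X (j, l, q) x := by
  simp [leg12, Matrix.mul_apply, Fintype.sum_prod_type]

theorem mul_leg23_apply (X : Matrix (ι × ι × ι) (ι × ι × ι) k) (M : Matrix (ι × ι) (ι × ι) k)
    (x : ι × ι × ι) (q c d : ι) :
    (X * leg23 M) x (q, c, d) = ∑ j, ∑ l, X x (q, j, l) * M (j, l) (c, d) := by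
  simp [leg23, Matrix.mul_apply, Fintype.sum_prod_type]

theorem leg23_mul_apply (X : Matrix (ι × ι × ι) (ι × ι × ι) k) (M : Matrix (ι × ι) (ι × ι) k)
    (x : ι × ι × ι) (q c d : ι) :
    (leg23 M * X) (q, c, d) x = ∑ j, ∑ l, M (c, d) (j, l) * X (q, j, l) x := by
  simp [leg23, Matrix.mul_apply, Fintype.sum_prod_type]

theorem leg13_mul_leg23_apply (M N : Matrix (ι × ι) (ι × ι) k) (i m p j l q : ι) :
    (leg13 M * leg23 N) (i, m, p) (j, l, q) = ∑ c, M (i, p) (j, c) * N (m, c) (l, q) := by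
  simp [leg13, leg23, Matrix.mul_apply, Fintype.sum_prod_type]

theorem leg23_mul_leg13_apply (M N : Matrix (ι × ι) (ι × ι) k) (i m p j l q : ι) :
    (leg23 M * leg13 N) (i, m, p) (j, l, q) = ∑ c, M (m, p) (l, c) * N (i, c) (j, q) := by
  simp [leg13, leg23, Matrix.mul_apply, Fintype.sum_prod_type]

theorem leg12_mul_leg13_apply (M N : Matrix (ι × ι) (ι × ι) k) (p i m q j l : ι) :
    (leg12 M * leg13 N) (p, i, m) (q, j, l) = ∑ c, M (p, i) (c, j) * N (c, m) (q, l) := by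
  simp [leg12, leg13, Matrix.mul_apply, Fintype.sum_prod_type]

theorem leg13_mul_leg12_apply (M N : Matrix (ι × ι) (ι × ι) k) (p i m q j l : ι) :
    (leg13 M * leg12 N) (p, i, m) (q, j, l) = ∑ c, M (p, m) (c, l) * N (c, i) (q, j) := by
  simp [leg12, leg13, Matrix.mul_apply, Fintype.sum_prod_type]

/-- The second condition of (i), multiplied on the left by `R₁₃⁻¹ R₂₃⁻¹` and on the right by `R₂₃⁻¹
R₁₃⁻¹`. It is the form needed for `l⁺`, whose values on `S t` are given by `R⁻¹`. -/
theorem IsBraidedVectorDatum.leg_inv {R R' : Matrix (ι × ι) (ι × ι) k}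
    (h : IsBraidedVectorDatum R R') :
    leg13 R⁻¹ * leg23 R⁻¹ * leg12 R' = leg12 R' * (leg23 R⁻¹ * leg13 R⁻¹) := by
  have hdet := (Matrix.isUnit_iff_isUnit_det R).1 h.isUnit_R
  have h1 : leg23 R⁻¹ * leg23 R = 1 := by
    rw [← leg23_mul, Matrix.nonsing_inv_mul _ hdet, leg23_one]
  have h2 : leg13 R⁻¹ * leg13 R = 1 := by
    rw [← leg13_mul, Matrix.nonsing_inv_mul _ hdet, leg13_one]
  have h3 : leg23 R * leg23 R⁻¹ = 1 := by
    rw [← leg23_mul, Matrix.mul_nonsing_inv _ hdet, leg23_one]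
  have h4 : leg13 R * leg13 R⁻¹ = 1 := by
    rw [← leg13_mul, Matrix.mul_nonsing_inv _ hdet, leg13_one]
  calc leg13 R⁻¹ * leg23 R⁻¹ * leg12 R'
      = leg13 R⁻¹ * leg23 R⁻¹ * (leg12 R' * leg13 R * (leg23 R * leg23 R⁻¹) * leg13 R⁻¹) := by
        rw [h3, mul_one, mul_assoc (leg12 R'), h4, mul_one]
    _ = leg13 R⁻¹ * leg23 R⁻¹ * (leg12 R' * leg13 R * leg23 R) * leg23 R⁻¹ * leg13 R⁻¹ := by
        simp only [mul_assoc]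
    _ = leg13 R⁻¹ * (leg23 R⁻¹ * leg23 R) * leg13 R * leg12 R' * leg23 R⁻¹ * leg13 R⁻¹ := by
        rw [← h.mixed_right]
        simp only [mul_assoc]
    _ = _ := by
        rw [h1, mul_one, h2, one_mul, mul_assoc]

end Legs

/-! ### Values of the form on `t` and `S t`. -/

section FormValues

open HopfAlgebra (antipode)

variable {k ι A : Type*} [Field k] [Fintype ι] [DecidableEq ι] [Ring A] [HopfAlgebra k A]
  {r : DualQuasitriangular k A} {t : Matrix ι ι A} {Q : Matrix (ι × ι) (ι × ι) k}

namespace IsMatrixQuantumGroup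

theorem comul_antipode (ht : IsMatrixQuantumGroup r t Q) (i j : ι) :
    Coalgebra.comul (R := k) (antipode k (t i j)) =
    ∑ a, antipode k (t a j) ⊗ₜ[k] antipode k (t i a) :=
  QPoincare.comul_antipode ht.comul_t ht.counit_t i j

theorem counit_antipode (ht : IsMatrixQuantumGroup r t Q) (i j : ι) :
    Coalgebra.counit (R := k) (antipode k (t i j)) = if i = j then 1 else 0 := by
  rw [HopfAlgebra.counit_antipode, ht.counit_t]

/-- Apply `𝓡( - ⊗ t)` to `S(t) t = 1`; the matrix coproduct of `t` turns the product in the left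
slot into a matrix product. -/
theorem form_antipode_mul (ht : IsMatrixQuantumGroup r t Q) :
    (Matrix.of fun x y : ι × ι => r.form (antipode k (t x.1 y.1)) (t x.2 y.2)) * Q = 1 := by
  ext ⟨i, p⟩ ⟨j, q⟩
  have := congrArg (fun a => r.form a (t p q)) (sum_antipode_mul ht.comul_t ht.counit_t i j)
  simp only [map_sum, LinearMap.sum_apply, r.form_mul_left, ht.comul_t, TensorProduct.map_tmul,
    LinearMap.mul'_apply, ht.form_t] at this
  simp only [Matrix.mul_apply, Matrix.of_apply, Fintype.sum_prod_type, this, Matrix.one_apply,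
    Prod.mk.injEq, ite_and]
  split_ifs <;> simp_all [r.form_one_left, ht.counit_t]

theorem form_antipode_t (ht : IsMatrixQuantumGroup r t Q) (i j m l : ι) :
    r.form (antipode k (t i j)) (t m l) = Q⁻¹ (i, m) (j, l) := by
  rw [Matrix.inv_eq_left_inv ht.form_antipode_mul]
  rfl

/-- Apply `𝓡(S t ⊗ - )` to `S(t) t = 1`. The matrix obtained is a left inverse of the values on `S t
⊗ t`, which themselves invert `Q`, so it is `Q` again. -/
theorem form_antipode_antipode (ht : IsMatrixQuantumGroup r t Q) (i j m l : ι) :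
    r.form (antipode k (t i j)) (antipode k (t m l)) = Q (i, m) (j, l) := by
  let J : Matrix (ι × ι) (ι × ι) k :=
    .of fun x y => r.form (antipode k (t x.1 y.1)) (antipode k (t x.2 y.2))
  have hJ : J * (Matrix.of fun x y : ι × ι => r.form (antipode k (t x.1 y.1)) (t x.2 y.2)) = 1 := by
    ext ⟨i, p⟩ ⟨j, q⟩
    have := congrArg (r.form (antipode k (t i j)))
      (sum_antipode_mul ht.comul_t ht.counit_t p q)
    simp only [map_sum, r.form_mul_right, ht.comul_antipode, TensorProduct.map_tmul,
      LinearMap.mul'_apply, LinearMap.flip_apply] at this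
    simp only [Matrix.mul_apply, Matrix.of_apply, Fintype.sum_prod_type, Matrix.one_apply,
      Prod.mk.injEq, J]
    rw [Finset.sum_comm]
    simp only [mul_comm (r.form _ (antipode k _)), this, and_comm (a := i = j), ite_and]
    split_ifs <;> simp_all [r.form_one_right, ht.counit_antipode]
  have : J = Q := by
    rw [← mul_one J, ← ht.form_antipode_mul, ← mul_assoc, hJ, one_mul]
  exact congrFun (congrFun this (i, m)) (j, l)

end IsMatrixQuantumGroup

end FormValues

/-! ### The coaction matrix `S t` intertwines `R'` under the pairing with `H`. -/

section Intertwining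

open HopfAlgebra (antipode)

variable {k ι A H : Type*} [Field k] [Fintype ι] [DecidableEq ι] [Ring A] [HopfAlgebra k A]
  [Ring H] [HopfAlgebra k H] {r : DualQuasitriangular k A} {t : Matrix ι ι A}
  {R R' : Matrix (ι × ι) (ι × ι) k} {lam : k} {pair : HopfPairing k H A} {lp lm : Matrix ι ι H}

theorem inv_smul_matrix {n : Type*} [Fintype n] [DecidableEq n] {M : Matrix n n k} (hM : IsUnit M)
    (hlam : lam ≠ 0) : (lam • M)⁻¹ = lam⁻¹ • M⁻¹ := by
  apply Matrix.inv_eq_left_inv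
  rw [Matrix.smul_mul, Matrix.mul_smul, smul_smul, inv_mul_cancel₀ hlam, one_smul,
    Matrix.nonsing_inv_mul _ ((Matrix.isUnit_iff_isUnit_det M).1 hM)]

theorem IsFRTEnveloping.pair_lm_eq (hl : IsFRTEnveloping r t pair lp lm) (i j : ι) (a : A) :
    pair.toFun (lm i j) a = r.form (antipode k (t i j)) a := by
  rw [hl.pair_lm, r.inv_eq]

/-- `⟨h, (S t)₁ (S t)₂⟩ R' = R' ⟨h, (S t)₂ (S t)₁⟩`. -/
theorem pair_antipode_intertwines (hR : IsBraidedVectorDatum R R') (hlam : lam ≠ 0)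
    (ht : IsMatrixQuantumGroup r t (lam • R)) (hl : IsFRTEnveloping r t pair lp lm) (h : H)
    (i m c d : ι) :
    ∑ j, ∑ l, R' (j, l) (c, d) * pair.toFun h (antipode k (t i j) * antipode k (t m l)) =
      ∑ a, ∑ b, R' (i, m) (a, b) * pair.toFun h (antipode k (t b d) * antipode k (t a c)) := by
  let M (h : H) : Matrix (ι × ι) (ι × ι) k :=
    .of fun x y => pair.toFun h (antipode k (t x.1 y.1) * antipode k (t x.2 y.2))
  let N (h : H) : Matrix (ι × ι) (ι × ι) k :=
    .of fun x y => pair.toFun h (antipode k (t x.2 y.2) * antipode k (t x.1 y.1))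
  have key : M h * R' = R' * N h := by
    have hh : h ∈ Algebra.adjoin k ({x | ∃ i j, x = lp i j} ∪ {x | ∃ i j, x = lm i j}) := by
      rw [hl.adjoin_l]
      trivial
    induction hh using Algebra.adjoin_induction with
    | mem x hx =>
      obtain ⟨p, q, rfl⟩ | ⟨p, q, rfl⟩ := hx
      -- Both orders of the product carry the same factor `λ⁻²` for `l⁺`, and `λ²` for `l⁻` below,
      -- so the normalization drops out and only condition (i) remains.
      · have hM (i m j l : ι) : M (lp p q) (i, m) (j, l) =
            (lam⁻¹ * lam⁻¹) * (leg13 R⁻¹ * leg23 R⁻¹) (i, m, p) (j, l, q) := by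
          simp only [M, Matrix.of_apply, hl.pair_lp, r.form_mul_left, ht.comul_t, map_sum,
            TensorProduct.map_tmul, LinearMap.mul'_apply, ht.form_antipode_t,
            inv_smul_matrix hR.isUnit_R hlam, leg13_mul_leg23_apply, Matrix.smul_apply, smul_eq_mul,
            Finset.mul_sum]
          exact Finset.sum_congr rfl fun _ _ => by ring
        have hN (i m j l : ι) : N (lp p q) (i, m) (j, l) =
            (lam⁻¹ * lam⁻¹) * (leg23 R⁻¹ * leg13 R⁻¹) (i, m, p) (j, l, q) := by
          simp only [N, Matrix.of_apply, hl.pair_lp, r.form_mul_left, ht.comul_t, map_sum,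
            TensorProduct.map_tmul, LinearMap.mul'_apply, ht.form_antipode_t,
            inv_smul_matrix hR.isUnit_R hlam, leg23_mul_leg13_apply, Matrix.smul_apply, smul_eq_mul,
            Finset.mul_sum]
          exact Finset.sum_congr rfl fun _ _ => by ring
        ext ⟨i, m⟩ ⟨c, d⟩
        have := congrFun (congrFun hR.leg_inv (i, m, p)) (c, d, q)
        rw [mul_leg12_apply, leg12_mul_apply] at this
        rw [Matrix.mul_apply, Matrix.mul_apply, Fintype.sum_prod_type, Fintype.sum_prod_type]
        simp only [hM, hN, mul_assoc (lam⁻¹ * lam⁻¹), mul_left_comm _ (lam⁻¹ * lam⁻¹),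
          ← Finset.mul_sum, this]
      · have hM (i m j l : ι) : M (lm p q) (i, m) (j, l) =
            (lam * lam) * (leg12 R * leg13 R) (p, i, m) (q, j, l) := by
          simp only [M, Matrix.of_apply, hl.pair_lm_eq, r.form_mul_right, ht.comul_antipode,
            map_sum, TensorProduct.map_tmul, LinearMap.mul'_apply, LinearMap.flip_apply,
            ht.form_antipode_antipode, leg12_mul_leg13_apply, Matrix.smul_apply, smul_eq_mul,
            Finset.mul_sum]
          exact Finset.sum_congr rfl fun _ _ => by ring
        have hN (i m j l : ι) : N (lm p q) (i, m) (j, l) =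
            (lam * lam) * (leg13 R * leg12 R) (p, i, m) (q, j, l) := by
          simp only [N, Matrix.of_apply, hl.pair_lm_eq, r.form_mul_right, ht.comul_antipode,
            map_sum, TensorProduct.map_tmul, LinearMap.mul'_apply, LinearMap.flip_apply,
            ht.form_antipode_antipode, leg13_mul_leg12_apply, Matrix.smul_apply, smul_eq_mul,
            Finset.mul_sum]
          exact Finset.sum_congr rfl fun _ _ => by ring
        ext ⟨i, m⟩ ⟨c, d⟩
        have := congrFun (congrFun hR.mixed_left (p, i, m)) (q, c, d)
        rw [mul_assoc (leg23 R'), mul_leg23_apply, leg23_mul_apply] at this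
        rw [Matrix.mul_apply, Matrix.mul_apply, Fintype.sum_prod_type, Fintype.sum_prod_type]
        simp only [hM, hN, mul_assoc (lam * lam), mul_left_comm _ (lam * lam),
          ← Finset.mul_sum, this]
    | algebraMap a =>
      have h1 : M (algebraMap k H a) = a • 1 := by
        ext ⟨i, m⟩ ⟨j, l⟩
        simp only [M, Matrix.of_apply, Algebra.algebraMap_eq_smul_one, map_smul,
          LinearMap.smul_apply, pair.one_left, Bialgebra.counit_mul, ht.counit_antipode,
          Matrix.smul_apply, Matrix.one_apply, Prod.mk.injEq, ite_and, smul_eq_mul]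
        split_ifs <;> simp
      have h2 : N (algebraMap k H a) = a • 1 := by
        ext ⟨i, m⟩ ⟨j, l⟩
        simp only [N, Matrix.of_apply, Algebra.algebraMap_eq_smul_one, map_smul,
          LinearMap.smul_apply, pair.one_left, Bialgebra.counit_mul, ht.counit_antipode,
          Matrix.smul_apply, Matrix.one_apply, Prod.mk.injEq, ite_and, smul_eq_mul]
        split_ifs <;> simp
      rw [h1, h2]
      simp
    | add x y _ _ hx hy =>
      have h1 : M (x + y) = M x + M y := by
        ext
        simp [M]
      have h2 : N (x + y) = N x + N y := by
        ext
        simp [N]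
      rw [h1, h2, add_mul, mul_add, hx, hy]
    | mul x y _ _ hx hy =>
      -- The order is reversed because `S t` has the flipped matrix coproduct. The reversal is the
      -- same for `M` and `N`, so `M R' = R' N` passes to products.
      have h1 : M (x * y) = M y * M x := by
        ext ⟨i, m⟩ ⟨j, l⟩
        simp only [M, Matrix.of_apply, pair.mul_left, Bialgebra.comul_mul, ht.comul_antipode,
          Finset.sum_mul_sum, Algebra.TensorProduct.tmul_mul_tmul, map_sum, TensorProduct.map_tmul,
          LinearMap.mul'_apply, Matrix.mul_apply, Fintype.sum_prod_type, mul_comm (pair.toFun y _)]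
      have h2 : N (x * y) = N y * N x := by
        ext ⟨i, m⟩ ⟨j, l⟩
        simp only [N, Matrix.of_apply, pair.mul_left, Bialgebra.comul_mul, ht.comul_antipode,
          Finset.sum_mul_sum, Algebra.TensorProduct.tmul_mul_tmul, map_sum, TensorProduct.map_tmul,
          LinearMap.mul'_apply, Matrix.mul_apply, Fintype.sum_prod_type, mul_comm (pair.toFun y _)]
        exact Finset.sum_comm
      rw [h1, h2, mul_assoc, hx, ← mul_assoc, hy, mul_assoc]
  have := congrFun (congrFun key (i, m)) (c, d)
  simpa only [Matrix.mul_apply, Fintype.sum_prod_type, M, N, Matrix.of_apply,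
    mul_comm _ (R' _ (c, d))]
    using this

end Intertwining

/-! ### Coproducts, relations and universal R-matrix of the FRT algebra. -/

section FRT

open HopfAlgebra (antipode)

variable {k ι A H : Type*} [Field k] [Fintype ι] [DecidableEq ι] [Ring A] [HopfAlgebra k A]
  [Ring H] [HopfAlgebra k H] {r : DualQuasitriangular k A} {t : Matrix ι ι A}
  {R R' Q : Matrix (ι × ι) (ι × ι) k} {lam : k} {pair : HopfPairing k H A} {lp lm : Matrix ι ι H}

namespace IsFRTEnveloping

theorem ext_pair (hl : IsFRTEnveloping r t pair lp lm) {g h : H}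
    (hgh : ∀ a, pair.toFun g a = pair.toFun h a) : g = h := by
  rw [← sub_eq_zero]
  apply hl.separating
  simp [hgh]

theorem ext_pair_tensor (hl : IsFRTEnveloping r t pair lp lm) {z z' : H ⊗[k] H}
    (hz : ∀ x y, LinearMap.mul' k k (TensorProduct.map (pair.toFun.flip x) (pair.toFun.flip y) z) =
      LinearMap.mul' k k (TensorProduct.map (pair.toFun.flip x) (pair.toFun.flip y) z')) :
    z = z' :=
  eq_of_map_tensor hl.separating hl.separating hz

theorem comul_lp (ht : IsMatrixQuantumGroup r t Q) (hl : IsFRTEnveloping r t pair lp lm)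
    (i j : ι) : Coalgebra.comul (R := k) (lp i j) = ∑ a, lp i a ⊗ₜ[k] lp a j := by
  apply hl.ext_pair_tensor
  intro x y
  rw [← pair.mul_right]
  simp [hl.pair_lp, r.form_mul_left, ht.comul_t]

/-- Multiplicativity in the right slot and the coproduct of `S t` each reverse the order, so
together they give the same matrix coproduct as for `l⁺`. -/
theorem comul_lm (ht : IsMatrixQuantumGroup r t Q) (hl : IsFRTEnveloping r t pair lp lm)
    (i j : ι) : Coalgebra.comul (R := k) (lm i j) = ∑ a, lm i a ⊗ₜ[k] lm a j := by
  apply hl.ext_pair_tensor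
  intro x y
  rw [← pair.mul_right]
  simp [hl.pair_lm_eq, r.form_mul_right, ht.comul_antipode, mul_comm]

theorem counit_lm (ht : IsMatrixQuantumGroup r t Q) (hl : IsFRTEnveloping r t pair lp lm)
    (i j : ι) : Coalgebra.counit (R := k) (lm i j) = if i = j then 1 else 0 := by
  rw [← pair.one_right, hl.pair_lm_eq, r.form_one_right, ht.counit_antipode]

/-- The elements `b` with `𝓡( - ⊗ b)` represented in `H` form a subalgebra, which contains `t`
because `l⁺` represents it. Products are represented in reversed order. -/
theorem form_flip_mem_range (ht : IsMatrixQuantumGroup r t Q)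
    (hl : IsFRTEnveloping r t pair lp lm) (b : A) : r.form.flip b ∈ LinearMap.range pair.toFun := by
  have hb : b ∈ Algebra.adjoin k {x | ∃ i j, x = t i j} := by
    rw [ht.adjoin_t]
    trivial
  induction hb using Algebra.adjoin_induction with
  | mem x hx =>
    obtain ⟨i, j, rfl⟩ := hx
    exact ⟨lp i j, by ext a; simp [hl.pair_lp]⟩
  | algebraMap a =>
    exact ⟨algebraMap k H a, by
      ext x
      simp [Algebra.algebraMap_eq_smul_one, pair.one_left, r.form_one_right]⟩
  | add x y _ _ hx hy =>
    rw [map_add]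
    exact add_mem hx hy
  | mul x y _ _ hx hy =>
    obtain ⟨g, hg⟩ := hx
    obtain ⟨h, hh⟩ := hy
    exact ⟨h * g, by ext a; simp [pair.mul_left, r.form_mul_right, hg, hh]⟩

/-- The universal R-matrix of `H`, as a map from `A`. -/
theorem exists_represents_form (ht : IsMatrixQuantumGroup r t Q)
    (hl : IsFRTEnveloping r t pair lp lm) :
    ∃ ρ : A →ₗ[k] H, ∀ a x, pair.toFun (ρ a) x = r.form x a := by
  have hinj : Function.Injective pair.toFun := fun g h hgh =>
    hl.ext_pair fun a => LinearMap.congr_fun hgh a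
  let e := LinearEquiv.ofInjective pair.toFun hinj
  refine ⟨e.symm.toLinearMap ∘ₗ r.form.flip.codRestrict _ (hl.form_flip_mem_range ht),
    fun a x => ?_⟩
  have : pair.toFun (e.symm ⟨r.form.flip a, hl.form_flip_mem_range ht a⟩) = r.form.flip a :=
    LinearEquiv.ofInjective_symm_apply ..
  exact LinearMap.congr_fun this x

/-- Dual to multiplicativity of `𝓡` in its left slot: a representing map is a coalgebra map,
although it reverses products. -/
theorem comul_of_represents (hl : IsFRTEnveloping r t pair lp lm) {ρ : A →ₗ[k] H}
    (hρ : ∀ a x, pair.toFun (ρ a) x = r.form x a) (a : A) :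
    Coalgebra.comul (R := k) (ρ a) = TensorProduct.map ρ ρ (Coalgebra.comul a) := by
  apply hl.ext_pair_tensor
  intro x y
  rw [← pair.mul_right, hρ, r.form_mul_left]
  generalize (Coalgebra.comul a : A ⊗[k] A) = z
  induction z using TensorProduct.induction_on with
  | zero => simp
  | add x y hx hy => simp only [map_add, hx, hy]
  | tmul x y => simp [hρ]

theorem counit_of_represents {ρ : A →ₗ[k] H}
    (hρ : ∀ a x, pair.toFun (ρ a) x = r.form x a) (a : A) :
    Coalgebra.counit (R := k) (ρ a) = Coalgebra.counit (R := k) a := by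
  rw [← pair.one_right, hρ, r.form_one_left]

/-- Evaluating `l⁻ l⁻` on `x` gives `𝓡(S t S t ⊗ x) = ⟨ρ(x), S t S t⟩`, so the relation is the
intertwining property of `S t` at `h = ρ(x)`. -/
theorem lm_rel (hR : IsBraidedVectorDatum R R') (hlam : lam ≠ 0)
    (ht : IsMatrixQuantumGroup r t (lam • R)) (hl : IsFRTEnveloping r t pair lp lm) :
    IntertwinesRel R' lm := by
  obtain ⟨ρ, hρ⟩ := hl.exists_represents_form ht
  intro i m c d
  apply hl.ext_pair
  intro x
  have key (i j m l : ι) : pair.toFun (lm i j * lm m l) x =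
      pair.toFun (ρ x) (antipode k (t i j) * antipode k (t m l)) := by
    rw [hρ, pair.mul_left, r.form_mul_left]
    congr 3 <;> (ext; simp [hl.pair_lm_eq])
  simpa [key] using pair_antipode_intertwines hR hlam ht hl (ρ x) i m c d

/-- Quasi-commutativity at `S t ⊗ x`, paired with `h`: contracting `h` with `y` on the left or right
is dual to multiplying by `y` on that side, and `l⁻` is `𝓡(S t ⊗ - )`. -/
theorem exch (ht : IsMatrixQuantumGroup r t Q) (hl : IsFRTEnveloping r t pair lp lm)
    (i j : ι) (h : H) :
    ∑ m, lm m j * hitL (pair.toFun.flip (antipode k (t i m))) h =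
      ∑ m, hitR (pair.toFun.flip (antipode k (t m j))) h * lm i m := by
  apply hl.ext_pair
  intro x
  have hq := LinearMap.congr_fun r.quasi_comm (antipode k (t i j) ⊗ₜ x)
  simp only [LinearMap.comp_apply, TensorProduct.comul_tmul, ht.comul_antipode,
    TensorProduct.sum_tmul, map_sum] at hq
  have hq := congrArg (pair.toFun h) hq
  rw [map_sum, map_sum] at hq
  rw [map_sum, map_sum, LinearMap.sum_apply, LinearMap.sum_apply]
  have hL (y : A) : pair.toFun (hitL (pair.toFun.flip y) h) =
      pair.toFun h ∘ₗ LinearMap.mulLeft k y := by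
    ext x
    rw [LinearMap.comp_apply, LinearMap.mulLeft_apply, pair.mul_right, hitL]
    simp only [LinearMap.comp_apply]
    generalize (Coalgebra.comul h : H ⊗[k] H) = z
    induction z using TensorProduct.induction_on with
    | zero => simp
    | add x y hx hy => simp only [map_add, LinearMap.add_apply, hx, hy]
    | tmul x y => simp
  have hRt (y : A) : pair.toFun (hitR (pair.toFun.flip y) h) =
      pair.toFun h ∘ₗ LinearMap.mulRight k y := by
    ext x
    rw [LinearMap.comp_apply, LinearMap.mulRight_apply, pair.mul_right, hitR]
    simp only [LinearMap.comp_apply]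
    generalize (Coalgebra.comul h : H ⊗[k] H) = z
    induction z using TensorProduct.induction_on with
    | zero => simp
    | add x y hx hy => simp only [map_add, LinearMap.add_apply, hx, hy]
    | tmul x y => simp [mul_comm]
  have hlm (i j : ι) : pair.toFun (lm i j) = r.form (antipode k (t i j)) := by
    ext x
    exact hl.pair_lm_eq i j x
  simp only [pair.mul_left, hL, hRt, hlm]
  refine Eq.trans (Eq.trans ?_ hq.symm) ?_ <;> refine Finset.sum_congr rfl fun m _ => ?_ <;>
  · generalize (Coalgebra.comul x : A ⊗[k] A) = z
    induction z using TensorProduct.induction_on with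
    | zero => simp
    | add x y hx hy => simp only [map_add, TensorProduct.tmul_add, hx, hy]
    | tmul x y => simp [mul_comm]

end IsFRTEnveloping

end FRT

/-! ### Functions on the integers: commutativity, cocommutativity and group-like elements. -/

section Functions

variable {k C : Type*} [Field k] [Ring C] [HopfAlgebra k C]

namespace IntFunctions

variable (F : IntFunctions k C)

/-- Evaluation at an integer. -/
def ev (n : ℤ) : C →ₗ[k] k := LinearMap.proj n ∘ₗ F.eval.toLinearMap

theorem ev_apply (n : ℤ) (c : C) : F.ev n c = F.eval c n := rfl

theorem ext_eval {c d : C} (h : ∀ n, F.eval c n = F.eval d n) : c = d :=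
  F.injective (funext h)

theorem ext_eval_tensor {z z' : C ⊗[k] C}
    (hz : ∀ m n, LinearMap.mul' k k (TensorProduct.map (F.ev m) (F.ev n) z) =
      LinearMap.mul' k k (TensorProduct.map (F.ev m) (F.ev n) z')) : z = z' := by
  have h (c : C) (hc : ∀ n, F.ev n c = 0) : c = 0 := F.ext_eval fun n => (hc n).trans (by simp)
  exact eq_of_map_tensor h h hz

theorem commute (F : IntFunctions k C) (c d : C) : c * d = d * c :=
  F.ext_eval fun n => by simp [mul_comm]

theorem eval_hitL (n m : ℤ) (c : C) : F.eval (hitL (F.ev n) c) m = F.eval c (n + m) := by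
  rw [F.eval_add, hitL]
  simp only [LinearMap.comp_apply]
  generalize (Coalgebra.comul c : C ⊗[k] C) = z
  induction z using TensorProduct.induction_on with
  | zero => simp
  | add x y hx hy => simp only [map_add, Pi.add_apply, hx, hy]
  | tmul x y => simp [ev_apply]

theorem eval_hitR (n m : ℤ) (c : C) : F.eval (hitR (F.ev n) c) m = F.eval c (m + n) := by
  rw [F.eval_add, hitR]
  simp only [LinearMap.comp_apply]
  generalize (Coalgebra.comul c : C ⊗[k] C) = z
  induction z using TensorProduct.induction_on with
  | zero => simp
  | add x y hx hy => simp only [map_add, Pi.add_apply, hx, hy]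
  | tmul x y => simp [ev_apply, mul_comm]

/-- Both sides are the translate of `c` by `n`, since addition in `ℤ` is commutative. -/
theorem hitL_eq_hitR (n : ℤ) (c : C) : hitL (F.ev n) c = hitR (F.ev n) c :=
  F.ext_eval fun m => by rw [eval_hitL, eval_hitR, add_comm]

variable {mu : k} {c : C}

theorem comul_of_zpow (hmu : mu ≠ 0) (hc : ∀ m : ℤ, F.eval c m = mu ^ m) :
    Coalgebra.comul (R := k) c = c ⊗ₜ c := by
  apply F.ext_eval_tensor
  intro m n
  have := F.eval_add c m n
  rw [hc] at this
  refine this.symm.trans ?_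
  simp [ev_apply, hc, zpow_add₀ hmu]

theorem counit_of_zpow (hc : ∀ m : ℤ, F.eval c m = mu ^ m) : Coalgebra.counit (R := k) c = 1 := by
  rw [← F.eval_zero, hc, zpow_zero]

/-- A function `m ↦ mu ^ m` is group-like, so the antipode of `C` inverts it and all its integer
powers lie in `C`, negative ones included. -/
theorem exists_zpow (hmu : mu ≠ 0) (hc : ∀ m : ℤ, F.eval c m = mu ^ m) :
    ∃ e : ℤ → C, ∀ n m, F.eval (e n) m = (mu ^ n) ^ m := by
  have h1 := HopfAlgebra.mul_antipode_rTensor_comul_apply (R := k) c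
  have h2 := HopfAlgebra.mul_antipode_lTensor_comul_apply (R := k) c
  rw [F.comul_of_zpow hmu hc, F.counit_of_zpow hc] at h1 h2
  let u : Cˣ := ⟨c, HopfAlgebra.antipode k c, by simpa using h2, by simpa using h1⟩
  refine ⟨fun n => ((u ^ n : Cˣ) : C), fun n m => ?_⟩
  let f : C →* k := ((Pi.evalRingHom (fun _ : ℤ => k) m).comp F.eval.toRingHom : C →+* k)
  have hf (v : Cˣ) : F.eval v m = (Units.map f v : kˣ) := rfl
  rw [hf, map_zpow, Units.val_zpow_eq_zpow_val, ← hf]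
  change F.eval c m ^ n = _
  rw [hc, ← zpow_mul, ← zpow_mul, mul_comm]

end IntFunctions

end Functions

/-! ### The extended pair `H̃`, `Ã` and its action on the braided vectors. -/

section Extension

open HopfAlgebra (antipode)
open LaurentPolynomial (T)

variable {k A H C : Type*} [Field k] [Ring A] [HopfAlgebra k A] [Ring H] [HopfAlgebra k H]
  [Ring C] [HopfAlgebra k C]

@[simp]
theorem zLift_T {N : Type*} [AddCommGroup N] [Module k N] (f : ℤ → N) (n : ℤ) :
    zLift (k := k) f (T n) = f n := by
  have : AddMonoidAlgebra.coeffLinearEquiv k (T n : LaurentPolynomial k) = Finsupp.single n 1 := rfl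
  simp [zLift, this]

theorem extPair_tmul (pair : HopfPairing k H A) (F : IntFunctions k C) (h : H) (c : C) (a : A)
    (n : ℤ) : extPair pair F (h ⊗ₜ c) (a ⊗ₜ T n) = pair.toFun h a * F.ev n c := by
  simp [extPair, IntFunctions.ev]

theorem extForm_tmul (r : DualQuasitriangular k A) (lam : k) (a b : A) (m n : ℤ) :
    extForm r lam (a ⊗ₜ T m) (b ⊗ₜ T n) = r.form a b * lam ^ (-(m * n)) := by
  simp [extForm]

theorem extA_induction {p : ExtA k A → Prop} (add : ∀ x y, p x → p y → p (x + y))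
    (tmul : ∀ a n, p (a ⊗ₜ T n)) (x : ExtA k A) : p x := by
  induction x using TensorProduct.induction_on with
  | zero => simpa using tmul 0 0
  | add x y hx hy => exact add x y hx hy
  | tmul a f =>
    induction f using LaurentPolynomial.induction_on' with
    | add f g hf hg =>
      rw [TensorProduct.tmul_add]
      exact add _ _ hf hg
    | C_mul_T n c =>
      rw [← LaurentPolynomial.smul_eq_C_mul, ← TensorProduct.smul_tmul]
      exact tmul _ n

theorem comul_extA (a : A) (n : ℤ) :
    Coalgebra.comul (R := k) (a ⊗ₜ[k] (T n : LaurentPolynomial k)) =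
    TensorProduct.map ((TensorProduct.mk k A (LaurentPolynomial k)).flip (T n))
      ((TensorProduct.mk k A (LaurentPolynomial k)).flip (T n)) (Coalgebra.comul a) := by
  rw [TensorProduct.comul_tmul, LaurentPolynomial.comul_T]
  generalize (Coalgebra.comul a : A ⊗[k] A) = z
  induction z using TensorProduct.induction_on with
  | zero => simp
  | add x y hx hy => simp only [map_add, TensorProduct.add_tmul, hx, hy]
  | tmul x y => simp

theorem extPair_one (pair : HopfPairing k H A) (F : IntFunctions k C) (x : ExtA k A) :
    extPair pair F 1 x = Coalgebra.counit (R := k) x := by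
  induction x using extA_induction with
  | add x y hx hy => simp [hx, hy]
  | tmul a n =>
    rw [Algebra.TensorProduct.one_def, extPair_tmul]
    simp [pair.one_left, F.ev_apply]

theorem extPair_mul (pair : HopfPairing k H A) (F : IntFunctions k C) (g h : H ⊗[k] C)
    (x : ExtA k A) : extPair pair F (g * h) x = LinearMap.mul' k k
      (TensorProduct.map (extPair pair F g) (extPair pair F h) (Coalgebra.comul x)) := by
  induction g using TensorProduct.induction_on with
  | zero => simp
  | add g g' hg hg' => simp only [add_mul, map_add, LinearMap.add_apply, hg, hg',
      TensorProduct.map_add_left]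
  | tmul g c =>
    induction h using TensorProduct.induction_on with
    | zero => simp
    | add h h' hh hh' => simp only [mul_add, map_add, LinearMap.add_apply, hh, hh',
        TensorProduct.map_add_right]
    | tmul h d =>
      induction x using extA_induction with
      | add x y hx hy => simp only [map_add, hx, hy]
      | tmul a n =>
        rw [Algebra.TensorProduct.tmul_mul_tmul, extPair_tmul, pair.mul_left, comul_extA]
        generalize (Coalgebra.comul a : A ⊗[k] A) = z
        induction z using TensorProduct.induction_on with
        | zero => simp
        | add x y hx hy => simp only [map_add, add_mul, hx, hy]
        | tmul x y =>
          simp [extPair_tmul, F.ev_apply]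
          ring

/-- The functional `h ⊗ c ↦ f(h) g(c)`. -/
def tensorForm (f : H →ₗ[k] k) (g : C →ₗ[k] k) : H ⊗[k] C →ₗ[k] k :=
  LinearMap.mul' k k ∘ₗ TensorProduct.map f g

theorem tensorForm_tmul (f : H →ₗ[k] k) (g : C →ₗ[k] k) (h : H) (c : C) :
    tensorForm f g (h ⊗ₜ c) = f h * g c := by
  simp [tensorForm]

theorem extPair_flip (pair : HopfPairing k H A) (F : IntFunctions k C) (a : A) (n : ℤ) :
    (extPair pair F).flip (a ⊗ₜ T n) = tensorForm (pair.toFun.flip a) (F.ev n) := by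
  apply TensorProduct.ext'
  intro h c
  rw [LinearMap.flip_apply, extPair_tmul, tensorForm_tmul, LinearMap.flip_apply]

theorem hitL_tensorForm (f : H →ₗ[k] k) (g : C →ₗ[k] k) (h : H) (c : C) :
    hitL (tensorForm f g) (h ⊗ₜ[k] c) = hitL f h ⊗ₜ hitL g c := by
  simp only [hitL, LinearMap.comp_apply, TensorProduct.comul_tmul]
  generalize (Coalgebra.comul h : H ⊗[k] H) = z
  generalize (Coalgebra.comul c : C ⊗[k] C) = w
  induction z using TensorProduct.induction_on with
  | zero => simp
  | add x y hx hy => simp only [map_add, TensorProduct.add_tmul, hx, hy]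
  | tmul x y =>
    induction w using TensorProduct.induction_on with
    | zero => simp
    | add x y hx hy => simp only [map_add, TensorProduct.tmul_add, hx, hy]
    | tmul c d => simp [tensorForm_tmul, TensorProduct.smul_tmul', TensorProduct.tmul_smul,
        smul_smul, mul_comm]

theorem hitR_tensorForm (f : H →ₗ[k] k) (g : C →ₗ[k] k) (h : H) (c : C) :
    hitR (tensorForm f g) (h ⊗ₜ[k] c) = hitR f h ⊗ₜ hitR g c := by
  simp only [hitR, LinearMap.comp_apply, TensorProduct.comul_tmul]
  generalize (Coalgebra.comul h : H ⊗[k] H) = z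
  generalize (Coalgebra.comul c : C ⊗[k] C) = w
  induction z using TensorProduct.induction_on with
  | zero => simp
  | add x y hx hy => simp only [map_add, TensorProduct.add_tmul, hx, hy]
  | tmul x y =>
    induction w using TensorProduct.induction_on with
    | zero => simp
    | add x y hx hy => simp only [map_add, TensorProduct.tmul_add, hx, hy]
    | tmul c d => simp [tensorForm_tmul, TensorProduct.smul_tmul', TensorProduct.tmul_smul,
        smul_smul, mul_comm]

theorem tensorForm_convMul (f f' : H →ₗ[k] k) (g g' : C →ₗ[k] k) (h : H) (c : C) :
    (WithConv.toConv (tensorForm f g) * WithConv.toConv (tensorForm f' g')).ofConv (h ⊗ₜ[k] c) =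
      LinearMap.mul' k k (TensorProduct.map f f' (Coalgebra.comul h)) *
        LinearMap.mul' k k (TensorProduct.map g g' (Coalgebra.comul c)) := by
  rw [LinearMap.convMul_def]
  simp only [LinearMap.comp_apply, TensorProduct.comul_tmul]
  generalize (Coalgebra.comul h : H ⊗[k] H) = z
  generalize (Coalgebra.comul c : C ⊗[k] C) = w
  induction z using TensorProduct.induction_on with
  | zero => simp
  | add x y hx hy => simp only [map_add, TensorProduct.add_tmul, add_mul, hx, hy]
  | tmul x y =>
    induction w using TensorProduct.induction_on with
    | zero => simp
    | add x y hx hy => simp only [map_add, TensorProduct.tmul_add, mul_add, hx, hy]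
    | tmul c d =>
      simp [tensorForm_tmul]
      ring

theorem comul_tmul_of_comul_eq {γ : C} (hγ : Coalgebra.comul (R := k) γ = γ ⊗ₜ γ) {ι : Type*}
    [Fintype ι] {h : H} {x y : ι → H} (hh : Coalgebra.comul (R := k) h = ∑ a, x a ⊗ₜ[k] y a) :
    Coalgebra.comul (R := k) (h ⊗ₜ[k] γ) = ∑ a, (x a ⊗ₜ[k] γ) ⊗ₜ[k] (y a ⊗ₜ[k] γ) := by
  rw [TensorProduct.comul_tmul, hh, hγ, TensorProduct.sum_tmul, map_sum]
  simp

variable {ι : Type*} [Fintype ι] [DecidableEq ι] {R R' : Matrix (ι × ι) (ι × ι) k} {lam : k}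
  {r : DualQuasitriangular k A} {t : Matrix ι ι A} {pair : HopfPairing k H A} {lp lm : Matrix ι ι H}

/-- The extended FRT algebra acts on the braided vectors. -/
theorem IsFRTEnveloping.isBraidedVectorAction (hl : IsFRTEnveloping r t pair lp lm)
    (hR : IsBraidedVectorDatum R R') (hlam : lam ≠ 0) (ht : IsMatrixQuantumGroup r t (lam • R))
    (F : IntFunctions k C) {γ : C} (hγ : ∀ m : ℤ, F.eval γ m = lam ^ m) :
    IsBraidedVectorAction R R'
      (fun i j => tensorForm (pair.toFun.flip (antipode k (t i j))) (F.ev (-1)))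
      fun i j => lm i j ⊗ₜ[k] γ where
  datum := hR
  τ_one i j := by
    rw [Algebra.TensorProduct.one_def, tensorForm_tmul, LinearMap.flip_apply, pair.one_left,
      ht.counit_antipode, F.ev_apply]
    simp
  -- The flipped coproduct of `S t` accounts for the reversed order of the indices; `g⁻¹` is
  -- group-like, so evaluation at `-1` is multiplicative.
  τ_mul i j g h := by
    induction g using TensorProduct.induction_on with
    | zero => simp
    | add g g' hg hg' => simp only [add_mul, map_add, hg, hg', Finset.sum_add_distrib]
    | tmul g c =>
      induction h using TensorProduct.induction_on with
      | zero => simp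
      | add h h' hh hh' => simp only [mul_add, map_add, hh, hh', Finset.sum_add_distrib]
      | tmul h d =>
        simp only [Algebra.TensorProduct.tmul_mul_tmul, tensorForm_tmul, LinearMap.flip_apply,
          pair.mul_left, ht.comul_antipode, map_sum, TensorProduct.map_tmul, LinearMap.mul'_apply,
          F.ev_apply, map_mul, Pi.mul_apply, Finset.sum_mul]
        exact Finset.sum_congr rfl fun _ _ => by ring
  τ_rel i m c d := by
    ext1
    apply TensorProduct.ext'
    intro h x
    have := pair_antipode_intertwines hR hlam ht hl h i m c d
    simp only [pair.mul_right] at this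
    simp only [WithConv.ofConv_sum, WithConv.ofConv_smul, LinearMap.sum_apply,
      LinearMap.smul_apply, tensorForm_convMul, smul_eq_mul, ← mul_assoc, ← Finset.sum_mul, this]
  comul_l i j := comul_tmul_of_comul_eq (F.comul_of_zpow hlam hγ) (hl.comul_lm ht i j)
  counit_l i j := by
    rw [TensorProduct.counit_tmul, hl.counit_lm ht, F.counit_of_zpow hγ]
    simp
  l_rel i m c d := by
    have := hl.lm_rel hR hlam ht i m c d
    simp only [Algebra.TensorProduct.tmul_mul_tmul, TensorProduct.smul_tmul',
      ← TensorProduct.sum_tmul, this]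
  -- The factor in `C` causes no obstruction: `C` is commutative, and translations from the left and
  -- from the right coincide. What is left is the identity for `H`.
  exch i j h := by
    induction h using TensorProduct.induction_on with
    | zero => simp
    | add x y hx hy => simp only [map_add, mul_add, add_mul, Finset.sum_add_distrib, hx, hy]
    | tmul h c =>
      simp only [hitL_tensorForm, hitR_tensorForm, Algebra.TensorProduct.tmul_mul_tmul,
        ← TensorProduct.sum_tmul, hl.exch ht, F.hitL_eq_hitR, F.commute γ]
  -- Here `λ` disappears: `l⁻` on `S t` gives `λ R`, while `γ` evaluated at the exponent `-1` of
  -- `g⁻¹` gives `λ⁻¹`.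
  τ_l i j m n := by
    rw [tensorForm_tmul, LinearMap.flip_apply, hl.pair_lm_eq, ht.form_antipode_antipode,
      F.ev_apply, hγ, Matrix.smul_apply, smul_eq_mul, zpow_neg_one, mul_right_comm,
      mul_inv_cancel₀ hlam, one_mul]

end Extension

/-! ### The coaction is the action of the universal R-matrix. -/

section Coaction

variable {k ι K A : Type*} [Field k] [Fintype ι] [DecidableEq ι] [Ring K] [HopfAlgebra k K]
  [Ring A] [HopfAlgebra k A] {R R' : Matrix (ι × ι) (ι × ι) k} {τ : ι → ι → K →ₗ[k] k}
  {l : ι → ι → K}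

/-- The coaction on the braided vectors is induced by `ρ`, if this holds on generators. -/
theorem IsBraidedVectorAction.isCoactionOfForm (S : IsBraidedVectorAction R R' τ l)
    {pair : K →ₗ[k] A →ₗ[k] k} {form : A →ₗ[k] A →ₗ[k] k} (ρ : A →ₗ[k] K)
    (hρ : ∀ a x, pair (ρ a) x = form x a)
    (pair_one : ∀ a, pair 1 a = Coalgebra.counit (R := k) a)
    (pair_mul : ∀ g h a, pair (g * h) a =
      LinearMap.mul' k k (TensorProduct.map (pair g) (pair h) (Coalgebra.comul a)))
    (comul_ρ : ∀ a, Coalgebra.comul (R := k) (ρ a) = TensorProduct.map ρ ρ (Coalgebra.comul a))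
    (counit_ρ : ∀ a, Coalgebra.counit (R := k) (ρ a) = Coalgebra.counit (R := k) a)
    (hτ : ∀ i j a, pair (l i j) a = τ i j (ρ a)) :
    IsCoactionOfForm pair form S.act S.coactHom.toLinearMap := by
  refine ⟨ρ, hρ, fun a b => ?_⟩
  rw [AlgHom.toLinearMap_apply]
  -- As `ρ` is a coalgebra map, contracting `ρ(a)` with `τ` is `ρ` of `a` contracted with `l`. So
  -- `ρ(a) ▷ (p^i c)` and the evaluated coaction of `p^i c` satisfy the same recursion.
  have hit (i j : ι) (a : A) : hitL (τ i j) (ρ a) = ρ (hitL (pair (l i j)) a) := by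
    simp only [hitL, LinearMap.comp_apply, comul_ρ]
    generalize (Coalgebra.comul a : A ⊗[k] A) = z
    induction z using TensorProduct.induction_on with
    | zero => simp
    | add x y hx hy => simp only [map_add, hx, hy]
    | tmul x y => simp [hτ]
  have slice (a : A) (g : K) (c : BraidedVectors R') (z : K ⊗[k] BraidedVectors R') :
      TensorProduct.lid k _ ((pair.flip a).rTensor _ ((g ⊗ₜ c) * z)) =
        c * TensorProduct.lid k _ ((pair.flip (hitL (pair g) a)).rTensor _ z) := by
    induction z using TensorProduct.induction_on with
    | zero => simp
    | add x y hx hy => simp only [map_add, mul_add, hx, hy]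
    | tmul h d =>
      have : pair (g * h) a = pair h (hitL (pair g) a) := by
        rw [pair_mul, hitL]
        simp only [LinearMap.comp_apply]
        generalize (Coalgebra.comul a : A ⊗[k] A) = w
        induction w using TensorProduct.induction_on with
        | zero => simp
        | add x y hx hy => simp only [map_add, hx, hy]
        | tmul x y => simp
      simp [this]
  induction b using gen_induction generalizing a with
  | one => simp [S.act_one, pair_one, counit_ρ, Algebra.TensorProduct.one_def]
  | add b c hb hc => simp only [map_add, hb, hc]
  | smul x b hb => simp only [map_smul, hb]
  | gen_mul i c hc =>
    rw [map_mul, S.coactHom_gen, Finset.sum_mul, map_sum, map_sum, S.act_gen_mul]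
    simp only [slice, hc, hit]

end Coaction

end QPoincare

end

/-! ### Assembly: the explicit action, R-matrix and cross relations for `H̃`. -/

theorem proposition10 {k : Type uk} [Field k] {ι : Type uι} [Fintype ι] [DecidableEq ι]
    (R R' : Matrix (ι × ι) (ι × ι) k) (hR : IsBraidedVectorDatum R R')
    (lam : k) (hlam : lam ≠ 0)
    {A : Type uA} [Ring A] [HopfAlgebra k A] (r : DualQuasitriangular k A)
    (t : Matrix ι ι A) (ht : IsMatrixQuantumGroup r t (lam • R))
    {H : Type uH} [Ring H] [HopfAlgebra k H] (pair : HopfPairing k H A)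
    (lp lm : Matrix ι ι H) (hl : IsFRTEnveloping r t pair lp lm)
    {C : Type uC} [Ring C] [HopfAlgebra k C] (F : IntFunctions k C)
    (γ : C) (hγ : ∀ m : ℤ, F.eval γ m = lam ^ m) :
    -- `V(R')` is a braided Hopf algebra in the category of `H̃`-modules
    ∃ S : BraidedHopfStructure k (H ⊗[k] C) (BraidedVectors R'),
      -- the action is dual to the `Ã`-coaction `p^i ↦ p^j ⊗ g⁻¹ S t^i_j`
      (∀ h i, S.act h (gen R' i) = ∑ j, extPair pair F h
        (HopfAlgebra.antipode k (t i j) ⊗ₜ LaurentPolynomial.T (-1)) • gen R' j) ∧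
      IsCoactionOfForm (extPair pair F) (extForm r lam) S.act S.coact ∧
      (∀ i m, braiding S.act S.coact (gen R' i ⊗ₜ gen R' m) =
        ∑ a, ∑ b, R (i, m) (a, b) • (gen R' b ⊗ₜ[k] gen R' a)) ∧
      (∀ i, S.comul (gen R' i) = gen R' i ⊗ₜ 1 + 1 ⊗ₜ gen R' i) ∧
      (∀ i, S.counit (gen R' i) = 0) ∧
      (∀ i, S.antipode (gen R' i) = -gen R' i) ∧
      -- its bosonization exists as an ordinary Hopf algebra and is as stated
      ∃ (P : Type (max uk uι uH uC)) (_ : Ring P) (_ : HopfAlgebra k P)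
        (j : BraidedVectors R' →ₐ[k] P) (i : H ⊗[k] C →ₐc[k] P),
        IsBosonization S j i ∧
        (∀ a, i (1 ⊗ₜ γ) * j (gen R' a) = lam⁻¹ • (j (gen R' a) * i (1 ⊗ₜ γ))) ∧
        (∀ m l a, i (lp m l ⊗ₜ 1) * j (gen R' a) =
          lam⁻¹ • ∑ b, ∑ c, R⁻¹ (a, m) (b, c) • (j (gen R' b) * i (lp c l ⊗ₜ 1))) ∧
        (∀ m l a, i (lm m l ⊗ₜ 1) * j (gen R' a) =
          lam • ∑ b, ∑ c, R (m, a) (c, b) • (j (gen R' b) * i (lm c l ⊗ₜ 1))) ∧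
        (∀ a, Coalgebra.comul (R := k) (j (gen R' a)) = j (gen R' a) ⊗ₜ 1 +
          ∑ b, (i (lm a b ⊗ₜ 1) * i (1 ⊗ₜ γ)) ⊗ₜ j (gen R' b)) ∧
        (∀ m l, Coalgebra.comul (R := k) (i (lp m l ⊗ₜ 1)) =
          ∑ c, i (lp m c ⊗ₜ 1) ⊗ₜ i (lp c l ⊗ₜ 1)) ∧
        (∀ m l, Coalgebra.comul (R := k) (i (lm m l ⊗ₜ 1)) =
          ∑ c, i (lm m c ⊗ₜ 1) ⊗ₜ i (lm c l ⊗ₜ 1)) ∧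
        Coalgebra.comul (R := k) (i (1 ⊗ₜ γ)) = i (1 ⊗ₜ γ) ⊗ₜ i (1 ⊗ₜ γ) := by
  have S := hl.isBraidedVectorAction hR hlam ht F hγ
  obtain ⟨ρ, hρ⟩ := hl.exists_represents_form ht
  obtain ⟨e, he⟩ := F.exists_zpow hlam hγ
  have hcomulK (h : H ⊗[k] C) : Coalgebra.comul (R := k) (S.inKBialgHom h) =
      Algebra.TensorProduct.map S.inK S.inK (Coalgebra.comul h) := by
    rw [S.inKBialgHom_apply, S.comul_inK]
  have hcross (h : H) (c : C) (a : ι) : S.inKBialgHom (h ⊗ₜ c) * S.inB (gen R' a) =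
      ∑ b, S.inB (gen R' b) * S.inKBialgHom
        (hitL (pair.toFun.flip (HopfAlgebra.antipode k (t a b))) h ⊗ₜ hitL (F.ev (-1)) c) := by
    simp only [S.inKBialgHom_apply, S.inK_mul_inB_gen, hitL_tensorForm]
  -- For `l^± ⊗ 1` the factor `g⁻¹` contributes nothing, so the `λ^{∓1}` in the cross relations
  -- comes from the form alone; for `γ` it is the value `γ(-1)`.
  have hone : hitL (F.ev (-1)) (1 : C) = 1 := by simp [hitL_one, F.ev_apply]
  have hcomul_one : Coalgebra.comul (R := k) (1 : C) = 1 ⊗ₜ 1 := by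
    rw [Bialgebra.comul_one, Algebra.TensorProduct.one_def]
  refine ⟨S.toBraidedHopfStructure, fun h i => ?_, ?_, S.braiding_gen, S.comul_gen,
    IsBraidedVectorAction.counitHom_gen, S.antipode_gen, S.Boson, inferInstance, inferInstance, S.inB,
    S.inKBialgHom, S.isBosonization, fun a => ?_, fun m l a => ?_, fun m l a => ?_, fun a => ?_, fun m l => ?_,
    fun m l => ?_, ?_⟩
  · refine (S.act_gen h i).trans (Finset.sum_congr rfl fun j _ => ?_)
    rw [← extPair_flip, LinearMap.flip_apply]
  -- On `g^n` the representing function has to be `m ↦ λ^(-mn)`, that is `γ^(-n)`, which lies in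
  -- `C`.
  · let ρ' : ExtA k A →ₗ[k] H ⊗[k] C := TensorProduct.map ρ (zLift fun n => e (-n))
    have hρ' (a : A) (n : ℤ) : ρ' (a ⊗ₜ LaurentPolynomial.T n) = ρ a ⊗ₜ e (-n) := by simp [ρ']
    have hform (a x : ExtA k A) : extPair pair F (ρ' a) x = extForm r lam x a := by
      induction a using extA_induction with
      | add a b ha hb => simp only [map_add, LinearMap.add_apply, ha, hb]
      | tmul a n =>
        induction x using extA_induction with
        | add x y hx hy => simp only [map_add, LinearMap.add_apply, hx, hy]
        | tmul x m =>
          rw [hρ', extPair_tmul, extForm_tmul, hρ, F.ev_apply, he, ← zpow_mul]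
          congr 2
          ring
    refine S.isCoactionOfForm ρ' hform (extPair_one pair F) (extPair_mul pair F) ?_ ?_ ?_
    · intro a
      induction a using extA_induction with
      | add a b ha hb => simp only [map_add, ha, hb]
      | tmul a n =>
        rw [hρ', TensorProduct.comul_tmul, hl.comul_of_represents hρ,
          F.comul_of_zpow (zpow_ne_zero _ hlam) (he _), comul_extA]
        generalize (Coalgebra.comul a : A ⊗[k] A) = z
        induction z using TensorProduct.induction_on with
        | zero => simp
        | add x y hx hy => simp only [map_add, TensorProduct.add_tmul, hx, hy]
        | tmul x y => simp [hρ']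
    · intro a
      induction a using extA_induction with
      | add a b ha hb => simp only [map_add, ha, hb]
      | tmul a n =>
        rw [hρ', TensorProduct.counit_tmul, IsFRTEnveloping.counit_of_represents hρ,
          F.counit_of_zpow (he _), TensorProduct.counit_tmul, LaurentPolynomial.counit_T]
    · intro i j a
      -- On `a g^n` both sides become `𝓡(S t ⊗ a) λ^n`: the exponent `-1` of `g⁻¹` cancels the sign
      -- in the extended form, matching `γ(n)`.
      rw [← extPair_flip, LinearMap.flip_apply, hform]
      induction a using extA_induction with
      | add a b ha hb => simp only [map_add, ha, hb]
      | tmul a n =>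
        rw [extPair_tmul, extForm_tmul, hl.pair_lm_eq, F.ev_apply, hγ]
        simp
  · have h1 (b : ι) : hitL (pair.toFun.flip (HopfAlgebra.antipode k (t a b))) (1 : H) =
        if a = b then 1 else 0 := by
      rw [hitL_one, LinearMap.flip_apply, pair.one_left, ht.counit_antipode]
      simp
    have h2 : hitL (F.ev (-1)) γ = lam⁻¹ • γ := by
      simp [hitL, F.comul_of_zpow hlam hγ, F.ev_apply, hγ]
    rw [hcross, Finset.sum_eq_single a]
    · simp [h1, h2]
    · intro b _ hb
      simp [h1, hb.symm]
    · simp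
  · have h1 (b : ι) : hitL (pair.toFun.flip (HopfAlgebra.antipode k (t a b))) (lp m l) =
        ∑ c, (lam⁻¹ * R⁻¹ (a, m) (b, c)) • lp c l := by
      simp [hitL, hl.comul_lp ht, hl.pair_lp, ht.form_antipode_t,
        inv_smul_matrix hR.isUnit_R hlam]
    simp only [hcross, h1, hone, TensorProduct.sum_tmul, ← TensorProduct.smul_tmul', map_sum,
      map_smul, Finset.mul_sum, mul_smul_comm, Finset.smul_sum, smul_smul]
  · have h1 (b : ι) : hitL (pair.toFun.flip (HopfAlgebra.antipode k (t a b))) (lm m l) =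
        ∑ c, (lam * R (m, a) (c, b)) • lm c l := by
      simp [hitL, hl.comul_lm ht, hl.pair_lm_eq, ht.form_antipode_antipode]
    simp only [hcross, h1, hone, TensorProduct.sum_tmul, ← TensorProduct.smul_tmul', map_sum,
      map_smul, Finset.mul_sum, mul_smul_comm, Finset.smul_sum, smul_smul]
  · have h1 (b : ι) : (lm a b ⊗ₜ[k] (1 : C)) * (1 ⊗ₜ γ) = lm a b ⊗ₜ γ := by simp
    rw [S.comul_inB_gen]
    simp only [S.inKBialgHom_apply, ← map_mul, h1]
  · rw [hcomulK, comul_tmul_of_comul_eq hcomul_one (hl.comul_lp ht m l)]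
    simp [S.inKBialgHom_apply]
  · rw [hcomulK, comul_tmul_of_comul_eq hcomul_one (hl.comul_lm ht m l)]
    simp [S.inKBialgHom_apply]
  · have h1 : Coalgebra.comul (R := k) (1 : H) = ∑ _ : Unit, 1 ⊗ₜ 1 := by
      simp [Algebra.TensorProduct.one_def]
    rw [hcomulK, comul_tmul_of_comul_eq (F.comul_of_zpow hlam hγ) h1]
    simp [S.inKBialgHom_apply]
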